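/- **Setting.** Let $A_k$ be random $M_k\times N_k$ real matrices with $N_k\to\infty$ and $M_k/N_k\to\delta$, such that almost surely the empirical eigenvalue distribution of $A_k^{\mathsf T}A_k$ converges weakly to a deterministic probability measure $\nu$ (necessarily on $[0,\infty)$). Assume that all moments $\mu_j=\int\lambda^j\,d\nu(\lambda)$ are finite. Let $\eta(z)=\int(1+z\lambda)^{-1}d\nu(\lambda)$ for $z\ge0$, which is the almost sure limit of $N^{-1}\mathrm{Tr}\{(I+zA^{\mathsf T}A)^{-1}\}$. The R-transform $R$ is defined by $\eta(z)=1/(1+zR(-z\eta(z)))$ for $z>0$, with $R(0)=\lim_{y\uparrow0}R(y)$. It is called proper for all $z\le0$ if $z\eta(z)\to\infty$ as $z\to\infty$ (so that its domain is $(-\infty,0]$) and $\mu_2>\mu_1^2$. Let $x_1$ be a real random variable and $z_1\sim\mathcal N(0,1)$ independent of $x_1$. Put $I(s)=I(x_1;\sqrt s\,x_1+z_1)$ (in nats) and $\mathrm{MMSE}(s)=\mathbb E[(x_1-\mathbb E[x_1\mid\sqrt s\,x_1+z_1])^2]$ for $s\ge0$. The variable $x_1$ has Rényi information dimension $d_{\mathrm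 I}$ if $H(\lfloor nx_1\rfloor/n)/\log n\to d_{\mathrm I}$ as $n\to\infty$, where $H$ is the (finite) Shannon entropy. For $\sigma^2>0$, $E\in[0,1]$, $s\ge0$ let $$f_{\mathrm{RS}}(E,s)=I(s)+\frac12\int_0^{E/\sigma^2}R(-z)\,dz-\frac{sE}{2}.$$ An optimizer of $\inf_{s\ge0}\sup_{E\in[0,1]}f_{\mathrm{RS}}(E,s)$ is a pair $(E_{\mathrm{opt}},s_{\mathrm{opt}})\in[0,1]\times[0,\infty)$ such that $s_{\mathrm{opt}}$ attains the infimum over $s$ and $E_{\mathrm{opt}}$ attains the supremum over $E$ for $s=s_{\mathrm{opt}}$. **Theorem.** Assume that $\mathbb E[x_1^2]=1$ and that $x_1$ has Rényi information dimension $d_{\mathrm I}$; that $R$ is proper, continuous, non-decreasing and positive for all $z\le0$; and that $\lim_{z\to\infty}zR(-z)=\delta$. Then: 1. For every $\sigma^2>0$ an optimizer exists. 2. Suppose $\delta\ne d_{\mathrm I}$. For every family of optimizers $(E_{\mathrm{opt}},s_{\mathrm{opt}})$, one for each sufficiently small $\sigma^2>0$, the family is noise-limited, i.e. $E_{\mathrm{opt}}\to0$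 and $s_{\mathrm{opt}}\to\infty$ as $\sigma^2\downarrow0$, if and only if $\delta>d_{\mathrm I}$. 3. If $\delta>d_{\mathrm I}$, the optimizer is unique as $\sigma^2\downarrow0$ in the following sense. For all $\varepsilon>0$ and $S$, for all sufficiently small $\sigma^2>0$, every optimizer satisfies $E_{\mathrm{opt}}<\varepsilon$ and $s_{\mathrm{opt}}>S$, so that $(0,\infty)$ is the unique limit of optimizers. If moreover $x_1$ is not almost surely constant and has an MMSE dimension, i.e. $\lim_{s\to\infty}s\,\mathrm{MMSE}(s)$ exists, then for all sufficiently small $\sigma^2>0$ there is exactly one optimizer. -/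

import Mathlib

namespace CompressedSensing

open MeasureTheory ProbabilityTheory Filter Topology Set

/-! ### The sensing matrices and their asymptotic eigenvalue distribution -/

theorem isHermitian_gram {m n : ℕ} (B : Matrix (Fin m) (Fin n) ℝ) :
    (B.transpose * B).IsHermitian := by
  simpa using Matrix.isHermitian_conjTranspose_mul_self B

/-- The eigenvalues, with multiplicity, of `Bᵀ B`. -/
noncomputable def gramEigenvalues {m n : ℕ} (B : Matrix (Fin m) (Fin n) ℝ) : Fin n → ℝ :=
  (isHermitian_gram B).eigenvalues

/-- Almost surely, the empirical eigenvalue distributions of `Aₖᵀ Aₖ` (with `Aₖ` a random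
`Mₖ × Nₖ` matrix) converge weakly to the deterministic measure `ν`. -/
def HasLimitingSpectrum {Ω : Type*} [MeasurableSpace Ω] (P : Measure Ω) {M N : ℕ → ℕ}
    (A : (k : ℕ) → Ω → Matrix (Fin (M k)) (Fin (N k)) ℝ) (ν : Measure ℝ) : Prop :=
  ∀ᵐ ω ∂P, ∀ f : BoundedContinuousFunction ℝ ℝ,
    Tendsto (fun k => (N k : ℝ)⁻¹ * ∑ i, f (gramEigenvalues (A k ω) i)) atTop
      (𝓝 (∫ x, f x ∂ν))

/-- The `j`-th moment of the asymptotic eigenvalue distribution. -/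
noncomputable def spectralMoment (ν : Measure ℝ) (j : ℕ) : ℝ := ∫ x, x ^ j ∂ν

/-- The `η`-transform of the asymptotic eigenvalue distribution; it is the almost sure limit of
`N⁻¹ Tr (I + z Aᵀ A)⁻¹`, see `tendsto_trace_etaTransform`. -/
noncomputable def etaTransform (ν : Measure ℝ) (z : ℝ) : ℝ := ∫ x, (1 + z * x)⁻¹ ∂ν

/-- The value of the R-transform at `y < 0`: for `y = -w η(w)` with `w > 0`
it is `(1 - η(w)) / (w η(w))`. -/
noncomputable def rTransformNeg (ν : Measure ℝ) (y : ℝ) : ℝ :=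
  let w := Function.invFunOn (fun w => w * etaTransform ν w) (Ioi 0) (-y)
  (1 - etaTransform ν w) / (w * etaTransform ν w)

/-- The R-transform, determined on `(z_min, 0)` by `η(z) = 1 / (1 + z R(-z η(z)))`
(see `etaTransform_eq_rTransform`), with `R(0) = lim_{y ↑ 0} R(y)`. -/
noncomputable def rTransform (ν : Measure ℝ) (y : ℝ) : ℝ :=
  if y = 0 then limUnder (𝓝[<] 0) (rTransformNeg ν) else rTransformNeg ν y

/-- The R-transform is proper for all `z ≤ 0`: `z η(z) → ∞`, so that the domain of `R` is
`(-∞, 0]`, and `μ₂ > μ₁²`. -/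
def RTransformProper (ν : Measure ℝ) : Prop :=
  Tendsto (fun z => z * etaTransform ν z) atTop atTop ∧
    spectralMoment ν 1 ^ 2 < spectralMoment ν 2

/-! ### The signal and its scalar Gaussian channel -/

/-- The joint law of `(x₁, z₁)` with `x₁ ∼ p` and `z₁ ∼ N(0, 1)` independent. -/
noncomputable def signalNoise (p : Measure ℝ) : Measure (ℝ × ℝ) := p.prod (gaussianReal 0 1)

/-- The observation `√s x₁ + z₁`. -/
noncomputable def observation (s : ℝ) (q : ℝ × ℝ) : ℝ := Real.sqrt s * q.1 + q.2

/-- The mutual information, in nats, of the two coordinates under the joint law `J`. -/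
noncomputable def mutualInfoOf (J : Measure (ℝ × ℝ)) : ℝ :=
  (InformationTheory.klDiv J (J.fst.prod J.snd)).toReal

/-- `I(s) = I(x₁; √s x₁ + z₁)`. -/
noncomputable def mutualInfo (p : Measure ℝ) (s : ℝ) : ℝ :=
  mutualInfoOf ((signalNoise p).map (fun q => (q.1, observation s q)))

/-- `MMSE(s) = 𝔼[(x₁ - 𝔼[x₁ | √s x₁ + z₁])²]`. -/
noncomputable def mmse (p : Measure ℝ) (s : ℝ) : ℝ :=
  ∫ q, (q.1 - condExp (MeasurableSpace.comap (observation s) inferInstance) (signalNoise p)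
    (fun r : ℝ × ℝ => r.1) q) ^ 2 ∂(signalNoise p)

/-- `Pr(⌊n X⌋ = k)` for `X ∼ p`. -/
noncomputable def quantProb (p : Measure ℝ) (n : ℕ) (k : ℤ) : ℝ :=
  p.real {x : ℝ | ⌊(n : ℝ) * x⌋ = k}

/-- A variable with law `p` has Rényi information dimension `d`: the entropies of `⌊n X⌋ / n`
are finite and, divided by `log n`, converge to `d`. -/
def HasRenyiInfoDim (p : Measure ℝ) (d : ℝ) : Prop :=
  (∀ n : ℕ, Summable fun k : ℤ => Real.negMulLog (quantProb p n k)) ∧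
    Tendsto (fun n : ℕ => (∑' k : ℤ, Real.negMulLog (quantProb p n k)) / Real.log n) atTop (𝓝 d)

/-- The limit of `s · MMSE(s)` as `s → ∞` exists. -/
def HasMMSEDimension (p : Measure ℝ) : Prop :=
  ∃ D : ℝ, Tendsto (fun s => s * mmse p s) atTop (𝓝 D)

/-! ### The replica-symmetric potential and the inf-sup problem -/

/-- The replica-symmetric potential at noise variance `v = σ²`. -/
noncomputable def rsPotential (p ν : Measure ℝ) (v E s : ℝ) : ℝ :=
  mutualInfo p s + (1 / 2) * (∫ z in (0 : ℝ)..(E / v), rTransform ν (-z)) - s * E / 2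

/-- `q = (E, s)` is an optimizer of `inf_{s ≥ 0} sup_{E ∈ [0, 1]} f_RS(E, s)` at noise variance
`v`: `s` attains the infimum, and `E` attains the supremum for this `s`. -/
def IsInfSupOptimizer (p ν : Measure ℝ) (v : ℝ) (q : ℝ × ℝ) : Prop :=
  q.1 ∈ Icc (0 : ℝ) 1 ∧ q.2 ∈ Ici (0 : ℝ) ∧
    IsMinOn (fun s => ⨆ E : Icc (0 : ℝ) 1, rsPotential p ν v E s) (Ici 0) q.2 ∧
    IsMaxOn (fun E => rsPotential p ν v E q.2) (Icc 0 1) q.1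

/-- A family of pairs `(E, s)` indexed by the noise variance is noise-limited: `E → 0` and
`s → ∞` as the noise variance decreases to `0`. -/
def NoiseLimited (Q : ℝ → ℝ × ℝ) : Prop :=
  Tendsto (fun v => (Q v).1) (𝓝[>] 0) (𝓝 0) ∧ Tendsto (fun v => (Q v).2) (𝓝[>] 0) atTop

/-! ### Consistency of the transforms with their usual characterizations -/

theorem integrable_eta {ν : Measure ℝ} [IsProbabilityMeasure ν] (hν : ∀ᵐ x ∂ν, 0 ≤ x) {z : ℝ}
    (hz : 0 ≤ z) : Integrable (fun x => (1 + z * x)⁻¹) ν := by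
  refine Integrable.of_bound (C := 1) (by fun_prop) ?_
  filter_upwards [hν] with x hx
  have : 0 ≤ z * x := mul_nonneg hz hx
  rw [Real.norm_eq_abs, abs_of_nonneg (by positivity)]
  exact inv_le_one_of_one_le₀ (by linarith)

theorem etaTransform_pos {ν : Measure ℝ} [IsProbabilityMeasure ν] (hν : ∀ᵐ x ∂ν, 0 ≤ x) {z : ℝ}
    (hz : 0 ≤ z) : 0 < etaTransform ν z := by
  have hpos : ∀ᵐ x ∂ν, 0 < (1 + z * x)⁻¹ := by
    filter_upwards [hν] with x hx
    have : 0 ≤ z * x := mul_nonneg hz hx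
    positivity
  have h0 : 0 ≤ etaTransform ν z :=
    integral_nonneg_of_ae (hpos.mono fun x hx => hx.le)
  rcases h0.lt_or_eq with h | h
  · exact h
  · have := (integral_eq_zero_iff_of_nonneg_ae (hpos.mono fun x hx => hx.le)
      (integrable_eta hν hz)).1 h.symm
    obtain ⟨x, hx, hx'⟩ := (hpos.and this).exists
    simp only [Pi.zero_apply] at hx'
    exact absurd hx' hx.ne'

theorem injOn_mul_etaTransform {ν : Measure ℝ} [IsProbabilityMeasure ν]
    (hν : ∀ᵐ x ∂ν, 0 ≤ x) : InjOn (fun w => w * etaTransform ν w) (Ioi 0) := by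
  have hmono : StrictMonoOn (fun w => w * etaTransform ν w) (Ioi 0) := by
    intro a ha b hb hab
    have ha' : (0 : ℝ) < a := ha
    have hb' : (0 : ℝ) < b := hb
    have hia := (integrable_eta hν ha'.le).const_mul a
    have hib := (integrable_eta hν hb'.le).const_mul b
    have hpos : ∀ᵐ x ∂ν, 0 < b * (1 + b * x)⁻¹ - a * (1 + a * x)⁻¹ := by
      filter_upwards [hν] with x hx
      have h1 : 0 < 1 + a * x := by positivity
      have h2 : 0 < 1 + b * x := by positivity
      have : b * (1 + b * x)⁻¹ - a * (1 + a * x)⁻¹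
          = (b - a) / ((1 + b * x) * (1 + a * x)) := by
        field_simp
        ring
      rw [this]
      exact div_pos (by linarith) (by positivity)
    have h0 : 0 ≤ ∫ x, (b * (1 + b * x)⁻¹ - a * (1 + a * x)⁻¹) ∂ν :=
      integral_nonneg_of_ae (hpos.mono fun x hx => hx.le)
    have h1 : 0 < ∫ x, (b * (1 + b * x)⁻¹ - a * (1 + a * x)⁻¹) ∂ν := by
      rcases h0.lt_or_eq with h | h
      · exact h
      · have := (integral_eq_zero_iff_of_nonneg_ae (hpos.mono fun x hx => hx.le)
          (hib.sub hia)).1 h.symm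
        obtain ⟨x, hx, hx'⟩ := (hpos.and this).exists
        simp only [Pi.zero_apply] at hx'
        exact absurd hx' hx.ne'
    rw [integral_sub hib hia, integral_const_mul, integral_const_mul] at h1
    simp only [etaTransform]
    linarith
  exact hmono.injOn

/-- The implicit equation that defines the R-transform. -/
theorem etaTransform_eq_rTransform {ν : Measure ℝ} [IsProbabilityMeasure ν]
    (hν : ∀ᵐ x ∂ν, 0 ≤ x) {z : ℝ} (hz : 0 < z) :
    etaTransform ν z = 1 / (1 + z * rTransform ν (-(z * etaTransform ν z))) := by
  have hη := etaTransform_pos hν hz.le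
  have hinv : Function.invFunOn (fun w => w * etaTransform ν w) (Ioi 0) (z * etaTransform ν z) = z :=
    (injOn_mul_etaTransform hν).leftInvOn_invFunOn (show z ∈ Ioi 0 from hz)
  have hne : -(z * etaTransform ν z) ≠ 0 := by
    have : 0 < z * etaTransform ν z := by positivity
    linarith
  rw [rTransform, if_neg hne, rTransformNeg, neg_neg, hinv]
  field_simp
  ring

theorem gramEigenvalues_nonneg {m n : ℕ} (B : Matrix (Fin m) (Fin n) ℝ) (i : Fin n) :
    0 ≤ gramEigenvalues B i := by
  have h : (B.transpose * B).PosSemidef := by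
    simpa using Matrix.posSemidef_conjTranspose_mul_self B
  exact h.eigenvalues_nonneg i

theorem trace_inv_one_add {m n : ℕ} (B : Matrix (Fin m) (Fin n) ℝ) {z : ℝ} (hz : 0 ≤ z) :
    Matrix.trace ((1 + z • (B.transpose * B))⁻¹) = ∑ i, (1 + z * gramEigenvalues B i)⁻¹ := by
  have hs := (isHermitian_gram B).spectral_theorem
  rw [Unitary.conjStarAlgAut_apply] at hs
  set U : Matrix (Fin n) (Fin n) ℝ := (isHermitian_gram B).eigenvectorUnitary.1 with hU
  have h1 : U * star U = 1 := Unitary.coe_mul_star_self _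
  have h2 : star U * U = 1 := Unitary.coe_star_mul_self _
  have hl : ∀ i, 1 + z * gramEigenvalues B i ≠ 0 := fun i => by
    have := mul_nonneg hz (gramEigenvalues_nonneg B i)
    positivity
  have hG : 1 + z • (B.transpose * B)
      = U * Matrix.diagonal (fun i => 1 + z * gramEigenvalues B i) * star U := by
    have hd : Matrix.diagonal (fun i => 1 + z * gramEigenvalues B i)
        = 1 + z • Matrix.diagonal (gramEigenvalues B) := by
      rw [← Matrix.diagonal_one, ← Matrix.diagonal_smul, Matrix.diagonal_add]
      rfl
    rw [hd, mul_add, add_mul, mul_one, h1, Matrix.mul_smul, Matrix.smul_mul]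
    congr 2
  have hinv : (1 + z • (B.transpose * B))⁻¹
      = U * Matrix.diagonal (fun i => (1 + z * gramEigenvalues B i)⁻¹) * star U := by
    apply Matrix.inv_eq_right_inv
    rw [hG]
    calc _ = U * Matrix.diagonal (fun i => 1 + z * gramEigenvalues B i) * (star U * U)
          * Matrix.diagonal (fun i => (1 + z * gramEigenvalues B i)⁻¹) * star U := by
            simp only [mul_assoc]
      _ = U * (Matrix.diagonal (fun i => 1 + z * gramEigenvalues B i)
          * Matrix.diagonal (fun i => (1 + z * gramEigenvalues B i)⁻¹)) * star U := by
            rw [h2]; simp only [mul_assoc, one_mul]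
      _ = 1 := by
            rw [Matrix.diagonal_mul_diagonal]
            simp only [mul_inv_cancel₀ (hl _), Matrix.diagonal_one, mul_one, h1]
  rw [hinv, Matrix.trace_mul_cycle, h2, one_mul, Matrix.trace_diagonal]

/-- The asymptotic eigenvalue distribution lives on `[0, ∞)`. -/
theorem HasLimitingSpectrum.ae_nonneg {Ω : Type*} [MeasurableSpace Ω] {P : Measure Ω}
    [IsProbabilityMeasure P] {M N : ℕ → ℕ}
    {A : (k : ℕ) → Ω → Matrix (Fin (M k)) (Fin (N k)) ℝ} {ν : Measure ℝ} [IsProbabilityMeasure ν]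
    (hA : HasLimitingSpectrum P A ν) : ∀ᵐ x ∂ν, 0 ≤ x := by
  obtain ⟨ω, hω⟩ := hA.exists
  let f : BoundedContinuousFunction ℝ ℝ :=
    BoundedContinuousFunction.ofNormedAddCommGroup (fun x => min (max (-x) 0) 1)
      (by fun_prop) 1 (fun x => by
        rw [Real.norm_eq_abs, abs_of_nonneg (le_min (le_max_right _ _) zero_le_one)]
        exact min_le_right _ _)
  have hf : ∀ x, f x = min (max (-x) 0) 1 := fun x => rfl
  have h0 : ∫ x, f x ∂ν = 0 := by
    refine tendsto_nhds_unique (hω f) ?_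
    have : (fun k => (N k : ℝ)⁻¹ * ∑ i, f (gramEigenvalues (A k ω) i)) = fun _ => 0 := by
      funext k
      rw [Finset.sum_eq_zero, mul_zero]
      intro i _
      rw [hf, max_eq_right (by linarith [gramEigenvalues_nonneg (A k ω) i])]
      simp
    rw [this]
    exact tendsto_const_nhds
  have h1 := (integral_eq_zero_iff_of_nonneg
    (fun x => by rw [hf]; exact le_min (le_max_right _ _) zero_le_one) (f.integrable ν)).1 h0
  filter_upwards [h1] with x hx
  by_contra hneg
  push Not at hneg
  rw [hf, Pi.zero_apply] at hx
  have : 0 < min (max (-x) 0) 1 := lt_min (lt_max_of_lt_left (by linarith)) one_pos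
  linarith

/-- `η(z)` is the almost sure limit of `N⁻¹ Tr (I + z Aᵀ A)⁻¹`. -/
theorem tendsto_trace_etaTransform {Ω : Type*} [MeasurableSpace Ω] {P : Measure Ω}
    [IsProbabilityMeasure P] {M N : ℕ → ℕ}
    {A : (k : ℕ) → Ω → Matrix (Fin (M k)) (Fin (N k)) ℝ} {ν : Measure ℝ} [IsProbabilityMeasure ν]
    (hA : HasLimitingSpectrum P A ν) {z : ℝ} (hz : 0 ≤ z) :
    ∀ᵐ ω ∂P, Tendsto
      (fun k => (N k : ℝ)⁻¹ *
        Matrix.trace ((1 + z • ((A k ω).transpose * A k ω))⁻¹)) atTop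
      (𝓝 (etaTransform ν z)) := by
  have hpos : ∀ x : ℝ, 1 ≤ 1 + z * max x 0 := fun x => by
    have := mul_nonneg hz (le_max_right x 0)
    linarith
  let f : BoundedContinuousFunction ℝ ℝ :=
    BoundedContinuousFunction.ofNormedAddCommGroup (fun x => (1 + z * max x 0)⁻¹)
      (Continuous.inv₀ (by fun_prop) fun x => by linarith [hpos x]) 1 (fun x => by
        rw [Real.norm_eq_abs, abs_of_nonneg (by have := hpos x; positivity)]
        exact inv_le_one_of_one_le₀ (hpos x))
  have hf : ∀ x, f x = (1 + z * max x 0)⁻¹ := fun x => rfl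
  have hη : etaTransform ν z = ∫ x, f x ∂ν := by
    refine integral_congr_ae ?_
    filter_upwards [hA.ae_nonneg] with x hx
    rw [hf, max_eq_left hx]
  rw [hη]
  filter_upwards [hA] with ω hω
  refine (hω f).congr fun k => ?_
  rw [trace_inv_one_add _ hz]
  congr 1
  refine Finset.sum_congr rfl fun i _ => ?_
  rw [hf, max_eq_left (gramEigenvalues_nonneg _ i)]

end CompressedSensing

namespace CompressedSensing

open MeasureTheory ProbabilityTheory Filter Topology Set

/-! ### The Gaussian channel -/

/-! Write `r z = R(-z)`, a positive decreasing function with `z * r z → δ`, so that `∫₀ᵀ r` grows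
like `δ log T`. Two facts decide the phase transition. First, `I(s)` grows like `(dI/2) log s`
(`tendsto_mutualInfo_div_log`): up to additive constants, `I(s)` is the entropy of the signal
quantized at scale `1/⌊√s⌋`. Second, the inf-sup problem compares this growth with that of `∫ r`.

At `s = r(0)/σ²` the supremum over `E` is attained at `E = 0`, so the optimal value is at most
`I(r(0)/σ²)`, about `(dI/2) log(1/σ²)`. At bounded `s`, the choice `E = 1` costs about `(δ/2)
log(1/σ²)`. For `dI < δ` optimizers therefore escape to large `s` (`eventually_lt_snd_optimizer`).
Then `E` tends to zero, because `E ≥ ε` would force `s ≤ r(ε/(2σ²))/σ²`, which stays bounded. For `δ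
< dI`, comparing `s` with `0` through the test point `E = 1/s` gives `I(s) ≤ (δ'/2) log s + const`
with `δ' < dI`, so `s` stays bounded (`exists_snd_optimizer_le`).

For uniqueness, an optimizer with `0 < E < 1` and `s > 0` satisfies `E = MMSE(s)` and `σ² s =
r(E/σ²)`; hence `s MMSE(s) = z r(z)` with `z = E/σ²`. The limit of `s MMSE(s)` is at most `dI < δ`,
which confines `z` to a bounded interval. There `z r(z)` increases at a definite rate compared with
the decrease of `r` (`exists_mul_rTransform_increment`). On the other side, `s MMSE(s)` can fall
only arbitrarily slowly relative to `log s` (`eventually_mul_slope_sub_le`). Two distinct optimizers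
would violate one of these rates.

The slow variation is a one-sided Tauberian statement: convergence of `s MMSE(s)` alone does not
control its local rate, but concavity of `MMSE(s) - c/s`, with `c` the sixth Gaussian moment, does.
That concavity and the relation `I' = MMSE/2` come from the heat-flow structure of output moments
and Gaussian integration by parts, for bounded signals first. Truncation then carries over the
inequalities, which survive pointwise limits. -/

/-- The standard normal law. -/
noncomputable abbrev stdGaussian : Measure ℝ := gaussianReal 0 1

/-- Density of the output of the channel with signal `x` and signal-to-noise ratio `t` with respect
to the standard normal law. -/
noncomputable def chanKernel (t x y : ℝ) : ℝ := Real.exp (x * (√t * y) - t * x ^ 2 / 2)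

/-- The moments of the signal law weighted by the likelihood of the output `y`. -/
noncomputable def chanMoment (q : Measure ℝ) (k : ℕ) (t y : ℝ) : ℝ :=
  ∫ x, x ^ k * chanKernel t x y ∂q

/-- Joint law of signal and channel output. -/
noncomputable def chanLaw (q : Measure ℝ) (t : ℝ) : Measure (ℝ × ℝ) :=
  (signalNoise q).map (fun r => (r.1, observation t r))

theorem chanKernel_pos (t x y : ℝ) : 0 < chanKernel t x y := Real.exp_pos _

theorem measurable_chanKernel (t : ℝ) : Measurable (fun r : ℝ × ℝ => chanKernel t r.1 r.2) := by
  unfold chanKernel; fun_prop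

theorem measurable_observation (t : ℝ) : Measurable (observation t) := by
  unfold observation; fun_prop

theorem chanKernel_eq {t : ℝ} (ht : 0 ≤ t) (x y : ℝ) :
    chanKernel t x y = Real.exp (y ^ 2 / 2) * Real.exp (-(y - √t * x) ^ 2 / 2) := by
  rw [chanKernel, ← Real.exp_add]
  congr 1
  nlinarith [Real.sq_sqrt ht]

theorem chanKernel_le {t : ℝ} (ht : 0 ≤ t) (x y : ℝ) :
    chanKernel t x y ≤ Real.exp (y ^ 2 / 2) := by
  rw [chanKernel_eq ht]
  refine mul_le_of_le_one_right (Real.exp_pos _).le (Real.exp_le_one_iff.2 ?_)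
  nlinarith [sq_nonneg (y - √t * x)]

theorem gaussianReal_eq_withDensity (m : ℝ) :
    gaussianReal m 1
      = stdGaussian.withDensity (fun y => ENNReal.ofReal (Real.exp (m * y - m ^ 2 / 2))) := by
  rw [stdGaussian, gaussianReal_of_var_ne_zero _ one_ne_zero,
    gaussianReal_of_var_ne_zero _ one_ne_zero,
    ← withDensity_mul _ (measurable_gaussianPDF _ _) (by fun_prop)]
  congr 1
  ext y
  simp only [Pi.mul_apply, gaussianPDF]
  rw [← ENNReal.ofReal_mul (gaussianPDFReal_nonneg _ _ _)]
  congr 1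
  simp only [gaussianPDFReal]
  rw [mul_assoc _ (Real.exp _) (Real.exp _), ← Real.exp_add]
  congr 2
  simp only [NNReal.coe_one]
  ring

/-- Given signal `x`, the output is `N(√t x, 1)`, with density `chanKernel` against the standard
normal. The reference measure is now fixed and all dependence on `t` sits in the integrand, where it
can be differentiated. -/
theorem chanLaw_eq (q : Measure ℝ) [IsFiniteMeasure q] {t : ℝ} (ht : 0 ≤ t) :
    chanLaw q t
      = (q.prod stdGaussian).withDensity (fun r => ENNReal.ofReal (chanKernel t r.1 r.2)) := by
  have hm : Measurable (fun r : ℝ × ℝ => (r.1, observation t r)) :=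
    measurable_fst.prodMk (measurable_observation t)
  refine Measure.ext_of_lintegral _ fun f hf => ?_
  have hk : Measurable (fun r : ℝ × ℝ => ENNReal.ofReal (chanKernel t r.1 r.2)) :=
    (measurable_chanKernel t).ennreal_ofReal
  have hfm : Measurable (fun r : ℝ × ℝ => f (r.1, observation t r)) := hf.comp hm
  rw [chanLaw, lintegral_map hf hm, lintegral_withDensity_eq_lintegral_mul _ hk hf, signalNoise,
    lintegral_prod _ hfm.aemeasurable, lintegral_prod _ (hk.mul hf).aemeasurable]
  refine lintegral_congr fun x => ?_
  have h1 : ∫⁻ z, f (x, observation t (x, z)) ∂(gaussianReal 0 1)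
      = ∫⁻ y, f (x, y) ∂(gaussianReal (√t * x) 1) := by
    have := gaussianReal_map_const_add (μ := 0) (v := 1) (√t * x)
    rw [zero_add] at this
    rw [← this, lintegral_map (by fun_prop) (by fun_prop)]
    rfl
  rw [h1, gaussianReal_eq_withDensity,
    lintegral_withDensity_eq_lintegral_mul _ (by fun_prop) (by fun_prop)]
  refine lintegral_congr fun y => ?_
  simp only [Pi.mul_apply, chanKernel]
  congr 3
  rw [mul_pow, Real.sq_sqrt ht]
  ring

instance (q : Measure ℝ) [IsFiniteMeasure q] (t : ℝ) : IsFiniteMeasure (chanLaw q t) := by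
  unfold chanLaw signalNoise; infer_instance

instance (q : Measure ℝ) [IsProbabilityMeasure q] (t : ℝ) :
    IsProbabilityMeasure (chanLaw q t) := by
  unfold chanLaw signalNoise
  exact Measure.isProbabilityMeasure_map
    (measurable_fst.prodMk (measurable_observation t)).aemeasurable

theorem integral_chanLaw (q : Measure ℝ) [IsFiniteMeasure q] {t : ℝ} (ht : 0 ≤ t)
    (f : ℝ × ℝ → ℝ) :
    ∫ r, f r ∂(chanLaw q t)
      = ∫ r, chanKernel t r.1 r.2 * f r ∂(q.prod stdGaussian) := by
  rw [chanLaw_eq q ht, integral_withDensity_eq_integral_toReal_smul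
    (measurable_chanKernel t).ennreal_ofReal (by simp)]
  refine integral_congr_ae (.of_forall fun r => ?_)
  simp [ENNReal.toReal_ofReal (chanKernel_pos _ _ _).le]

theorem integrable_chanLaw_iff (q : Measure ℝ) [IsFiniteMeasure q] {t : ℝ} (ht : 0 ≤ t)
    (f : ℝ × ℝ → ℝ) :
    Integrable f (chanLaw q t)
      ↔ Integrable (fun r => chanKernel t r.1 r.2 * f r) (q.prod stdGaussian) := by
  rw [chanLaw_eq q ht, integrable_withDensity_iff_integrable_smul'
    (measurable_chanKernel t).ennreal_ofReal (by simp)]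
  refine integrable_congr (.of_forall fun r => ?_)
  simp [ENNReal.toReal_ofReal (chanKernel_pos _ _ _).le]

theorem integrable_chanLaw_iff_comp (q : Measure ℝ) (t : ℝ) {f : ℝ × ℝ → ℝ} (hf : Measurable f) :
    Integrable f (chanLaw q t)
      ↔ Integrable (fun r => f (r.1, observation t r)) (q.prod stdGaussian) := by
  rw [chanLaw, integrable_map_measure hf.aestronglyMeasurable
    (measurable_fst.prodMk (measurable_observation t)).aemeasurable]
  rfl

theorem integral_chanLaw_comp (q : Measure ℝ) (t : ℝ) {f : ℝ × ℝ → ℝ} (hf : Measurable f) :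
    ∫ r, f r ∂(chanLaw q t) = ∫ r, f (r.1, observation t r) ∂(q.prod stdGaussian) := by
  rw [chanLaw, integral_map
    (measurable_fst.prodMk (measurable_observation t)).aemeasurable hf.aestronglyMeasurable]
  rfl

theorem fst_chanLaw (q : Measure ℝ) [IsFiniteMeasure q] (t : ℝ) : (chanLaw q t).fst = q := by
  rw [Measure.fst, chanLaw, Measure.map_map measurable_fst
    (measurable_fst.prodMk (measurable_observation t))]
  change (signalNoise q).map Prod.fst = q
  simp [signalNoise]

theorem integrable_chanKernel (q : Measure ℝ) [IsFiniteMeasure q] {t : ℝ} (ht : 0 ≤ t) (y : ℝ) :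
    Integrable (fun x => chanKernel t x y) q := by
  refine Integrable.of_bound (C := Real.exp (y ^ 2 / 2)) ?_ (.of_forall fun x => ?_)
  · unfold chanKernel; fun_prop
  · rw [Real.norm_eq_abs, abs_of_pos (chanKernel_pos _ _ _)]
    exact chanKernel_le ht x y

theorem chanMoment_zero (q : Measure ℝ) (t y : ℝ) :
    chanMoment q 0 t y = ∫ x, chanKernel t x y ∂q := by
  simp [chanMoment]

theorem chanMoment_zero_pos (q : Measure ℝ) [IsFiniteMeasure q] [NeZero q] {t : ℝ} (ht : 0 ≤ t)
    (y : ℝ) : 0 < chanMoment q 0 t y := by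
  rw [chanMoment_zero, integral_pos_iff_support_of_nonneg (fun x => (chanKernel_pos t x y).le)
    (integrable_chanKernel q ht y)]
  have : Function.support (fun x => chanKernel t x y) = univ :=
    eq_univ_of_forall fun x => (chanKernel_pos t x y).ne'
  rw [this]
  exact NeZero.pos _

theorem stronglyMeasurable_chanMoment (q : Measure ℝ) [IsFiniteMeasure q] (k : ℕ) (t : ℝ) :
    StronglyMeasurable (chanMoment q k t) := by
  unfold chanMoment
  refine StronglyMeasurable.integral_prod_right' (f := fun r : ℝ × ℝ => r.2 ^ k * chanKernel t r.2 r.1)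
    (Measurable.stronglyMeasurable ?_)
  exact (measurable_snd.pow_const k).mul ((measurable_chanKernel t).comp measurable_swap)

theorem measurable_chanMoment (q : Measure ℝ) [IsFiniteMeasure q] (k : ℕ) (t : ℝ) :
    Measurable (chanMoment q k t) := (stronglyMeasurable_chanMoment q k t).measurable

theorem snd_chanLaw (q : Measure ℝ) [IsFiniteMeasure q] {t : ℝ} (ht : 0 ≤ t) :
    (chanLaw q t).snd
      = stdGaussian.withDensity (fun y => ENNReal.ofReal (chanMoment q 0 t y)) := by
  have hk : Measurable (fun r : ℝ × ℝ => ENNReal.ofReal (chanKernel t r.1 r.2)) :=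
    (measurable_chanKernel t).ennreal_ofReal
  refine Measure.ext_of_lintegral _ fun f hf => ?_
  have hfs : Measurable (fun r : ℝ × ℝ => f r.2) := hf.comp measurable_snd
  rw [Measure.snd, lintegral_map hf measurable_snd, chanLaw_eq q ht,
    lintegral_withDensity_eq_lintegral_mul _ hk hfs,
    lintegral_withDensity_eq_lintegral_mul _ (measurable_chanMoment q 0 t).ennreal_ofReal hf,
    lintegral_prod_symm _ (hk.mul hfs).aemeasurable]
  refine lintegral_congr fun y => ?_
  have hky : Measurable (fun x : ℝ => ENNReal.ofReal (chanKernel t x y)) :=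
    hk.comp (measurable_id.prodMk measurable_const)
  simp only [Pi.mul_apply]
  rw [lintegral_mul_const _ hky, chanMoment_zero,
    ofReal_integral_eq_lintegral_ofReal (integrable_chanKernel q ht y)
      (.of_forall fun x => (chanKernel_pos _ _ _).le)]

theorem integral_snd_chanLaw (q : Measure ℝ) [IsFiniteMeasure q] {t : ℝ} (ht : 0 ≤ t)
    {f : ℝ → ℝ} (hf : Measurable f) :
    ∫ r, f r.2 ∂(chanLaw q t) = ∫ y, chanMoment q 0 t y * f y ∂stdGaussian := by
  have h : ∫ y, f y ∂(chanLaw q t).snd = ∫ r, f r.2 ∂(chanLaw q t) :=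
    integral_map measurable_snd.aemeasurable hf.aestronglyMeasurable
  rw [← h, snd_chanLaw q ht, integral_withDensity_eq_integral_toReal_smul
    (measurable_chanMoment q 0 t).ennreal_ofReal (by simp)]
  refine integral_congr_ae (.of_forall fun y => ?_)
  have : 0 ≤ chanMoment q 0 t y := by
    rw [chanMoment_zero]; exact integral_nonneg fun x => (chanKernel_pos _ _ _).le
  simp [ENNReal.toReal_ofReal this]

theorem integrable_snd_chanLaw_iff (q : Measure ℝ) [IsFiniteMeasure q] {t : ℝ} (ht : 0 ≤ t)
    {f : ℝ → ℝ} (hf : Measurable f) :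
    Integrable (fun r => f r.2) (chanLaw q t)
      ↔ Integrable (fun y => chanMoment q 0 t y * f y) stdGaussian := by
  have h : Integrable f (chanLaw q t).snd ↔ Integrable (fun r => f r.2) (chanLaw q t) :=
    integrable_map_measure hf.aestronglyMeasurable measurable_snd.aemeasurable
  rw [← h, snd_chanLaw q ht, integrable_withDensity_iff_integrable_smul'
    (measurable_chanMoment q 0 t).ennreal_ofReal (by simp)]
  refine integrable_congr (.of_forall fun y => ?_)
  have : 0 ≤ chanMoment q 0 t y := by
    rw [chanMoment_zero]; exact integral_nonneg fun x => (chanKernel_pos _ _ _).le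
  simp [ENNReal.toReal_ofReal this]

/-! ### Integrability and second moments under the channel law -/

theorem integrable_pow_stdGaussian (k : ℕ) : Integrable (fun z : ℝ => z ^ k) stdGaussian :=
by
  refine (integrable_norm_iff (by fun_prop)).1 ?_
  have := (memLp_id_gaussianReal (μ := 0) (v := 1) k).integrable_norm_rpow'
  simpa using this

theorem integrable_sq_of_integral_eq_one {p : Measure ℝ} (hp : ∫ x, x ^ 2 ∂p = 1) :
    Integrable (fun x : ℝ => x ^ 2) p := by
  by_contra h
  rw [integral_undef h] at hp
  exact zero_ne_one hp

theorem integrable_id_of_sq {q : Measure ℝ} [IsFiniteMeasure q]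
    (hq : Integrable (fun x : ℝ => x ^ 2) q) : Integrable (fun x : ℝ => x) q :=
  ((memLp_two_iff_integrable_sq (by fun_prop)).2 hq).integrable one_le_two

theorem integrable_fst_chanLaw {q : Measure ℝ} [IsFiniteMeasure q] (t : ℝ) {f : ℝ → ℝ}
    (hf : Measurable f) (hi : Integrable f q) :
    Integrable (fun r => f r.1) (chanLaw q t) := by
  have hf1 : Measurable (fun r : ℝ × ℝ => f r.1) := hf.comp measurable_fst
  rw [integrable_chanLaw_iff_comp q t hf1]
  exact hi.comp_fst stdGaussian

theorem integral_fst_chanLaw {q : Measure ℝ} [IsFiniteMeasure q] (t : ℝ) {f : ℝ → ℝ}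
    (hf : Measurable f) : ∫ r, f r.1 ∂(chanLaw q t) = ∫ x, f x ∂q := by
  rw [integral_chanLaw_comp q t (f := fun r => f r.1) (hf.comp measurable_fst), integral_fun_fst]
  simp

theorem integrable_snd_sq_chanLaw {q : Measure ℝ} [IsFiniteMeasure q]
    (hq : Integrable (fun x : ℝ => x ^ 2) q) (t : ℝ) :
    Integrable (fun r => r.2 ^ 2) (chanLaw q t) := by
  rw [integrable_chanLaw_iff_comp q t (by fun_prop)]
  have h1 : Integrable (fun r : ℝ × ℝ => (√t * r.1) ^ 2) (q.prod stdGaussian) := by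
    simp only [mul_pow]
    exact (hq.const_mul _).comp_fst stdGaussian
  have h2 : Integrable (fun r : ℝ × ℝ => r.2 ^ 2) (q.prod stdGaussian) :=
    (integrable_pow_stdGaussian 2).comp_snd q
  refine ((h1.add h2).const_mul 2).mono' ?_ (.of_forall fun r => ?_)
  · unfold observation; fun_prop
  · simp only [observation, Pi.add_apply]
    rw [Real.norm_eq_abs, abs_of_nonneg (sq_nonneg _)]
    nlinarith [sq_nonneg (√t * r.1 - r.2)]

theorem integrable_mul_chanLaw {q : Measure ℝ} [IsFiniteMeasure q]
    (hq : Integrable (fun x : ℝ => x ^ 2) q) (t : ℝ) :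
    Integrable (fun r => r.1 * r.2) (chanLaw q t) := by
  refine ((integrable_fst_chanLaw t (by fun_prop) hq).add
    (integrable_snd_sq_chanLaw hq t)).mono' (by fun_prop) (.of_forall fun r => ?_)
  simp only [Pi.add_apply]
  rw [Real.norm_eq_abs, abs_le]
  constructor <;> nlinarith [sq_nonneg (r.1 - r.2), sq_nonneg (r.1 + r.2)]

theorem integral_mul_chanLaw {q : Measure ℝ} [IsFiniteMeasure q]
    (hq : Integrable (fun x : ℝ => x ^ 2) q) (t : ℝ) :
    ∫ r, r.1 * r.2 ∂(chanLaw q t) = √t * ∫ x, x ^ 2 ∂q := by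
  rw [integral_chanLaw_comp q t (by fun_prop)]
  have h1 : Integrable (fun r : ℝ × ℝ => √t * r.1 ^ 2) (q.prod stdGaussian) :=
    (hq.const_mul _).comp_fst stdGaussian
  have h2 : Integrable (fun r : ℝ × ℝ => r.1 * r.2) (q.prod stdGaussian) :=
    (integrable_id_of_sq hq).mul_prod (by simpa using integrable_pow_stdGaussian 1)
  have h3 : ∫ r : ℝ × ℝ, r.1 * r.2 ∂(q.prod stdGaussian) = 0 := by
    rw [integral_prod_mul (fun x => x) (fun x => x), integral_id_gaussianReal, mul_zero]
  have h4 : ∫ r : ℝ × ℝ, √t * r.1 ^ 2 ∂(q.prod stdGaussian) = √t * ∫ x, x ^ 2 ∂q := by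
    rw [integral_fun_fst (fun x : ℝ => √t * x ^ 2), integral_const_mul]
    simp
  calc _ = ∫ r : ℝ × ℝ, (√t * r.1 ^ 2 + r.1 * r.2) ∂(q.prod stdGaussian) := by
        refine integral_congr_ae (.of_forall fun r => ?_)
        simp only [observation]; ring
    _ = _ := by rw [integral_add h1 h2, h3, h4, add_zero]

theorem chanMoment_zero_le (q : Measure ℝ) [IsFiniteMeasure q] {t : ℝ} (ht : 0 ≤ t) (y : ℝ) :
    chanMoment q 0 t y ≤ q.real univ * Real.exp (y ^ 2 / 2) := by
  rw [chanMoment_zero]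
  refine (integral_mono (integrable_chanKernel q ht y) (integrable_const _)
    fun x => chanKernel_le ht x y).trans ?_
  simp

/-- Jensen's inequality for the exponential. Together with the pointwise bound on the kernel it
makes the log-likelihood at most quadratic in `y`, hence integrable, since the output has a second
moment. -/
theorem le_log_chanMoment_zero {p : Measure ℝ} [IsProbabilityMeasure p]
    (hp : Integrable (fun x : ℝ => x ^ 2) p) {t : ℝ} (ht : 0 ≤ t) (y : ℝ) :
    √t * y * ∫ x, x ∂p - t / 2 * ∫ x, x ^ 2 ∂p ≤ Real.log (chanMoment p 0 t y) := by
  rw [Real.le_log_iff_exp_le (chanMoment_zero_pos p ht y), chanMoment_zero]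
  have h1 := (integrable_id_of_sq hp).const_mul (√t * y)
  have h2 := hp.const_mul (t / 2)
  have := convexOn_exp.map_integral_le (μ := p)
    (f := fun x => √t * y * x - t / 2 * x ^ 2) Real.continuous_exp.continuousOn isClosed_univ
    (by simp) (h1.sub h2) ?_
  · rw [integral_sub h1 h2, integral_const_mul, integral_const_mul] at this
    refine this.trans_eq (integral_congr_ae (.of_forall fun x => ?_))
    simp only [chanKernel]
    ring_nf
  · refine (integrable_chanKernel p ht y).congr (.of_forall fun x => ?_)
    simp only [chanKernel, Function.comp]
    ring_nf

theorem abs_log_chanMoment_zero_le {p : Measure ℝ} [IsProbabilityMeasure p]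
    (hp : Integrable (fun x : ℝ => x ^ 2) p) {t : ℝ} (ht : 0 ≤ t) :
    ∃ C, ∀ y, |Real.log (chanMoment p 0 t y)| ≤ C + y ^ 2 := by
  refine ⟨(√t * ∫ x, x ∂p) ^ 2 + |t / 2 * ∫ x, x ^ 2 ∂p|, fun y => ?_⟩
  have h1 := le_log_chanMoment_zero hp ht y
  have h2 : Real.log (chanMoment p 0 t y) ≤ y ^ 2 / 2 := by
    rw [Real.log_le_iff_le_exp (chanMoment_zero_pos p ht y)]
    simpa using chanMoment_zero_le p ht y
  have h3 := le_abs_self (t / 2 * ∫ x, x ^ 2 ∂p)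
  have h4 := abs_nonneg (t / 2 * ∫ x, x ^ 2 ∂p)
  rw [abs_le]
  constructor
  · nlinarith [sq_nonneg (√t * (∫ x, x ∂p) + y), sq_nonneg (√t * ∫ x, x ∂p), sq_nonneg y]
  · nlinarith [sq_nonneg (√t * ∫ x, x ∂p), sq_nonneg y]

theorem integrable_log_chanMoment_zero {p : Measure ℝ} [IsProbabilityMeasure p]
    (hp : Integrable (fun x : ℝ => x ^ 2) p) {t : ℝ} (ht : 0 ≤ t) :
    Integrable (fun r => Real.log (chanMoment p 0 t r.2)) (chanLaw p t) := by
  obtain ⟨C, hC⟩ := abs_log_chanMoment_zero_le hp ht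
  refine ((integrable_const C).add (integrable_snd_sq_chanLaw hp t)).mono'
    (((measurable_chanMoment p 0 t).comp measurable_snd).log.aestronglyMeasurable)
    (.of_forall fun r => hC r.2)

/-- Log-likelihood ratio of joint law against product of marginals. -/
theorem chanLaw_eq_withDensity_prod (p : Measure ℝ) [IsProbabilityMeasure p] {t : ℝ} (ht : 0 ≤ t) :
    chanLaw p t = ((chanLaw p t).fst.prod (chanLaw p t).snd).withDensity
      (fun r => ENNReal.ofReal (chanKernel t r.1 r.2 / chanMoment p 0 t r.2)) := by
  have hA : Measurable (fun y => ENNReal.ofReal (chanMoment p 0 t y)) :=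
    (measurable_chanMoment p 0 t).ennreal_ofReal
  have hA2 : Measurable (fun r : ℝ × ℝ => ENNReal.ofReal (chanMoment p 0 t r.2)) :=
    hA.comp measurable_snd
  have hkA : Measurable (fun r : ℝ × ℝ =>
      ENNReal.ofReal (chanKernel t r.1 r.2 / chanMoment p 0 t r.2)) :=
    ((measurable_chanKernel t).div
      ((measurable_chanMoment p 0 t).comp measurable_snd)).ennreal_ofReal
  have : SFinite (stdGaussian.withDensity fun y => ENNReal.ofReal (chanMoment p 0 t y)) := by
    infer_instance
  rw [fst_chanLaw, snd_chanLaw p ht, prod_withDensity_right hA, ← withDensity_mul _ hA2 hkA,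
    chanLaw_eq p ht]
  congr 1
  ext r
  have := chanMoment_zero_pos p ht r.2
  rw [Pi.mul_apply, ← ENNReal.ofReal_mul this.le, mul_div_cancel₀ _ this.ne']

theorem llr_chanLaw (p : Measure ℝ) [IsProbabilityMeasure p] {t : ℝ} (ht : 0 ≤ t) :
    llr (chanLaw p t) ((chanLaw p t).fst.prod (chanLaw p t).snd) =ᵐ[chanLaw p t]
      fun r => √t * (r.1 * r.2) - t / 2 * r.1 ^ 2 - Real.log (chanMoment p 0 t r.2) := by
  set μ := (chanLaw p t).fst.prod (chanLaw p t).snd with hμ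
  have hkA : Measurable (fun r : ℝ × ℝ =>
      ENNReal.ofReal (chanKernel t r.1 r.2 / chanMoment p 0 t r.2)) :=
    ((measurable_chanKernel t).div
      ((measurable_chanMoment p 0 t).comp measurable_snd)).ennreal_ofReal
  have h := chanLaw_eq_withDensity_prod p ht
  rw [← hμ] at h
  have hac : chanLaw p t ≪ μ := by rw [h]; exact withDensity_absolutelyContinuous _ _
  have hd := Measure.rnDeriv_withDensity μ hkA
  rw [← h] at hd
  filter_upwards [hac.ae_le hd] with r hr
  have h1 := chanMoment_zero_pos p ht r.2
  rw [llr, hr, ENNReal.toReal_ofReal (div_nonneg (chanKernel_pos _ _ _).le h1.le),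
    Real.log_div (chanKernel_pos _ _ _).ne' h1.ne', chanKernel, Real.log_exp]
  ring

theorem mutualInfo_eq_integral_chanLaw {p : Measure ℝ} [IsProbabilityMeasure p] {t : ℝ}
    (ht : 0 ≤ t) :
    mutualInfo p t = ∫ r, (√t * (r.1 * r.2) - t / 2 * r.1 ^ 2
      - Real.log (chanMoment p 0 t r.2)) ∂(chanLaw p t) := by
  have hac : chanLaw p t ≪ (chanLaw p t).fst.prod (chanLaw p t).snd := by
    conv_lhs => rw [chanLaw_eq_withDensity_prod p ht]
    exact withDensity_absolutelyContinuous _ _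
  have : mutualInfo p t = (InformationTheory.klDiv (chanLaw p t)
      ((chanLaw p t).fst.prod (chanLaw p t).snd)).toReal := rfl
  rw [this, InformationTheory.toReal_klDiv_of_measure_eq hac (by simp)]
  exact integral_congr_ae (llr_chanLaw p ht)

/-! ### Mutual information and MMSE through output moments -/

/-- Relative entropy of channel output and noise. -/
noncomputable def outputDiv (q : Measure ℝ) (t : ℝ) : ℝ :=
  ∫ y, chanMoment q 0 t y * Real.log (chanMoment q 0 t y) ∂stdGaussian

/-- Second moment of the conditional mean of the signal. -/
noncomputable def meanSq (q : Measure ℝ) (t : ℝ) : ℝ :=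
  ∫ y, chanMoment q 1 t y ^ 2 / chanMoment q 0 t y ∂stdGaussian

/-- Taking expectations in the log-likelihood ratio, the correlation of signal and output
contributes `t E x²` and the quadratic term removes half of it. What is left is a functional of the
output density alone. -/
theorem mutualInfo_eq {p : Measure ℝ} [IsProbabilityMeasure p]
    (hp : Integrable (fun x : ℝ => x ^ 2) p) {t : ℝ} (ht : 0 ≤ t) :
    mutualInfo p t = t / 2 * ∫ x, x ^ 2 ∂p - outputDiv p t := by
  have h1 := (integrable_mul_chanLaw hp t).const_mul (√t)
  have h2 := (integrable_fst_chanLaw t (by fun_prop) hp).const_mul (t / 2)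
  have h3 := integrable_log_chanMoment_zero hp ht
  have h12 : Integrable (fun r : ℝ × ℝ => √t * (r.1 * r.2) - t / 2 * r.1 ^ 2) (chanLaw p t) :=
    h1.sub h2
  rw [mutualInfo_eq_integral_chanLaw ht, integral_sub h12 h3, integral_sub h1 h2,
    integral_const_mul, integral_const_mul, integral_mul_chanLaw hp,
    integral_fst_chanLaw t (f := fun x => x ^ 2) (by fun_prop),
    integral_snd_chanLaw p ht (f := fun y => Real.log (chanMoment p 0 t y))
      (measurable_chanMoment p 0 t).log, outputDiv, ← mul_assoc, Real.mul_self_sqrt ht]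
  ring

/-- Gibbs' inequality: `a log a ≥ a - 1`, and the output density has integral one. -/
theorem outputDiv_nonneg {p : Measure ℝ} [IsProbabilityMeasure p]
    (hp : Integrable (fun x : ℝ => x ^ 2) p) {t : ℝ} (ht : 0 ≤ t) : 0 ≤ outputDiv p t := by
  have h3 := (integrable_snd_chanLaw_iff p ht (f := fun y => Real.log (chanMoment p 0 t y))
    (measurable_chanMoment p 0 t).log).1 (integrable_log_chanMoment_zero hp ht)
  have h1 : ∫ y, chanMoment p 0 t y * 1 ∂stdGaussian = 1 := by
    rw [← integral_snd_chanLaw p ht (f := fun _ => 1) measurable_const]; simp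
  have h2 : Integrable (fun y => chanMoment p 0 t y * 1) stdGaussian :=
    (integrable_snd_chanLaw_iff p ht (f := fun _ => 1) measurable_const).1 (integrable_const _)
  have h4 : ∫ y, (chanMoment p 0 t y * 1 - 1) ∂stdGaussian ≤ outputDiv p t := by
    refine integral_mono (h2.sub (integrable_const _)) h3 fun y => ?_
    have h0 := chanMoment_zero_pos p ht y
    have := Real.one_sub_inv_le_log_of_pos h0
    have := mul_le_mul_of_nonneg_left this h0.le
    rw [mul_sub, mul_inv_cancel₀ h0.ne'] at this
    exact this
  rw [integral_sub h2 (integrable_const _), h1] at h4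
  simpa using h4

theorem integrable_pow_mul_chanKernel {q : Measure ℝ} [IsFiniteMeasure q] {k : ℕ}
    (hq : Integrable (fun x : ℝ => x ^ k) q) {t : ℝ} (ht : 0 ≤ t) (y : ℝ) :
    Integrable (fun x => x ^ k * chanKernel t x y) q := by
  refine hq.mul_bdd (c := Real.exp (y ^ 2 / 2)) ?_ (.of_forall fun x => ?_)
  · unfold chanKernel; fun_prop
  · rw [Real.norm_eq_abs, abs_of_pos (chanKernel_pos _ _ _)]
    exact chanKernel_le ht x y

theorem integrable_chanMoment {q : Measure ℝ} [IsFiniteMeasure q] {k : ℕ}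
    (hq : Integrable (fun x : ℝ => x ^ k) q) {t : ℝ} (ht : 0 ≤ t) :
    Integrable (chanMoment q k t) stdGaussian := by
  have h := (integrable_chanLaw_iff q ht (fun r => r.1 ^ k)).1
    (integrable_fst_chanLaw t (f := fun x => x ^ k) (by fun_prop) hq)
  refine h.integral_prod_right.congr (.of_forall fun y => ?_)
  simp only [chanMoment, mul_comm]

theorem integral_chanMoment {q : Measure ℝ} [IsFiniteMeasure q] {k : ℕ}
    (hq : Integrable (fun x : ℝ => x ^ k) q) {t : ℝ} (ht : 0 ≤ t) :
    ∫ y, chanMoment q k t y ∂stdGaussian = ∫ x, x ^ k ∂q := by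
  have h := (integrable_chanLaw_iff q ht (fun r => r.1 ^ k)).1
    (integrable_fst_chanLaw t (f := fun x => x ^ k) (by fun_prop) hq)
  rw [← integral_fst_chanLaw (q := q) t (f := fun x => x ^ k) (by fun_prop),
    integral_chanLaw q ht, integral_prod_symm _ h]
  refine integral_congr_ae (.of_forall fun y => ?_)
  simp only [chanMoment, mul_comm]

theorem integral_sub_sq_mul_chanKernel {q : Measure ℝ} [IsFiniteMeasure q]
    (hq : Integrable (fun x : ℝ => x ^ 2) q) {t : ℝ} (ht : 0 ≤ t) (y c : ℝ) :
    ∫ x, (x - c) ^ 2 * chanKernel t x y ∂q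
      = chanMoment q 2 t y - 2 * c * chanMoment q 1 t y + c ^ 2 * chanMoment q 0 t y := by
  have h2 := integrable_pow_mul_chanKernel hq ht y
  have h1 := (integrable_pow_mul_chanKernel (k := 1)
    (by simpa using integrable_id_of_sq hq) ht y).const_mul (2 * c)
  have h0 := (integrable_chanKernel q ht y).const_mul (c ^ 2)
  have h21 : Integrable (fun x => x ^ 2 * chanKernel t x y - 2 * c * (x ^ 1 * chanKernel t x y)) q :=
    h2.sub h1
  rw [chanMoment_zero, chanMoment, chanMoment, ← integral_const_mul, ← integral_const_mul,
    ← integral_sub h2 h1, ← integral_add h21 h0]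
  refine integral_congr_ae (.of_forall fun x => ?_)
  ring

/-- The posterior variance is non-negative. The measure may be zero here, in which case the quotient
vanishes by convention; truncations are allowed to have no mass. -/
theorem chanMoment_one_sq_div_le {q : Measure ℝ} [IsFiniteMeasure q]
    (hq : Integrable (fun x : ℝ => x ^ 2) q) {t : ℝ} (ht : 0 ≤ t) (y : ℝ) :
    chanMoment q 1 t y ^ 2 / chanMoment q 0 t y ≤ chanMoment q 2 t y := by
  have h := integral_sub_sq_mul_chanKernel hq ht y (chanMoment q 1 t y / chanMoment q 0 t y)
  have h0 : 0 ≤ ∫ x, (x - chanMoment q 1 t y / chanMoment q 0 t y) ^ 2 * chanKernel t x y ∂q :=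
    integral_nonneg fun x => mul_nonneg (sq_nonneg _) (chanKernel_pos _ _ _).le
  rw [h] at h0
  rcases eq_or_ne (chanMoment q 0 t y) 0 with h1 | h1
  · simpa [h1] using h0
  · have : chanMoment q 2 t y - 2 * (chanMoment q 1 t y / chanMoment q 0 t y) * chanMoment q 1 t y
        + (chanMoment q 1 t y / chanMoment q 0 t y) ^ 2 * chanMoment q 0 t y
        = chanMoment q 2 t y - chanMoment q 1 t y ^ 2 / chanMoment q 0 t y := by
      field_simp
      ring
    linarith

theorem chanMoment_zero_nonneg (q : Measure ℝ) (t y : ℝ) : 0 ≤ chanMoment q 0 t y := by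
  rw [chanMoment_zero]
  exact integral_nonneg fun x => (chanKernel_pos _ _ _).le

theorem integrable_meanSq {q : Measure ℝ} [IsFiniteMeasure q]
    (hq : Integrable (fun x : ℝ => x ^ 2) q) {t : ℝ} (ht : 0 ≤ t) :
    Integrable (fun y => chanMoment q 1 t y ^ 2 / chanMoment q 0 t y) stdGaussian := by
  refine (integrable_chanMoment hq ht).mono'
    (((measurable_chanMoment q 1 t).pow_const 2).div
      (measurable_chanMoment q 0 t)).aestronglyMeasurable (.of_forall fun y => ?_)
  rw [Real.norm_eq_abs, abs_of_nonneg (div_nonneg (sq_nonneg _) (chanMoment_zero_nonneg q t y))]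
  exact chanMoment_one_sq_div_le hq ht y

theorem meanSq_nonneg (q : Measure ℝ) (t : ℝ) : 0 ≤ meanSq q t :=
  integral_nonneg fun y => div_nonneg (sq_nonneg _) (chanMoment_zero_nonneg q t y)

/-- Bayes' rule: the posterior of the signal has density proportional to `chanKernel`. Testing on
preimages of Borel sets and exchanging the integrals over signal and output identifies its mean with
the abstract conditional expectation. -/
theorem condExp_signal {p : Measure ℝ} [IsProbabilityMeasure p]
    (hp : Integrable (fun x : ℝ => x ^ 2) p) {t : ℝ} (ht : 0 ≤ t) :
    (fun r => chanMoment p 1 t (observation t r) / chanMoment p 0 t (observation t r))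
      =ᵐ[signalNoise p] condExp (MeasurableSpace.comap (observation t) inferInstance)
        (signalNoise p) (fun r : ℝ × ℝ => r.1) := by
  have hprob : IsProbabilityMeasure (signalNoise p) := by unfold signalNoise; infer_instance
  have hr : Measurable (fun y => chanMoment p 1 t y / chanMoment p 0 t y) :=
    (measurable_chanMoment p 1 t).div (measurable_chanMoment p 0 t)
  have hi1 : Integrable (fun x : ℝ => x ^ 1) p := by simpa using integrable_id_of_sq hp
  have hmean : ∀ y, chanMoment p 0 t y * (chanMoment p 1 t y / chanMoment p 0 t y)
      = chanMoment p 1 t y := fun y => mul_div_cancel₀ _ (chanMoment_zero_pos p ht y).ne'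
  have hint : Integrable (fun r => chanMoment p 1 t (observation t r)
      / chanMoment p 0 t (observation t r)) (signalNoise p) := by
    refine (integrable_chanLaw_iff_comp p t (f := fun r => chanMoment p 1 t r.2
      / chanMoment p 0 t r.2) (hr.comp measurable_snd)).1 ?_
    rw [integrable_snd_chanLaw_iff p ht hr]
    simpa only [hmean] using integrable_chanMoment hi1 ht
  refine ae_eq_condExp_of_forall_setIntegral_eq (measurable_observation t).comap_le
    ((integrable_id_of_sq hp).comp_fst stdGaussian) (fun s _ _ => hint.integrableOn) ?_ ?_
  · rintro _ ⟨B, hB, rfl⟩ -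
    rw [← integral_indicator (measurable_observation t hB),
      ← integral_indicator (measurable_observation t hB)]
    have hind : Measurable (B.indicator (fun y => chanMoment p 1 t y / chanMoment p 0 t y)) :=
      hr.indicator hB
    have hB2 : MeasurableSet (Prod.snd ⁻¹' B : Set (ℝ × ℝ)) := measurable_snd hB
    have e1 := integral_chanLaw_comp p t
      (f := fun r => B.indicator (fun y => chanMoment p 1 t y / chanMoment p 0 t y) r.2)
      (hind.comp measurable_snd)
    have e2 := integral_chanLaw_comp p t (f := (Prod.snd ⁻¹' B).indicator (fun r : ℝ × ℝ => r.1))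
      (measurable_fst.indicator hB2)
    have e3 := integral_snd_chanLaw p ht hind
    have e4 := integral_chanLaw p ht ((Prod.snd ⁻¹' B).indicator (fun r : ℝ × ℝ => r.1))
    have hi : Integrable (fun r : ℝ × ℝ => chanKernel t r.1 r.2
        * (Prod.snd ⁻¹' B).indicator (fun r : ℝ × ℝ => r.1) r) (p.prod stdGaussian) := by
      rw [← integrable_chanLaw_iff p ht]
      exact (integrable_fst_chanLaw t measurable_id (integrable_id_of_sq hp)).indicator hB2
    refine Eq.trans (e1.symm.trans (e3.trans ?_)) (e4.symm.trans e2)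
    rw [integral_prod_symm _ hi]
    refine integral_congr_ae (.of_forall fun y => ?_)
    by_cases hy : y ∈ B
    · simp only [hmean, mem_preimage, indicator, hy, if_true]
      simp [chanMoment, mul_comm]
    · simp [indicator, hy]
  · refine (StronglyMeasurable.aestronglyMeasurable ?_)
    exact (hr.comp (comap_measurable (observation t))).stronglyMeasurable

/-- Orthogonality of the estimation error: the cross term and the square of the conditional mean
have the same expectation `meanSq`. -/
theorem mmse_eq {p : Measure ℝ} [IsProbabilityMeasure p]
    (hp : Integrable (fun x : ℝ => x ^ 2) p) {t : ℝ} (ht : 0 ≤ t) :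
    mmse p t = ∫ x, x ^ 2 ∂p - meanSq p t := by
  have hr : Measurable (fun y => chanMoment p 1 t y / chanMoment p 0 t y) :=
    (measurable_chanMoment p 1 t).div (measurable_chanMoment p 0 t)
  have hi1 : Integrable (fun x : ℝ => x ^ 1) p := by simpa using integrable_id_of_sq hp
  set f : ℝ → ℝ := fun y => chanMoment p 1 t y / chanMoment p 0 t y with hf
  have e1 : mmse p t = ∫ r, (r.1 - f r.2) ^ 2 ∂(chanLaw p t) := by
    rw [integral_chanLaw_comp p t (f := fun r => (r.1 - f r.2) ^ 2)
      ((measurable_fst.sub (hr.comp measurable_snd)).pow_const 2), mmse]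
    refine integral_congr_ae ?_
    filter_upwards [condExp_signal hp ht] with r hr
    rw [← hr]
  have e2 : ∀ y, chanMoment p 0 t y * f y ^ 2 = chanMoment p 1 t y ^ 2 / chanMoment p 0 t y := by
    intro y
    have := (chanMoment_zero_pos p ht y).ne'
    simp only [hf]
    field_simp
  have hi2 : Integrable (fun r => f r.2 ^ 2) (chanLaw p t) := by
    rw [integrable_snd_chanLaw_iff p ht (hr.pow_const 2)]
    simpa only [e2] using integrable_meanSq hp ht
  have hi3 := integrable_fst_chanLaw (q := p) t (f := fun x => x ^ 2) (by fun_prop) hp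
  have hi4 : Integrable (fun r => r.1 * f r.2) (chanLaw p t) := by
    refine (hi2.add hi3).mono'
      (measurable_fst.mul (hr.comp measurable_snd)).aestronglyMeasurable (.of_forall fun r => ?_)
    simp only [Pi.add_apply]
    rw [Real.norm_eq_abs, abs_le]
    constructor <;> nlinarith [sq_nonneg (r.1 - f r.2), sq_nonneg (r.1 + f r.2)]
  have e3 : ∫ r, r.1 * f r.2 ∂(chanLaw p t) = meanSq p t := by
    rw [integral_chanLaw p ht, integral_prod_symm _ ((integrable_chanLaw_iff p ht _).1 hi4), meanSq]
    refine integral_congr_ae (.of_forall fun y => ?_)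
    have : ∀ x, chanKernel t x y * (x * f y) = (x ^ 1 * chanKernel t x y) * f y := fun x => by ring
    simp only [this]
    rw [integral_mul_const, ← chanMoment]
    simp only [hf]
    ring
  have e4 : ∫ r, f r.2 ^ 2 ∂(chanLaw p t) = meanSq p t := by
    rw [integral_snd_chanLaw p ht (f := fun y => f y ^ 2) (hr.pow_const 2), meanSq]
    simp only [e2]
  have e5 : ∀ r : ℝ × ℝ, (r.1 - f r.2) ^ 2 = r.1 ^ 2 - 2 * (r.1 * f r.2) + f r.2 ^ 2 :=
    fun r => by ring
  have hi34 : Integrable (fun r : ℝ × ℝ => r.1 ^ 2 - 2 * (r.1 * f r.2)) (chanLaw p t) :=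
    hi3.sub (hi4.const_mul 2)
  rw [e1]
  simp only [e5]
  rw [integral_add hi34 hi2, integral_sub hi3 (hi4.const_mul 2), integral_const_mul, e3, e4,
    integral_fst_chanLaw t (f := fun x => x ^ 2) (by fun_prop)]
  ring

/-- The kernel is strictly positive, so for every single output `y` the posterior is degenerate only
if `p` itself is. -/
theorem mmse_pos {p : Measure ℝ} [IsProbabilityMeasure p]
    (hp : Integrable (fun x : ℝ => x ^ 2) p) (hvar : 0 < variance id p) {t : ℝ} (ht : 0 ≤ t) :
    0 < mmse p t := by
  have hpos : ∀ y, 0 < chanMoment p 2 t y - chanMoment p 1 t y ^ 2 / chanMoment p 0 t y := by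
    intro y
    set c := chanMoment p 1 t y / chanMoment p 0 t y with hc
    have h0 := chanMoment_zero_pos p ht y
    have h : chanMoment p 2 t y - chanMoment p 1 t y ^ 2 / chanMoment p 0 t y
        = ∫ x, (x - c) ^ 2 * chanKernel t x y ∂p := by
      rw [integral_sub_sq_mul_chanKernel hp ht, hc]
      field_simp
      ring
    have hn : ∀ x, 0 ≤ (x - c) ^ 2 * chanKernel t x y :=
      fun x => mul_nonneg (sq_nonneg _) (chanKernel_pos _ _ _).le
    rw [h]
    refine lt_of_le_of_ne (integral_nonneg hn) fun h1 => ?_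
    have hint : Integrable (fun x => (x - c) ^ 2 * chanKernel t x y) p := by
      have h2 := integrable_pow_mul_chanKernel hp ht y
      have h1 := (integrable_pow_mul_chanKernel (k := 1)
        (by simpa using integrable_id_of_sq hp) ht y).const_mul (2 * c)
      have h0 := (integrable_chanKernel p ht y).const_mul (c ^ 2)
      refine ((h2.sub h1).add h0).congr (.of_forall fun x => ?_)
      simp only [Pi.add_apply, Pi.sub_apply]
      ring
    have h2 := (integral_eq_zero_iff_of_nonneg hn hint).1 h1.symm
    have h3 : id =ᵐ[p] fun _ => c := by
      filter_upwards [h2] with x hx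
      have hx' : (x - c) ^ 2 * chanKernel t x y = 0 := hx
      rcases mul_eq_zero.1 hx' with h | h
      · exact sub_eq_zero.1 (pow_eq_zero_iff two_ne_zero |>.1 h)
      · exact absurd h (chanKernel_pos _ _ _).ne'
    rw [variance_congr h3, variance_eq_integral aemeasurable_const] at hvar
    simp only [integral_const, probReal_univ, one_smul, sub_self, ne_eq, OfNat.ofNat_ne_zero,
      not_false_eq_true, zero_pow, smul_zero] at hvar
    exact lt_irrefl _ hvar
  have hi := (integrable_chanMoment hp ht).sub (integrable_meanSq hp ht)
  rw [mmse_eq hp ht, ← integral_chanMoment hp ht, meanSq,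
    ← integral_sub (integrable_chanMoment hp ht) (integrable_meanSq hp ht)]
  rw [integral_pos_iff_support_of_nonneg (fun y => (hpos y).le) hi]
  have : Function.support (fun y => chanMoment p 2 t y - chanMoment p 1 t y ^ 2 /
    chanMoment p 0 t y) = univ := eq_univ_of_forall fun y => (hpos y).ne'
  rw [this]
  simp

/-! ### Gaussian integration by parts -/

theorem integrable_exp_abs_stdGaussian (C c : ℝ) :
    Integrable (fun y : ℝ => C * Real.exp (c * |y|)) stdGaussian := by
  have h := (integrable_exp_mul_gaussianReal (μ := 0) (v := 1) c).add
    (integrable_exp_mul_gaussianReal (μ := 0) (v := 1) (-c))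
  refine (h.mono' (by fun_prop) (.of_forall fun y => ?_)).const_mul C
  rw [Real.norm_eq_abs, abs_of_pos (Real.exp_pos _), Pi.add_apply]
  rcases abs_cases y with ⟨h, -⟩ | ⟨h, -⟩ <;> rw [h]
  · linarith [Real.exp_pos (-c * y)]
  · rw [mul_neg, ← neg_mul]
    linarith [Real.exp_pos (c * y)]

theorem integrable_stdGaussian_iff {f : ℝ → ℝ} :
    Integrable f stdGaussian ↔ Integrable (fun y => gaussianPDFReal 0 1 y * f y) := by
  rw [stdGaussian, gaussianReal_of_var_ne_zero _ one_ne_zero,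
    integrable_withDensity_iff_integrable_smul' (measurable_gaussianPDF _ _)
      (by simp [gaussianPDF])]
  simp [toReal_gaussianPDF]

theorem hasDerivAt_gaussianPDFReal (y : ℝ) :
    HasDerivAt (gaussianPDFReal 0 1) (-y * gaussianPDFReal 0 1 y) y := by
  have h : HasDerivAt (fun y : ℝ => -(y - 0) ^ 2 / (2 * ((1 : NNReal) : ℝ))) (-y) y := by
    have := (((hasDerivAt_id y).sub_const 0).pow 2).neg.div_const (2 * ((1 : NNReal) : ℝ))
    refine this.congr_deriv ?_
    simp
    ring
  refine (h.exp.const_mul _).congr_deriv ?_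
  rw [gaussianPDFReal]
  ring

/-- Stein's identity, by integration by parts against the Gaussian density `φ`, for which `φ' =
-yφ`. -/
theorem integral_mul_stdGaussian {f f' : ℝ → ℝ} (hf : ∀ y, HasDerivAt f (f' y) y)
    (hi : Integrable f stdGaussian) (hi' : Integrable f' stdGaussian)
    (hyf : Integrable (fun y => y * f y) stdGaussian) :
    ∫ y, y * f y ∂stdGaussian = ∫ y, f' y ∂stdGaussian := by
  rw [integrable_stdGaussian_iff] at hi hi' hyf
  have h := integral_mul_deriv_eq_deriv_mul_of_integrable (u := f) (v := gaussianPDFReal 0 1)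
    (u' := f') (v' := fun y => -y * gaussianPDFReal 0 1 y) (fun y _ => hf y)
    (fun y _ => hasDerivAt_gaussianPDFReal y)
    (hyf.neg.congr (.of_forall fun y => by simp only [Pi.neg_apply, Pi.mul_apply]; ring))
    (hi'.congr (.of_forall fun y => by simp only [Pi.mul_apply]; ring))
    (hi.congr (.of_forall fun y => by simp only [Pi.mul_apply]; ring))
  rw [stdGaussian, integral_gaussianReal_eq_integral_smul one_ne_zero,
    integral_gaussianReal_eq_integral_smul one_ne_zero]
  have e1 : ∀ y, gaussianPDFReal 0 1 y • (y * f y) = -(f y * (-y * gaussianPDFReal 0 1 y)) :=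
    fun y => by simp only [smul_eq_mul]; ring
  have e2 : ∀ y, gaussianPDFReal 0 1 y • f' y = f' y * gaussianPDFReal 0 1 y :=
    fun y => by simp only [smul_eq_mul]; ring
  simp only [e1, e2]
  rw [integral_neg, h, neg_neg]

/-- Functions of a parameter `t ∈ (a, b)` and of `y` that are continuous in `y` and grow at most
exponentially, uniformly in the parameter. -/
structure Tame (a b : ℝ) (f : ℝ → ℝ → ℝ) : Prop where
  continuous : ∀ t ∈ Ioo a b, Continuous (f t)
  bound : ∃ C c : ℝ, 0 ≤ C ∧ 0 ≤ c ∧ ∀ t ∈ Ioo a b, ∀ y, |f t y| ≤ C * Real.exp (c * |y|)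

namespace Tame

variable {a b : ℝ} {f g : ℝ → ℝ → ℝ}

theorem add (hf : Tame a b f) (hg : Tame a b g) : Tame a b (fun t y => f t y + g t y) := by
  obtain ⟨C, c, hC, hc, h⟩ := hf.bound
  obtain ⟨D, d, hD, hd, h'⟩ := hg.bound
  refine ⟨fun t ht => (hf.continuous t ht).add (hg.continuous t ht), C + D, c + d, by positivity,
    by positivity, fun t ht y => (abs_add_le _ _).trans ?_⟩
  have hy := abs_nonneg y
  rw [add_mul]
  refine add_le_add ((h t ht y).trans ?_) ((h' t ht y).trans ?_)
  · gcongr; linarith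
  · gcongr; linarith

theorem mul (hf : Tame a b f) (hg : Tame a b g) : Tame a b (fun t y => f t y * g t y) := by
  obtain ⟨C, c, hC, hc, h⟩ := hf.bound
  obtain ⟨D, d, hD, hd, h'⟩ := hg.bound
  refine ⟨fun t ht => (hf.continuous t ht).mul (hg.continuous t ht), C * D, c + d, by positivity,
    by positivity, fun t ht y => ?_⟩
  rw [abs_mul, add_mul, Real.exp_add]
  calc _ ≤ (C * Real.exp (c * |y|)) * (D * Real.exp (d * |y|)) :=
        mul_le_mul (h t ht y) (h' t ht y) (abs_nonneg _) (by positivity)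
    _ = _ := by ring

theorem const (a b k : ℝ) : Tame a b (fun _ _ => k) :=
  ⟨fun _ _ => continuous_const, |k|, 0, abs_nonneg _, le_rfl, fun t _ y => by simp⟩

theorem neg (hf : Tame a b f) : Tame a b (fun t y => -f t y) :=
  ⟨fun t ht => (hf.continuous t ht).neg, by simpa only [abs_neg] using hf.bound⟩

theorem sub (hf : Tame a b f) (hg : Tame a b g) : Tame a b (fun t y => f t y - g t y) := by
  simpa only [sub_eq_add_neg] using hf.add hg.neg

theorem pow (hf : Tame a b f) (n : ℕ) : Tame a b (fun t y => f t y ^ n) := by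
  induction n with
  | zero => simpa using Tame.const a b 1
  | succ n ih => simpa only [pow_succ] using ih.mul hf

theorem integrable (hf : Tame a b f) {t : ℝ} (ht : t ∈ Ioo a b) : Integrable (f t) stdGaussian := by
  obtain ⟨C, c, hC, hc, h⟩ := hf.bound
  exact (integrable_exp_abs_stdGaussian C c).mono' (hf.continuous t ht).aestronglyMeasurable
    (.of_forall fun y => h t ht y)

theorem coord (a b : ℝ) : Tame a b (fun _ y => y) :=
  ⟨fun _ _ => continuous_id, 1, 1, zero_le_one, zero_le_one, fun t _ y => by
    rw [one_mul, one_mul]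
    linarith [Real.add_one_le_exp |y|]⟩

theorem inv_two_sqrt (ha : 0 < a) (b : ℝ) : Tame a b (fun t _ => 1 / (2 * √t)) :=
  ⟨fun _ _ => continuous_const, 1 / (2 * √a), 0, by positivity, le_rfl, fun t ht y => by
    have h1 : √a ≤ √t := Real.sqrt_le_sqrt ht.1.le
    have h2 : 0 < √a := Real.sqrt_pos.2 ha
    rw [abs_of_nonneg (by positivity), zero_mul, Real.exp_zero, mul_one]
    gcongr⟩

/-- Derivative of a Gaussian expectation along a function obeying the heat flow up to lower order
terms. -/
theorem hasDerivAt_integral {Y X X' : ℝ → ℝ → ℝ} (ha : 0 < a) (hf : Tame a b f) (hX : Tame a b X)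
    (hX' : Tame a b X') (hY : Tame a b Y)
    (hd : ∀ t ∈ Ioo a b, ∀ y,
      HasDerivAt (fun t => f t y) (y * X t y * (1 / (2 * √t)) - 1 / 2 * Y t y) t)
    (hdX : ∀ t ∈ Ioo a b, ∀ y, HasDerivAt (X t) (√t * X' t y) y) {t : ℝ} (ht : t ∈ Ioo a b) :
    HasDerivAt (fun t => ∫ y, f t y ∂stdGaussian)
      (∫ y, 1 / 2 * (X' t y - Y t y) ∂stdGaussian) t := by
  have htp : 0 < √t := Real.sqrt_pos.2 (ha.trans ht.1)
  have hyX : Tame a b (fun t y => y * X t y) := (Tame.coord a b).mul hX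
  have hD : Tame a b (fun t y => y * X t y * (1 / (2 * √t)) - 1 / 2 * Y t y) :=
    (hyX.mul (Tame.inv_two_sqrt ha b)).sub ((Tame.const a b (1 / 2)).mul hY)
  obtain ⟨C, c, hC, hc, h⟩ := hD.bound
  have hn : Ioo a b ∈ 𝓝 t := Ioo_mem_nhds ht.1 ht.2
  have key := (hasDerivAt_integral_of_dominated_loc_of_deriv_le (μ := stdGaussian) hn
    (F := f) (F' := fun t y => y * X t y * (1 / (2 * √t)) - 1 / 2 * Y t y)
    (Filter.eventually_of_mem hn fun s hs => (hf.continuous s hs).aestronglyMeasurable)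
    (hf.integrable ht) (hD.continuous t ht).aestronglyMeasurable
    (.of_forall fun y s hs => h s hs y) (integrable_exp_abs_stdGaussian C c)
    (.of_forall fun y s hs => hd s hs y)).2
  refine key.congr_deriv ?_
  -- Stein's identity trades the factor `y` for a derivative; the resulting `√t` cancels against `1
  -- / (2√t)`.
  have hst := integral_mul_stdGaussian (f := X t) (f' := fun y => √t * X' t y) (hdX t ht)
    (hX.integrable ht) ((hX'.integrable ht).const_mul _) (hyX.integrable ht)
  rw [integral_sub ((hyX.integrable ht).mul_const _) ((hY.integrable ht).const_mul _),
    integral_mul_const, hst, integral_const_mul, integral_const_mul, integral_const_mul,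
    integral_sub (hX'.integrable ht) (hY.integrable ht)]
  field_simp

end Tame

/-! ### Signals with bounded support -/

section Bounded

variable {q : Measure ℝ} [IsFiniteMeasure q] {B : ℝ}

theorem integrable_pow_of_bounded (hB : ∀ᵐ x ∂q, |x| ≤ B) (k : ℕ) :
    Integrable (fun x : ℝ => x ^ k) q := by
  refine Integrable.of_bound (C := B ^ k) (by fun_prop) ?_
  filter_upwards [hB] with x hx
  rw [norm_pow, Real.norm_eq_abs]
  exact pow_le_pow_left₀ (abs_nonneg x) hx k

theorem measurable_chanKernel_left (t y : ℝ) : Measurable (fun x => chanKernel t x y) := by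
  unfold chanKernel; fun_prop

theorem hasDerivAt_chanMoment_right (hB : ∀ᵐ x ∂q, |x| ≤ B) (k : ℕ) {t : ℝ} (ht : 0 ≤ t) (y : ℝ) :
    HasDerivAt (chanMoment q k t) (√t * chanMoment q (k + 1) t y) y := by
  have key := (hasDerivAt_integral_of_dominated_loc_of_deriv_le (μ := q)
    (Metric.ball_mem_nhds y one_pos)
    (F := fun y x => x ^ k * chanKernel t x y)
    (F' := fun y x => x ^ k * (chanKernel t x y * (x * √t)))
    (bound := fun x => |x| ^ k * (Real.exp ((|y| + 1) ^ 2 / 2) * (|x| * √t)))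
    (.of_forall fun s => ((measurable_id.pow_const k).mul
      (measurable_chanKernel_left t s)).aestronglyMeasurable)
    (integrable_pow_mul_chanKernel (integrable_pow_of_bounded hB k) ht y)
    ((measurable_id.pow_const k).mul ((measurable_chanKernel_left t y).mul
      (by fun_prop))).aestronglyMeasurable
    (.of_forall fun x s hs => ?_) ?_ (.of_forall fun x s _ => ?_)).2
  · refine key.congr_deriv ?_
    rw [chanMoment, ← integral_const_mul]
    refine integral_congr_ae (.of_forall fun x => ?_)
    ring
  · rw [norm_mul, norm_mul, norm_pow, Real.norm_eq_abs, Real.norm_eq_abs, Real.norm_eq_abs, abs_mul,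
      abs_of_nonneg (Real.sqrt_nonneg t), abs_of_pos (chanKernel_pos _ _ _)]
    gcongr
    refine (chanKernel_le ht x s).trans (Real.exp_le_exp.2 ?_)
    have : |s| ≤ |y| + 1 := by
      have h1 : |s - y| < 1 := by simpa [Real.dist_eq] using hs
      have h2 := abs_sub_abs_le_abs_sub s y
      linarith
    have := pow_le_pow_left₀ (abs_nonneg s) this 2
    rw [sq_abs] at this
    linarith
  · have h := ((integrable_pow_of_bounded hB (k + 1)).norm.mul_const
      (Real.exp ((|y| + 1) ^ 2 / 2) * √t))
    refine h.congr (.of_forall fun x => ?_)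
    simp only [norm_pow, Real.norm_eq_abs]
    ring
  · have h1 : HasDerivAt (fun y => x * (√t * y) - t * x ^ 2 / 2) (x * √t) s := by
      refine ((((hasDerivAt_id s).const_mul (√t)).const_mul x).sub_const _).congr_deriv ?_
      simp
    exact (h1.exp).const_mul (x ^ k)

/-- Differentiating the exponent brings down powers of `x`. Together with
`hasDerivAt_chanMoment_right` this makes the moments closed under both derivatives, so later
derivative formulas become rational identities in them, apart from the logarithm in `outputDiv`. -/
theorem hasDerivAt_chanMoment_left (hB : ∀ᵐ x ∂q, |x| ≤ B) (k : ℕ) {t : ℝ} (ht : 0 < t) (y : ℝ) :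
    HasDerivAt (fun t => chanMoment q k t y)
      (y * chanMoment q (k + 1) t y * (1 / (2 * √t)) - 1 / 2 * chanMoment q (k + 2) t y) t := by
  -- Staying above `t / 2` keeps the factor `1 / (2√s)` bounded, as domination requires.
  have hn : Ioi (t / 2) ∈ 𝓝 t := Ioi_mem_nhds (by linarith)
  have hpos : ∀ s ∈ Ioi (t / 2), 0 < s := fun s hs => by
    have : t / 2 < s := hs
    linarith
  have hi := fun k => integrable_pow_mul_chanKernel (integrable_pow_of_bounded hB k) ht.le y
  have key := (hasDerivAt_integral_of_dominated_loc_of_deriv_le (μ := q) hn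
    (F := fun t x => x ^ k * chanKernel t x y)
    (F' := fun t x => x ^ k * (chanKernel t x y * (x * (1 / (2 * √t) * y) - x ^ 2 / 2)))
    (bound := fun x => |x| ^ k * (Real.exp (y ^ 2 / 2) *
      (|x| * (1 / (2 * √(t / 2)) * |y|) + |x| ^ 2 / 2)))
    (.of_forall fun s => ((measurable_id.pow_const k).mul
      (measurable_chanKernel_left s y)).aestronglyMeasurable)
    (hi k)
    ((measurable_id.pow_const k).mul ((measurable_chanKernel_left t y).mul
      (by fun_prop))).aestronglyMeasurable
    (.of_forall fun x s hs => ?_) ?_ (.of_forall fun x s hs => ?_)).2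
  · refine key.congr_deriv ?_
    rw [chanMoment, chanMoment, ← integral_const_mul, ← integral_const_mul, ← integral_mul_const,
      ← integral_sub (((hi (k + 1)).const_mul _).mul_const _) ((hi (k + 2)).const_mul _)]
    refine integral_congr_ae (.of_forall fun x => ?_)
    ring
  · have hs0 := hpos s hs
    have hs1 : √(t / 2) ≤ √s := Real.sqrt_le_sqrt (le_of_lt hs)
    have hs2 : 0 < √(t / 2) := Real.sqrt_pos.2 (by linarith)
    rw [norm_mul, norm_mul, norm_pow, Real.norm_eq_abs, Real.norm_eq_abs, Real.norm_eq_abs,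
      abs_of_pos (chanKernel_pos _ _ _)]
    have h1 := chanKernel_le hs0.le x y
    have h2 : |x * (1 / (2 * √s) * y) - x ^ 2 / 2|
        ≤ |x| * (1 / (2 * √(t / 2)) * |y|) + |x| ^ 2 / 2 := by
      refine (abs_sub _ _).trans ?_
      rw [abs_mul, abs_mul, abs_of_nonneg (by positivity : (0 : ℝ) ≤ 1 / (2 * √s)), sq_abs,
        abs_of_nonneg (by positivity : (0 : ℝ) ≤ x ^ 2 / 2)]
      gcongr
    gcongr
  · have h := (((integrable_pow_of_bounded hB (k + 1)).norm.mul_const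
      (Real.exp (y ^ 2 / 2) * (1 / (2 * √(t / 2)) * |y|)))).add
      ((integrable_pow_of_bounded hB (k + 2)).norm.mul_const (Real.exp (y ^ 2 / 2) / 2))
    refine h.congr (.of_forall fun x => ?_)
    simp only [norm_pow, Real.norm_eq_abs, Pi.add_apply]
    ring
  · have hs0 := hpos s hs
    have h1 : HasDerivAt (fun s => x * (√s * y) - s * x ^ 2 / 2)
        (x * (1 / (2 * √s) * y) - x ^ 2 / 2) s := by
      refine ((((Real.hasDerivAt_sqrt hs0.ne').mul_const y).const_mul x).sub
        (((hasDerivAt_id s).mul_const (x ^ 2)).div_const 2)).congr_deriv ?_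
      simp
    exact (h1.exp).const_mul (x ^ k)

theorem chanKernel_le_of_bounded {b : ℝ} {t : ℝ} (ht : 0 ≤ t) (htb : t ≤ b) {x : ℝ} (hx : |x| ≤ B)
    (y : ℝ) : chanKernel t x y ≤ Real.exp (B * √b * |y|) := by
  refine Real.exp_le_exp.2 ?_
  have h1 : √t ≤ √b := Real.sqrt_le_sqrt htb
  have h2 : x * (√t * y) ≤ |x| * (√t * |y|) := by
    refine (le_abs_self _).trans_eq ?_
    rw [abs_mul, abs_mul, abs_of_nonneg (Real.sqrt_nonneg t)]
  have h3 : |x| * (√t * |y|) ≤ B * (√b * |y|) := by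
    have := (abs_nonneg x).trans hx
    gcongr
  nlinarith [mul_nonneg ht (sq_nonneg x)]

theorem le_chanKernel_of_bounded {b : ℝ} {t : ℝ} (ht : 0 ≤ t) (htb : t ≤ b) {x : ℝ} (hx : |x| ≤ B)
    (y : ℝ) : Real.exp (-(B * √b * |y| + b * B ^ 2 / 2)) ≤ chanKernel t x y := by
  refine Real.exp_le_exp.2 ?_
  have h1 : √t ≤ √b := Real.sqrt_le_sqrt htb
  have h2 : -(x * (√t * y)) ≤ |x| * (√t * |y|) := by
    refine (neg_le_abs _).trans_eq ?_
    rw [abs_mul, abs_mul, abs_of_nonneg (Real.sqrt_nonneg t)]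
  have h3 : |x| * (√t * |y|) ≤ B * (√b * |y|) := by
    have := (abs_nonneg x).trans hx
    gcongr
  have h4 : t * x ^ 2 ≤ b * B ^ 2 := by
    rw [← sq_abs x]
    have := ht.trans htb
    gcongr
  linarith

theorem continuous_chanMoment (hB : ∀ᵐ x ∂q, |x| ≤ B) (k : ℕ) {t : ℝ} (ht : 0 ≤ t) :
    Continuous (chanMoment q k t) :=
  continuous_iff_continuousAt.2 fun y => (hasDerivAt_chanMoment_right hB k ht y).continuousAt

theorem tame_chanMoment (hB0 : 0 ≤ B) (hB : ∀ᵐ x ∂q, |x| ≤ B) (k : ℕ) {a : ℝ} (ha : 0 < a) (b : ℝ) :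
    Tame a b (chanMoment q k) := by
  refine ⟨fun t ht => continuous_chanMoment hB k (ha.trans ht.1).le,
    B ^ k * q.real univ, B * √b, by positivity, by positivity, fun t ht y => ?_⟩
  rw [chanMoment, ← Real.norm_eq_abs]
  have := norm_integral_le_of_norm_le_const (μ := q)
    (f := fun x => x ^ k * chanKernel t x y) (C := B ^ k * Real.exp (B * √b * |y|)) ?_
  · refine this.trans_eq ?_
    ring
  · filter_upwards [hB] with x hx
    rw [norm_mul, norm_pow, Real.norm_eq_abs, Real.norm_eq_abs, abs_of_pos (chanKernel_pos _ _ _)]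
    exact mul_le_mul (pow_le_pow_left₀ (abs_nonneg x) hx k)
      (chanKernel_le_of_bounded (ha.trans ht.1).le ht.2.le hx y) (chanKernel_pos _ _ _).le
      (by positivity)

theorem le_chanMoment_zero_of_bounded (hB : ∀ᵐ x ∂q, |x| ≤ B) {b t : ℝ} (ht : 0 ≤ t)
    (htb : t ≤ b) (y : ℝ) :
    q.real univ * Real.exp (-(B * √b * |y| + b * B ^ 2 / 2)) ≤ chanMoment q 0 t y := by
  rw [chanMoment_zero]
  have := integral_mono_ae (μ := q) (integrable_const (Real.exp (-(B * √b * |y| + b * B ^ 2 / 2))))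
    (integrable_chanKernel q ht y) (by
      filter_upwards [hB] with x hx using le_chanKernel_of_bounded ht htb hx y)
  simpa using this

variable [NeZero q]

/-- Bounded support bounds the kernel from below by a decaying exponential in `|y|`, so division by
the output density preserves tameness. -/
theorem tame_inv_chanMoment_zero (hB0 : 0 ≤ B) (hB : ∀ᵐ x ∂q, |x| ≤ B) {a : ℝ} (ha : 0 < a) {b : ℝ} :
    Tame a b (fun t y => (chanMoment q 0 t y)⁻¹) := by
  have hq : 0 < q.real univ := measureReal_univ_pos
  refine ⟨fun t ht => (continuous_chanMoment hB 0 (ha.trans ht.1).le).inv₀ fun y =>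
    (chanMoment_zero_pos q (ha.trans ht.1).le y).ne', Real.exp (b * B ^ 2 / 2) / q.real univ,
    B * √b, by positivity, by positivity, fun t ht y => ?_⟩
  have ht0 := (ha.trans ht.1).le
  rw [abs_of_pos (inv_pos.2 (chanMoment_zero_pos q ht0 y))]
  refine (inv_anti₀ (by positivity) (le_chanMoment_zero_of_bounded hB ht0 ht.2.le y)).trans_eq ?_
  rw [mul_inv, ← Real.exp_neg, neg_neg, Real.exp_add]
  field_simp

theorem tame_log_chanMoment_zero (hB0 : 0 ≤ B) (hB : ∀ᵐ x ∂q, |x| ≤ B) {a : ℝ} (ha : 0 < a)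
    {b : ℝ} : Tame a b (fun t y => Real.log (chanMoment q 0 t y)) := by
  obtain ⟨C, c, hC, hc, h⟩ := (tame_chanMoment hB0 hB 0 ha b).bound
  obtain ⟨D, d, hD, hd, h'⟩ := (tame_inv_chanMoment_zero hB0 hB ha (b := b)).bound
  refine ⟨fun t ht => (continuous_chanMoment hB 0 (ha.trans ht.1).le).log fun y =>
    (chanMoment_zero_pos q (ha.trans ht.1).le y).ne', C + D, c + d, by positivity, by positivity,
    fun t ht y => ?_⟩
  have h0 := chanMoment_zero_pos q (ha.trans ht.1).le y
  have h1 := h t ht y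
  have h2 := h' t ht y
  rw [abs_of_pos h0] at h1
  rw [abs_of_pos (inv_pos.2 h0)] at h2
  have h3 := Real.log_le_sub_one_of_pos h0
  have h4 := Real.log_le_sub_one_of_pos (inv_pos.2 h0)
  rw [Real.log_inv] at h4
  have hy := abs_nonneg y
  have h5 : C * Real.exp (c * |y|) ≤ C * Real.exp ((c + d) * |y|) := by gcongr; linarith
  have h6 : D * Real.exp (d * |y|) ≤ D * Real.exp ((c + d) * |y|) := by gcongr; linarith
  have h7 : 0 ≤ C * Real.exp ((c + d) * |y|) := by positivity
  have h8 : 0 ≤ D * Real.exp ((c + d) * |y|) := by positivity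
  rw [add_mul, abs_le]
  constructor <;> linarith

end Bounded

/-! ### Derivatives of information and MMSE in the signal-to-noise ratio -/

/-- Second moment of the conditional variance of the signal. -/
noncomputable def varSq (q : Measure ℝ) (t : ℝ) : ℝ :=
  ∫ y, (chanMoment q 2 t y * chanMoment q 0 t y - chanMoment q 1 t y ^ 2) ^ 2
    / chanMoment q 0 t y ^ 3 ∂stdGaussian

/-- The sixth moment of the standard normal law. -/
noncomputable def sixthMoment : ℝ := ∫ z, z ^ 6 ∂stdGaussian

section Bounded

variable {q : Measure ℝ} [IsFiniteMeasure q] [NeZero q] {B : ℝ}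

/-- The I-MMSE relation. With `Aₖ` the moments and `L = log A₀`, the heat-flow lemma applies to `X =
A₁(L + 1)` and `Y = A₂(L + 1)`; after integration by parts the logarithms cancel and `A₁²/A₀`
remains. The total mass of `q` is irrelevant, so truncations need no normalization. -/
theorem hasDerivAt_outputDiv (hB0 : 0 ≤ B) (hB : ∀ᵐ x ∂q, |x| ≤ B) {t : ℝ} (ht : 0 < t) :
    HasDerivAt (outputDiv q) (1 / 2 * meanSq q t) t := by
  have ha : 0 < t / 2 := by linarith
  have hT := fun k => tame_chanMoment hB0 hB k ha (2 * t)
  have hI := tame_inv_chanMoment_zero hB0 hB ha (b := 2 * t)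
  have hL := tame_log_chanMoment_zero hB0 hB ha (b := 2 * t)
  have h1 := Tame.const (t / 2) (2 * t) 1
  have key := Tame.hasDerivAt_integral ha ((hT 0).mul hL) ((hT 1).mul (hL.add h1))
    (((hT 2).mul (hL.add h1)).add (((hT 1).pow 2).mul hI)) ((hT 2).mul (hL.add h1))
    ?_ ?_ (t := t) ⟨by linarith, by linarith⟩
  · refine key.congr_deriv ?_
    rw [meanSq, ← integral_const_mul]
    refine integral_congr_ae (.of_forall fun y => ?_)
    simp only
    ring
  · intro s hs y
    have hs0 := ha.trans hs.1
    have h0 := (chanMoment_zero_pos q hs0.le y).ne'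
    have d0 := hasDerivAt_chanMoment_left hB 0 hs0 y
    refine (d0.mul (d0.log h0)).congr_deriv ?_
    simp only [zero_add]
    field_simp
  · intro s hs y
    have hs0 := ha.trans hs.1
    have h0 := (chanMoment_zero_pos q hs0.le y).ne'
    have d0 := hasDerivAt_chanMoment_right hB 0 hs0.le y
    have d1 := hasDerivAt_chanMoment_right hB 1 hs0.le y
    refine (d1.mul ((d0.log h0).add_const 1)).congr_deriv ?_
    simp only [zero_add, Nat.reduceAdd]
    field_simp

/-- The same mechanism applied to `A₁²/A₀`. The third moments cancel and what remains is a perfect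
square, `A₀` times the squared posterior variance, so `meanSq` is non-decreasing. -/
theorem hasDerivAt_meanSq (hB0 : 0 ≤ B) (hB : ∀ᵐ x ∂q, |x| ≤ B) {t : ℝ} (ht : 0 < t) :
    HasDerivAt (meanSq q) (varSq q t) t := by
  have ha : 0 < t / 2 := by linarith
  have hT := fun k => tame_chanMoment hB0 hB k ha (2 * t)
  have hI := tame_inv_chanMoment_zero hB0 hB ha (b := 2 * t)
  have hc := Tame.const (t / 2) (2 * t)
  have key := Tame.hasDerivAt_integral ha (((hT 1).pow 2).mul hI)
    ((((hc 2).mul ((hT 1).mul (hT 2))).mul hI).sub (((hT 1).pow 3).mul (hI.pow 2)))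
    (((((hc 2).mul ((hT 2).pow 2)).add ((hc 2).mul ((hT 1).mul (hT 3)))).mul hI).sub
      ((((hc 5).mul (((hT 1).pow 2).mul (hT 2))).mul (hI.pow 2)).sub
        (((hc 2).mul ((hT 1).pow 4)).mul (hI.pow 3))))
    ((((hc 2).mul ((hT 1).mul (hT 3))).mul hI).sub
      ((((hT 1).pow 2).mul (hT 2)).mul (hI.pow 2)))
    ?_ ?_ (t := t) ⟨by linarith, by linarith⟩
  · simp only [← div_eq_mul_inv] at key
    refine key.congr_deriv ?_
    rw [varSq]
    refine integral_congr_ae (.of_forall fun y => ?_)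
    have h0 := (chanMoment_zero_pos q ht.le y).ne'
    simp only
    field_simp
    ring
  · intro s hs y
    have hs0 := ha.trans hs.1
    have h0 := (chanMoment_zero_pos q hs0.le y).ne'
    have d0 := hasDerivAt_chanMoment_left hB 0 hs0 y
    have d1 := hasDerivAt_chanMoment_left hB 1 hs0 y
    refine ((d1.pow 2).mul (d0.inv h0)).congr_deriv ?_
    simp only [zero_add, Nat.reduceAdd, Nat.cast_ofNat, Nat.add_one_sub_one, pow_one,
      Pi.pow_apply, Pi.inv_apply]
    field_simp
    ring
  · intro s hs y
    have hs0 := ha.trans hs.1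
    have h0 := (chanMoment_zero_pos q hs0.le y).ne'
    have d0 := hasDerivAt_chanMoment_right hB 0 hs0.le y
    have d1 := hasDerivAt_chanMoment_right hB 1 hs0.le y
    have d2 := hasDerivAt_chanMoment_right hB 2 hs0.le y
    refine ((((d1.mul d2).const_mul 2).mul (d0.inv h0)).sub
      ((d1.pow 3).mul ((d0.inv h0).pow 2))).congr_deriv ?_
    simp only [zero_add, Nat.reduceAdd, Nat.cast_ofNat, Nat.reduceSub, pow_one,
      Pi.pow_apply, Pi.inv_apply, Pi.mul_apply]
    field_simp
    ring

/-- Cubed conditional variances are controlled by sixth moments of the noise. -/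
theorem condVar_cube_le (hB : ∀ᵐ x ∂q, |x| ≤ B) {t : ℝ} (ht : 0 < t) (y : ℝ) :
    (chanMoment q 2 t y * chanMoment q 0 t y - chanMoment q 1 t y ^ 2) ^ 3
      / chanMoment q 0 t y ^ 5 ≤ ∫ x, (x - y / √t) ^ 6 * chanKernel t x y ∂q := by
  set c := y / √t with hc
  set A := chanMoment q 0 t y with hA
  have h0 : 0 < A := chanMoment_zero_pos q ht.le y
  have hi : ∀ n : ℕ, Integrable (fun x => (x - c) ^ n * chanKernel t x y) q := by
    intro n
    refine (integrable_chanKernel q ht.le y).bdd_mul (c := (B + |c|) ^ n) (by fun_prop) ?_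
    filter_upwards [hB] with x hx
    rw [norm_pow, Real.norm_eq_abs]
    refine pow_le_pow_left₀ (abs_nonneg _) ((abs_sub _ _).trans (by linarith)) n
  have h2 := integral_sub_sq_mul_chanKernel (integrable_pow_of_bounded hB 2) ht.le y c
  set W := ∫ x, (x - c) ^ 2 * chanKernel t x y ∂q with hW
  have hW0 : 0 ≤ W := integral_nonneg fun x => mul_nonneg (sq_nonneg _) (chanKernel_pos _ _ _).le
  have hV : (chanMoment q 2 t y * A - chanMoment q 1 t y ^ 2) / A ≤ W := by
    rw [h2, div_le_iff₀ h0]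
    nlinarith [sq_nonneg (c * A - chanMoment q 1 t y)]
  have hV0 : 0 ≤ (chanMoment q 2 t y * A - chanMoment q 1 t y ^ 2) / A := by
    refine div_nonneg ?_ h0.le
    have := chanMoment_one_sq_div_le (integrable_pow_of_bounded hB 2) ht.le y
    rw [div_le_iff₀ h0] at this
    linarith
  -- Jensen for the cube, through the tangent at the mean `a = W / A`: `u³ - 3a²u + 2a³ = (u - a)²(u
  -- + 2a) ≥ 0` for `u = (x - c)²`.
  have hJ : W ^ 3 / A ^ 2 ≤ ∫ x, (x - c) ^ 6 * chanKernel t x y ∂q := by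
    have h3 : ∫ x, (3 * (W / A) ^ 2 * ((x - c) ^ 2 * chanKernel t x y)
        - 2 * (W / A) ^ 3 * chanKernel t x y) ∂q ≤ ∫ x, (x - c) ^ 6 * chanKernel t x y ∂q := by
      refine integral_mono (((hi 2).const_mul _).sub ((integrable_chanKernel q ht.le y).const_mul _))
        (hi 6) fun x => ?_
      have ha : 0 ≤ W / A := div_nonneg hW0 h0.le
      have hu : 0 ≤ (x - c) ^ 2 := sq_nonneg _
      have : 0 ≤ (x - c) ^ 6 - 3 * (W / A) ^ 2 * (x - c) ^ 2 + 2 * (W / A) ^ 3 := by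
        have e : (x - c) ^ 6 - 3 * (W / A) ^ 2 * (x - c) ^ 2 + 2 * (W / A) ^ 3
          = ((x - c) ^ 2 - W / A) ^ 2 * ((x - c) ^ 2 + 2 * (W / A)) := by ring
        rw [e]
        positivity
      have := mul_nonneg this (chanKernel_pos t x y).le
      simp only
      linarith
    rw [integral_sub ((hi 2).const_mul _) ((integrable_chanKernel q ht.le y).const_mul _),
      integral_const_mul, integral_const_mul, ← hW, ← chanMoment_zero, ← hA] at h3
    refine le_trans (le_of_eq ?_) h3
    field_simp
    ring
  refine le_trans ?_ hJ
  have := pow_le_pow_left₀ hV0 hV 3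
  calc _ = ((chanMoment q 2 t y * A - chanMoment q 1 t y ^ 2) / A) ^ 3 / A ^ 2 := by
        field_simp
    _ ≤ _ := by gcongr

theorem integrable_sub_pow_six {q : Measure ℝ} [IsFiniteMeasure q] {t : ℝ} (ht : 0 < t) :
    Integrable (fun r : ℝ × ℝ => chanKernel t r.1 r.2 * (r.1 - r.2 / √t) ^ 6)
      (q.prod stdGaussian) := by
  have h := Real.sqrt_pos.2 ht
  rw [← integrable_chanLaw_iff q ht.le (fun r => (r.1 - r.2 / √t) ^ 6),
    integrable_chanLaw_iff_comp q t (by fun_prop)]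
  refine (((integrable_pow_stdGaussian 6).const_mul (1 / √t ^ 6)).comp_snd q).congr
    (.of_forall fun r => ?_)
  simp only [observation]
  field_simp
  ring

/-- Under the channel `x - y/√t` equals `-z/√t`, so only noise moments enter. The bound is
independent of the support of the signal and therefore survives truncation. -/
theorem integral_sub_pow_six {q : Measure ℝ} [IsFiniteMeasure q] {t : ℝ} (ht : 0 < t) :
    ∫ y, ∫ x, (x - y / √t) ^ 6 * chanKernel t x y ∂q ∂stdGaussian
      = q.real univ * sixthMoment / t ^ 3 := by
  have h := Real.sqrt_pos.2 ht
  have e1 := integral_chanLaw q ht.le (fun r => (r.1 - r.2 / √t) ^ 6)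
  rw [integral_prod_symm _ (integrable_sub_pow_six ht), integral_chanLaw_comp q t (by fun_prop)] at e1
  have e2 : ∀ r : ℝ × ℝ, (r.1 - observation t r / √t) ^ 6 = 1 / t ^ 3 * r.2 ^ 6 := by
    intro r
    have : t ^ 3 = √t ^ 6 := by
      conv_lhs => rw [← Real.sq_sqrt ht.le]
      ring
    rw [observation, this]
    field_simp
    ring
  simp only [e2] at e1
  rw [integral_fun_snd (fun z : ℝ => 1 / t ^ 3 * z ^ 6), integral_const_mul] at e1
  simp only [mul_comm (_ ^ 6 : ℝ)]
  rw [← e1, sixthMoment, smul_eq_mul]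
  ring

/-- The derivative is the output average of `κ₃² - 2 Var³`, with `κ₃` the posterior third cumulant.
Dropping the square and applying `condVar_cube_le` leaves the sixth noise moment. -/
theorem hasDerivAt_varSq (hB0 : 0 ≤ B) (hB : ∀ᵐ x ∂q, |x| ≤ B) {t : ℝ} (ht : 0 < t) :
    ∃ d, HasDerivAt (varSq q) d t ∧ -2 * (q.real univ * sixthMoment / t ^ 3) ≤ d := by
  have ha : 0 < t / 2 := by linarith
  have htm : t ∈ Ioo (t / 2) (2 * t) := ⟨by linarith, by linarith⟩
  have hT := fun k => tame_chanMoment hB0 hB k ha (2 * t)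
  have hI := tame_inv_chanMoment_zero hB0 hB ha (b := 2 * t)
  have hc := Tame.const (t / 2) (2 * t)
  -- `hD` concerns `D = A₂A₀ - A₁²`. Up to factors `√t`, `hD1` and `hD2` concern its first and
  -- second `y`-derivatives; `hDY` collects the terms of its `t`-derivative without the factor `y`.
  have hD := ((hT 2).mul (hT 0)).sub ((hT 1).pow 2)
  have hD1 := ((hT 3).mul (hT 0)).sub ((hT 1).mul (hT 2))
  have hDY := (((hT 4).mul (hT 0)).add ((hT 2).pow 2)).sub ((hc 2).mul ((hT 1).mul (hT 3)))
  have hD2 := ((hT 4).mul (hT 0)).sub ((hT 2).pow 2)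
  have hX' := (((((hc 2).mul (hD1.pow 2)).add (((hc 2).mul hD).mul hD2)).mul (hI.pow 3)).sub
    ((((hc 12).mul ((hD.mul hD1).mul (hT 1))).add ((hc 3).mul ((hD.pow 2).mul (hT 2)))).mul
      (hI.pow 4))).add (((hc 12).mul ((hD.pow 2).mul ((hT 1).pow 2))).mul (hI.pow 5))
  have hY := ((((hc 2).mul hD).mul hDY).mul (hI.pow 3)).sub
    (((hc 3).mul ((hD.pow 2).mul (hT 2))).mul (hI.pow 4))
  have key := Tame.hasDerivAt_integral ha ((hD.pow 2).mul (hI.pow 3))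
    ((((hc 2).mul (hD.mul hD1)).mul (hI.pow 3)).sub
      (((hc 3).mul ((hD.pow 2).mul (hT 1))).mul (hI.pow 4))) hX' hY ?_ ?_ htm
  · refine ⟨_, key.congr_of_eventuallyEq (.of_forall fun s => ?_), ?_⟩
    · rw [varSq]
      simp only [inv_pow, div_eq_mul_inv]
    · rw [← integral_sub_pow_six ht, ← integral_const_mul]
      have hi6 : Integrable (fun y => -2 * ∫ x, (x - y / √t) ^ 6 * chanKernel t x y ∂q)
          stdGaussian := by
        refine ((integrable_sub_pow_six (q := q) ht).integral_prod_right.const_mul (-2)).congr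
          (.of_forall fun y => ?_)
        simp only [mul_comm (_ ^ 6 : ℝ)]
      refine integral_mono hi6 (((hc (1 / 2)).mul (hX'.sub hY)).integrable htm) fun y => ?_
      have h0 := chanMoment_zero_pos q ht.le y
      have h6 := condVar_cube_le hB ht y
      simp only
      generalize chanMoment q 0 t y = A0 at *
      generalize chanMoment q 1 t y = A1 at *
      generalize chanMoment q 2 t y = A2 at *
      generalize chanMoment q 3 t y = A3 at *
      generalize chanMoment q 4 t y = A4 at *
      -- The square is `κ₃²` and the subtracted term `2 Var³`, both weighted by `A₀`.
      refine le_trans ?_ (le_of_eq (?_ :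
        (((A3 * A0 - A1 * A2) * A0 - 2 * A1 * (A2 * A0 - A1 ^ 2)) ^ 2 / A0 ^ 5
        - 2 * ((A2 * A0 - A1 ^ 2) ^ 3 / A0 ^ 5)) = _))
      · have : 0 ≤ ((A3 * A0 - A1 * A2) * A0 - 2 * A1 * (A2 * A0 - A1 ^ 2)) ^ 2 / A0 ^ 5 := by
          positivity
        linarith
      · field_simp
        ring
  · intro s hs y
    have hs0 := ha.trans hs.1
    have h0 := (chanMoment_zero_pos q hs0.le y).ne'
    have d0 := hasDerivAt_chanMoment_left hB 0 hs0 y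
    have d1 := hasDerivAt_chanMoment_left hB 1 hs0 y
    have d2 := hasDerivAt_chanMoment_left hB 2 hs0 y
    refine ((((d2.mul d0).sub (d1.pow 2)).pow 2).mul ((d0.inv h0).pow 3)).congr_deriv ?_
    simp only [zero_add, Nat.reduceAdd, Nat.cast_ofNat, Nat.reduceSub, pow_one,
      Pi.pow_apply, Pi.inv_apply, Pi.mul_apply, Pi.sub_apply]
    generalize 1 / (2 * √s) = w
    generalize chanMoment q 0 s y = A0 at *
    generalize chanMoment q 1 s y = A1 at *
    generalize chanMoment q 2 s y = A2 at *
    generalize chanMoment q 3 s y = A3 at *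
    generalize chanMoment q 4 s y = A4 at *
    field_simp
    ring
  · intro s hs y
    have hs0 := ha.trans hs.1
    have h0 := (chanMoment_zero_pos q hs0.le y).ne'
    have d0 := hasDerivAt_chanMoment_right hB 0 hs0.le y
    have d1 := hasDerivAt_chanMoment_right hB 1 hs0.le y
    have d2 := hasDerivAt_chanMoment_right hB 2 hs0.le y
    have d3 := hasDerivAt_chanMoment_right hB 3 hs0.le y
    have dD := (d2.mul d0).sub (d1.pow 2)
    have dD1 := (d3.mul d0).sub (d1.mul d2)
    refine ((((dD.mul dD1).const_mul 2).mul ((d0.inv h0).pow 3)).sub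
      ((((dD.pow 2).mul d1).const_mul 3).mul ((d0.inv h0).pow 4))).congr_deriv ?_
    simp only [zero_add, Nat.reduceAdd, Nat.cast_ofNat, Nat.reduceSub, pow_one,
      Pi.pow_apply, Pi.inv_apply, Pi.mul_apply, Pi.sub_apply]
    generalize √s = w
    generalize chanMoment q 0 s y = A0 at *
    generalize chanMoment q 1 s y = A1 at *
    generalize chanMoment q 2 s y = A2 at *
    generalize chanMoment q 3 s y = A3 at *
    generalize chanMoment q 4 s y = A4 at *
    field_simp
    ring

/-- Mean value theorem with a monotone derivative. The statement is about increments because these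
inequalities pass to pointwise limits, while derivatives need not. -/
theorem outputDiv_increment_of_bounded (hB0 : 0 ≤ B) (hB : ∀ᵐ x ∂q, |x| ≤ B) {s t : ℝ} (hs : 0 < s)
    (hst : s < t) :
    (t - s) / 2 * meanSq q s ≤ outputDiv q t - outputDiv q s ∧
      outputDiv q t - outputDiv q s ≤ (t - s) / 2 * meanSq q t := by
  have hmono : MonotoneOn (meanSq q) (Ioi 0) := by
    refine monotoneOn_of_deriv_nonneg (convex_Ioi 0)
      (fun u hu => (hasDerivAt_meanSq hB0 hB hu).continuousAt.continuousWithinAt) ?_ ?_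
    · intro u hu
      rw [interior_Ioi] at hu
      exact (hasDerivAt_meanSq hB0 hB hu).differentiableAt.differentiableWithinAt
    · intro u hu
      rw [interior_Ioi] at hu
      rw [(hasDerivAt_meanSq hB0 hB hu).deriv]
      exact integral_nonneg fun y =>
        div_nonneg (sq_nonneg _) (pow_nonneg (chanMoment_zero_nonneg q u y) 3)
  obtain ⟨u, hu, h⟩ := exists_hasDerivAt_eq_slope (outputDiv q) (fun u => 1 / 2 * meanSq q u) hst
    (fun u hu => (hasDerivAt_outputDiv hB0 hB (hs.trans_le hu.1)).continuousAt.continuousWithinAt)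
    (fun u hu => hasDerivAt_outputDiv hB0 hB (hs.trans hu.1))
  have hd : 0 < t - s := by linarith
  rw [eq_div_iff hd.ne'] at h
  have h1 := hmono hs (hs.trans hu.1 : (0 : ℝ) < u) hu.1.le
  have h2 := hmono (hs.trans hu.1 : (0 : ℝ) < u) (hs.trans hst : (0 : ℝ) < t) hu.2.le
  rw [← h]
  constructor <;> nlinarith

/-- The second derivative of `K / t` is `2K / t³`, which matches exactly the lower bound for the
derivative of `varSq`. -/
theorem concaveOn_of_bounded (hB0 : 0 ≤ B) (hB : ∀ᵐ x ∂q, |x| ≤ B) :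
    ConcaveOn ℝ (Ioi 0) (fun t => -meanSq q t - q.real univ * sixthMoment / t) := by
  set K := q.real univ * sixthMoment
  have d1 : ∀ t ∈ Ioi (0 : ℝ), HasDerivAt (fun t => -meanSq q t - K / t)
      (-varSq q t + K / t ^ 2) t := by
    intro t ht
    have ht' : t ≠ 0 := ne_of_gt ht
    refine ((hasDerivAt_meanSq hB0 hB ht).neg.sub
      ((hasDerivAt_inv ht').const_mul K)).congr_deriv ?_
    ring
  have e1 : ∀ t ∈ Ioi (0 : ℝ), deriv (fun t => -meanSq q t - K / t) t = -varSq q t + K / t ^ 2 :=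
    fun t ht => (d1 t ht).deriv
  have d2 : ∀ t ∈ Ioi (0 : ℝ), ∃ d ≤ 0, HasDerivAt (fun t => -varSq q t + K / t ^ 2) d t := by
    intro t ht
    have ht' : t ≠ 0 := ne_of_gt ht
    obtain ⟨d, hd, hle⟩ := hasDerivAt_varSq hB0 hB ht
    refine ⟨-d + -2 * (K / t ^ 3), by linarith, ?_⟩
    refine (hd.neg.add (((hasDerivAt_pow 2 t).inv (by positivity)).const_mul K)).congr_deriv ?_
    simp
    field_simp
  refine AntitoneOn.concaveOn_of_deriv (convex_Ioi 0)
    (fun t ht => (d1 t ht).continuousAt.continuousWithinAt) ?_ ?_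
  · rw [interior_Ioi]
    exact fun t ht => (d1 t ht).differentiableAt.differentiableWithinAt
  · rw [interior_Ioi]
    have h : AntitoneOn (fun t => -varSq q t + K / t ^ 2) (Ioi 0) := by
      refine antitoneOn_of_deriv_nonpos (convex_Ioi 0) ?_ ?_ ?_
      · intro t ht
        obtain ⟨d, -, hd⟩ := d2 t ht
        exact hd.continuousAt.continuousWithinAt
      · rw [interior_Ioi]
        intro t ht
        obtain ⟨d, -, hd⟩ := d2 t ht
        exact hd.differentiableAt.differentiableWithinAt
      · rw [interior_Ioi]
        intro t ht
        obtain ⟨d, hle, hd⟩ := d2 t ht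
        rwa [hd.deriv]
    exact h.congr fun t ht => (e1 t ht).symm

end Bounded

/-! ### General signals by truncation -/

/-- The signal law restricted to `[-n, n]`. -/
noncomputable def truncLaw (p : Measure ℝ) (n : ℕ) : Measure ℝ := p.restrict (Icc (-(n : ℝ)) n)

instance (p : Measure ℝ) [IsFiniteMeasure p] (n : ℕ) : IsFiniteMeasure (truncLaw p n) := by
  unfold truncLaw; infer_instance

theorem aecover_truncLaw (p : Measure ℝ) : AECover p atTop (fun n : ℕ => Icc (-(n : ℝ)) n) :=
  aecover_Icc (tendsto_neg_atTop_atBot.comp tendsto_natCast_atTop_atTop)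
    tendsto_natCast_atTop_atTop

theorem truncLaw_bounded (p : Measure ℝ) (n : ℕ) : ∀ᵐ x ∂(truncLaw p n), |x| ≤ (n : ℝ) := by
  filter_upwards [ae_restrict_mem measurableSet_Icc] with x hx
  exact abs_le.2 hx

theorem integrable_pow_of_le_two {p : Measure ℝ} [IsProbabilityMeasure p]
    (hp : Integrable (fun x : ℝ => x ^ 2) p) {k : ℕ} (hk : k ≤ 2) : Integrable (fun x : ℝ => x ^ k) p := by
  interval_cases k
  · simp
  · simpa using integrable_id_of_sq hp
  · exact hp

theorem tendsto_chanMoment_truncLaw {p : Measure ℝ} [IsProbabilityMeasure p]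
    (hp : Integrable (fun x : ℝ => x ^ 2) p) {k : ℕ} (hk : k ≤ 2) {t : ℝ} (ht : 0 ≤ t) (y : ℝ) :
    Tendsto (fun n => chanMoment (truncLaw p n) k t y) atTop (𝓝 (chanMoment p k t y)) :=
  (aecover_truncLaw p).integral_tendsto_of_countably_generated
    (integrable_pow_mul_chanKernel (integrable_pow_of_le_two hp hk) ht y)

theorem tendsto_truncLaw_univ (p : Measure ℝ) [IsProbabilityMeasure p] :
    Tendsto (fun n => (truncLaw p n).real univ) atTop (𝓝 1) := by
  have := (aecover_truncLaw p).integral_tendsto_of_countably_generated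
    (integrable_const (μ := p) (1 : ℝ))
  simpa [truncLaw] using this

theorem eventually_neZero_truncLaw (p : Measure ℝ) [IsProbabilityMeasure p] : ∀ᶠ n in atTop, NeZero (truncLaw p n) := by
  filter_upwards [(tendsto_truncLaw_univ p).eventually (lt_mem_nhds one_pos)] with n hn
  refine ⟨fun h => ?_⟩
  rw [h] at hn
  simp at hn

theorem integrable_truncLaw {p : Measure ℝ} {f : ℝ → ℝ} (hf : Integrable f p) (n : ℕ) :
    Integrable f (truncLaw p n) := hf.restrict

theorem chanMoment_truncLaw_two_le {p : Measure ℝ} [IsProbabilityMeasure p]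
    (hp : Integrable (fun x : ℝ => x ^ 2) p) {t : ℝ} (ht : 0 ≤ t) (y : ℝ) (n : ℕ) :
    chanMoment (truncLaw p n) 2 t y ≤ chanMoment p 2 t y :=
  setIntegral_le_integral (integrable_pow_mul_chanKernel hp ht y)
    (.of_forall fun x => mul_nonneg (sq_nonneg x) (chanKernel_pos _ _ _).le)

theorem chanMoment_truncLaw_zero_le {p : Measure ℝ} [IsProbabilityMeasure p] {t : ℝ} (ht : 0 ≤ t) (y : ℝ) (n : ℕ) :
    chanMoment (truncLaw p n) 0 t y ≤ chanMoment p 0 t y := by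
  rw [chanMoment_zero, chanMoment_zero]
  exact setIntegral_le_integral (integrable_chanKernel p ht y)
    (.of_forall fun x => (chanKernel_pos _ _ _).le)

/-- Dominated convergence: `A₁²/A₀ ≤ A₂`, and truncation only decreases `A₂`. -/
theorem tendsto_meanSq_truncLaw {p : Measure ℝ} [IsProbabilityMeasure p]
    (hp : Integrable (fun x : ℝ => x ^ 2) p) {t : ℝ} (ht : 0 ≤ t) :
    Tendsto (fun n => meanSq (truncLaw p n) t) atTop (𝓝 (meanSq p t)) := by
  refine tendsto_integral_of_dominated_convergence (chanMoment p 2 t) (fun n =>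
    (((measurable_chanMoment _ 1 t).pow_const 2).div
      (measurable_chanMoment _ 0 t)).aestronglyMeasurable) (integrable_chanMoment hp ht)
    (fun n => .of_forall fun y => ?_) (.of_forall fun y => ?_)
  · rw [Real.norm_eq_abs,
      abs_of_nonneg (div_nonneg (sq_nonneg _) (chanMoment_zero_nonneg _ t y))]
    exact (chanMoment_one_sq_div_le (integrable_truncLaw hp n) ht y).trans
      (chanMoment_truncLaw_two_le hp ht y n)
  · exact ((tendsto_chanMoment_truncLaw hp one_le_two ht y).pow 2).div
      (tendsto_chanMoment_truncLaw hp zero_le_two ht y) (chanMoment_zero_pos p ht y).ne'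

/-- Dominated convergence with `-1 ≤ a log a ≤ a y² / 2`; the upper bound uses `a ≤ exp(y² / 2)`,
and `A₀ y²` is integrable because the output has a second moment. -/
theorem tendsto_outputDiv_truncLaw {p : Measure ℝ} [IsProbabilityMeasure p]
    (hp : Integrable (fun x : ℝ => x ^ 2) p) {t : ℝ} (ht : 0 ≤ t) :
    Tendsto (fun n => outputDiv (truncLaw p n) t) atTop (𝓝 (outputDiv p t)) := by
  have hi : Integrable (fun y => 1 + chanMoment p 0 t y * y ^ 2) stdGaussian :=
    (integrable_const 1).add ((integrable_snd_chanLaw_iff p ht (f := fun y => y ^ 2)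
      (by fun_prop)).1 (integrable_snd_sq_chanLaw hp t))
  refine tendsto_integral_of_dominated_convergence _ (fun n =>
    ((measurable_chanMoment _ 0 t).mul (measurable_chanMoment _ 0 t).log).aestronglyMeasurable) hi
    (fun n => .of_forall fun y => ?_) (.of_forall fun y => ?_)
  · set a := chanMoment (truncLaw p n) 0 t y with ha
    have ha0 : 0 ≤ a := chanMoment_zero_nonneg _ _ _
    have ha1 : a ≤ chanMoment p 0 t y := chanMoment_truncLaw_zero_le ht y n
    have ha2 : a ≤ Real.exp (y ^ 2 / 2) := ha1.trans (by simpa using chanMoment_zero_le p ht y)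
    rw [Real.norm_eq_abs]
    rcases ha0.eq_or_lt with h | h
    · rw [← h, zero_mul, abs_zero]
      have := chanMoment_zero_nonneg p t y
      positivity
    · have h1 := Real.one_sub_inv_le_log_of_pos h
      have h2 : Real.log a ≤ y ^ 2 / 2 := (Real.log_le_iff_le_exp h).2 ha2
      have h3 := mul_le_mul_of_nonneg_left h1 ha0
      rw [mul_sub, mul_inv_cancel₀ h.ne'] at h3
      have h4 := mul_le_mul_of_nonneg_left h2 ha0
      have h5 : a * y ^ 2 ≤ chanMoment p 0 t y * y ^ 2 := by gcongr
      have h6 : 0 ≤ a * y ^ 2 := by positivity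
      rw [abs_le]
      constructor <;> nlinarith
  · have h := tendsto_chanMoment_truncLaw hp zero_le_two ht y
    exact h.mul (h.log (chanMoment_zero_pos p ht y).ne')

theorem mutualInfo_increment {p : Measure ℝ} [IsProbabilityMeasure p]
    (hp : Integrable (fun x : ℝ => x ^ 2) p) {s t : ℝ} (hs : 0 < s) (hst : s < t) :
    (t - s) / 2 * mmse p t ≤ mutualInfo p t - mutualInfo p s ∧
      mutualInfo p t - mutualInfo p s ≤ (t - s) / 2 * mmse p s := by
  have ht := hs.trans hst
  have hK := (tendsto_outputDiv_truncLaw hp ht.le).sub (tendsto_outputDiv_truncLaw hp hs.le)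
  have h1 : (t - s) / 2 * meanSq p s ≤ outputDiv p t - outputDiv p s := by
    refine le_of_tendsto_of_tendsto ((tendsto_meanSq_truncLaw hp hs.le).const_mul _) hK ?_
    filter_upwards [eventually_neZero_truncLaw p] with n hn
    exact (outputDiv_increment_of_bounded n.cast_nonneg (truncLaw_bounded p n) hs hst).1
  have h2 : outputDiv p t - outputDiv p s ≤ (t - s) / 2 * meanSq p t := by
    refine le_of_tendsto_of_tendsto hK ((tendsto_meanSq_truncLaw hp ht.le).const_mul _) ?_
    filter_upwards [eventually_neZero_truncLaw p] with n hn
    exact (outputDiv_increment_of_bounded n.cast_nonneg (truncLaw_bounded p n) hs hst).2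
  rw [mutualInfo_eq hp ht.le, mutualInfo_eq hp hs.le, mmse_eq hp ht.le, mmse_eq hp hs.le]
  constructor <;> nlinarith

/-- Concavity is preserved under pointwise limits. This one-sided curvature bound is the Tauberian
condition used for uniqueness, and it also yields continuity of the MMSE. -/
theorem concaveOn_mmse_sub {p : Measure ℝ} [IsProbabilityMeasure p]
    (hp : Integrable (fun x : ℝ => x ^ 2) p) : ConcaveOn ℝ (Ioi 0) (fun t => mmse p t - sixthMoment / t) := by
  have hlim : ∀ t ∈ Ioi (0 : ℝ), Tendsto
      (fun n => -meanSq (truncLaw p n) t - (truncLaw p n).real univ * sixthMoment / t) atTop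
      (𝓝 (-meanSq p t - 1 * sixthMoment / t)) := fun t ht =>
    (tendsto_meanSq_truncLaw hp (le_of_lt ht)).neg.sub
      (((tendsto_truncLaw_univ p).mul_const _).div_const _)
  have h : ConcaveOn ℝ (Ioi 0) (fun t => -meanSq p t - 1 * sixthMoment / t) := by
    refine ⟨convex_Ioi 0, fun x hx y hy a b ha hb hab => ?_⟩
    refine le_of_tendsto_of_tendsto (((hlim x hx).const_smul a).add ((hlim y hy).const_smul b))
      (hlim _ (convex_Ioi 0 hx hy ha hb hab)) ?_
    filter_upwards [eventually_neZero_truncLaw p] with n hn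
    exact (concaveOn_of_bounded n.cast_nonneg (truncLaw_bounded p n)).2 hx hy ha hb hab
  refine (h.add_const (∫ x, x ^ 2 ∂p)).congr fun t ht => ?_
  simp only [Pi.add_apply]
  rw [mmse_eq hp (le_of_lt ht)]
  ring

/-! ### Monotonicity and continuity of the mutual information -/

theorem mutualInfo_nonneg (p : Measure ℝ) (t : ℝ) : 0 ≤ mutualInfo p t := ENNReal.toReal_nonneg

theorem mutualInfo_le {p : Measure ℝ} [IsProbabilityMeasure p]
    (hp : Integrable (fun x : ℝ => x ^ 2) p) {t : ℝ} (ht : 0 ≤ t) : mutualInfo p t ≤ t / 2 * ∫ x, x ^ 2 ∂p := by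
  rw [mutualInfo_eq hp ht]
  linarith [outputDiv_nonneg hp ht]

theorem mutualInfo_zero {p : Measure ℝ} [IsProbabilityMeasure p]
    (hp : Integrable (fun x : ℝ => x ^ 2) p) : mutualInfo p 0 = 0 :=
  le_antisymm (by simpa using mutualInfo_le hp le_rfl) (mutualInfo_nonneg p 0)

theorem mmse_nonneg (p : Measure ℝ) (t : ℝ) : 0 ≤ mmse p t := integral_nonneg fun _ => sq_nonneg _

theorem mmse_le {p : Measure ℝ} [IsProbabilityMeasure p]
    (hp : Integrable (fun x : ℝ => x ^ 2) p) {t : ℝ} (ht : 0 ≤ t) : mmse p t ≤ ∫ x, x ^ 2 ∂p := by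
  rw [mmse_eq hp ht]
  linarith [meanSq_nonneg p t]

theorem monotoneOn_mutualInfo {p : Measure ℝ} [IsProbabilityMeasure p]
    (hp : Integrable (fun x : ℝ => x ^ 2) p) : MonotoneOn (mutualInfo p) (Ici 0) := by
  intro s hs t ht hst
  rcases (show (0 : ℝ) ≤ s from hs).eq_or_lt with rfl | hs
  · rw [mutualInfo_zero hp]
    exact mutualInfo_nonneg p t
  rcases hst.eq_or_lt with rfl | hst
  · exact le_rfl
  · have h1 := (mutualInfo_increment hp hs hst).1
    have h2 := mmse_nonneg p t
    have : 0 ≤ (t - s) / 2 * mmse p t := mul_nonneg (by linarith) h2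
    linarith

theorem continuousOn_mutualInfo {p : Measure ℝ} [IsProbabilityMeasure p]
    (hp : Integrable (fun x : ℝ => x ^ 2) p) : ContinuousOn (mutualInfo p) (Ici 0) := by
  set K := ∫ x, x ^ 2 ∂p
  have hK : 0 ≤ K := integral_nonneg fun x => sq_nonneg x
  have key : ∀ s ∈ Ici (0 : ℝ), ∀ t ∈ Ici (0 : ℝ), s ≤ t →
      |mutualInfo p t - mutualInfo p s| ≤ K * |t - s| := by
    intro s hs t ht hst
    rw [abs_of_nonneg (sub_nonneg.2 (monotoneOn_mutualInfo hp hs ht hst)),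
      abs_of_nonneg (sub_nonneg.2 hst)]
    -- The increment bounds start at positive `s`; the endpoint uses `I(0) = 0` and the linear bound
    -- instead.
    rcases (show (0 : ℝ) ≤ s from hs).eq_or_lt with rfl | hs
    · rw [mutualInfo_zero hp]
      have := mutualInfo_le hp ht
      have : 0 ≤ t * K := mul_nonneg ht hK
      linarith
    rcases hst.eq_or_lt with rfl | hst
    · simp
    · have h1 := (mutualInfo_increment hp hs hst).2
      have h2 := mmse_le hp hs.le
      have : (t - s) / 2 * mmse p s ≤ (t - s) / 2 * K := by gcongr
      have : 0 ≤ (t - s) * K := mul_nonneg (by linarith) hK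
      linarith
  have hl : LipschitzOnWith (Real.toNNReal K) (mutualInfo p) (Ici 0) := by
    refine LipschitzOnWith.of_dist_le_mul fun s hs t ht => ?_
    rw [Real.coe_toNNReal K hK, Real.dist_eq, Real.dist_eq]
    rcases le_total s t with h | h
    · rw [abs_sub_comm, abs_sub_comm s]
      exact key s hs t ht h
    · exact key t ht s hs h
  exact hl.continuousOn

/-! ### Mutual information and the entropy of the quantized signal -/

/-- Entropy, in nats, of `⌊n X⌋` for `X ∼ p`. -/
noncomputable def quantEntropy (p : Measure ℝ) (n : ℕ) : ℝ :=
  ∑' k : ℤ, Real.negMulLog (quantProb p n k)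

/-- The quantization cell with label `k`. -/
def quantCell (n : ℕ) (k : ℤ) : Set ℝ := {x : ℝ | ⌊(n : ℝ) * x⌋ = k}

theorem measurable_quantLabel (n : ℕ) : Measurable (fun x : ℝ => ⌊(n : ℝ) * x⌋) :=
  Int.measurable_floor.comp (measurable_const_mul _)

theorem measurableSet_quantCell (n : ℕ) (k : ℤ) : MeasurableSet (quantCell n k) :=
  measurable_quantLabel n (measurableSet_singleton k)

theorem volume_quantCell {n : ℕ} (hn : 1 ≤ n) (k : ℤ) :
    volume (quantCell n k) = ENNReal.ofReal (1 / n) := by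
  have hn' : (0 : ℝ) < n := by exact_mod_cast hn
  have : quantCell n k = Ico ((k : ℝ) / n) ((k + 1) / n) := by
    ext x
    rw [quantCell, mem_ofPred_eq, Int.floor_eq_iff, mem_Ico, div_le_iff₀' hn', lt_div_iff₀' hn']
  rw [this, Real.volume_Ico]
  congr 1
  field_simp
  ring

theorem abs_sub_le_of_quantLabel_eq {n : ℕ} {a : ℝ} (ha : 0 ≤ a) (han : a ≤ 2 * n) {x u : ℝ}
    (h : ⌊(n : ℝ) * u⌋ = ⌊(n : ℝ) * x⌋) : |a * u - a * x| ≤ 2 := by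
  have h1 := Int.abs_sub_lt_one_of_floor_eq_floor h
  rw [← mul_sub, abs_mul] at h1 ⊢
  rw [abs_of_nonneg ha]
  rw [Nat.abs_cast] at h1
  calc a * |u - x| ≤ 2 * n * |u - x| := by gcongr
    _ ≤ 2 := by linarith

/-- A bound for the likelihoods summed over quantization cells. -/
noncomputable def cellConst : ℝ := Real.exp 2 * √(Real.pi / (1 / 4))

theorem lintegral_gauss_affine {a : ℝ} (ha : 0 < a) (b : ℝ) :
    ∫⁻ u, ENNReal.ofReal (Real.exp 2 * a * Real.exp (-(b + a * u) ^ 2 / 4))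
      = ENNReal.ofReal cellConst := by
  have e : ∀ u, Real.exp 2 * a * Real.exp (-(b + a * u) ^ 2 / 4)
      = Real.exp 2 * a * Real.exp (-(1 / 4) * (b + a * u) ^ 2) := by
    intro u
    congr 2
    ring
  have hi0 := (integrable_exp_neg_mul_sq (b := 1 / 4) (by norm_num))
  have hi1 : Integrable (fun w => (fun v => Real.exp (-(1 / 4) * v ^ 2)) (b + w)) :=
    hi0.comp_add_left b
  have hi2 := (hi1.comp_mul_left' ha.ne').const_mul (Real.exp 2 * a)
  rw [← ofReal_integral_eq_lintegral_ofReal]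
  · congr 1
    simp only [e]
    rw [integral_const_mul, Measure.integral_comp_mul_left
      (fun w => Real.exp (-(1 / 4) * (b + w) ^ 2)), integral_add_left_eq_self
      (fun v => Real.exp (-(1 / 4) * v ^ 2)), integral_gaussian, cellConst, abs_of_pos
      (inv_pos.2 ha), smul_eq_mul]
    field_simp
  · simp only [e]
    exact hi2
  · exact .of_forall fun u => by positivity

/-- Dividing by the cell probability cancels `p`, leaving roughly a sum over cells of the maximum of
a Gaussian bump whose width is comparable to the cell width. Such a sum is bounded by a Lebesgue
integral of a wider bump, uniformly in `n`, `b` and `p`. -/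
theorem lintegral_div_cell_le (p : Measure ℝ) [IsProbabilityMeasure p] {n : ℕ} (hn : 1 ≤ n) {a : ℝ}
    (h1 : (n : ℝ) ≤ a) (h2 : a ≤ 2 * n) (b : ℝ) :
    ∫⁻ x, ENNReal.ofReal (Real.exp (-(b + a * x) ^ 2 / 2)) / p (quantCell n ⌊(n : ℝ) * x⌋) ∂p
      ≤ ENNReal.ofReal cellConst := by
  have hn' : (0 : ℝ) < n := by exact_mod_cast hn
  have ha : 0 < a := hn'.trans_le h1
  set ρ : ℝ → ENNReal :=
    fun u => ENNReal.ofReal (Real.exp 2 * a * Real.exp (-(b + a * u) ^ 2 / 4)) with hρ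
  have hρm : Measurable ρ := by fun_prop
  set Φ : ℤ → ENNReal := fun k => ∫⁻ u in quantCell n k, ρ u with hΦ
  have hpt : ∀ x, ENNReal.ofReal (Real.exp (-(b + a * x) ^ 2 / 2)) ≤ Φ ⌊(n : ℝ) * x⌋ := by
    intro x
    have hc : ∀ u ∈ quantCell n ⌊(n : ℝ) * x⌋,
        ENNReal.ofReal (a * Real.exp (-(b + a * x) ^ 2 / 2)) ≤ ρ u := by
      intro u hu
      refine ENNReal.ofReal_le_ofReal ?_
      have h3 := abs_le.1 (abs_sub_le_of_quantLabel_eq ha.le h2 hu)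
      -- Within a cell the argument moves by at most `2`. The `8` becomes the factor `exp 2`, and
      -- the `2` halves the exponent from `1/2` to `1/4`.
      have h4 : (b + a * u) ^ 2 ≤ 2 * (b + a * x) ^ 2 + 8 := by
        nlinarith [sq_nonneg ((b + a * x) - (a * u - a * x)), h3.1, h3.2]
      rw [mul_comm (Real.exp 2) a, mul_assoc, ← Real.exp_add]
      gcongr
      linarith
    calc ENNReal.ofReal (Real.exp (-(b + a * x) ^ 2 / 2))
        ≤ ENNReal.ofReal (a * Real.exp (-(b + a * x) ^ 2 / 2))
            * volume (quantCell n ⌊(n : ℝ) * x⌋) := by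
          rw [volume_quantCell hn, ← ENNReal.ofReal_mul (by positivity)]
          refine ENNReal.ofReal_le_ofReal ?_
          have : 1 ≤ a * (1 / n) := by
            rw [mul_one_div, le_div_iff₀ hn']
            linarith
          have h3 := Real.exp_pos (-(b + a * x) ^ 2 / 2)
          nlinarith
      _ = ∫⁻ _ in quantCell n ⌊(n : ℝ) * x⌋,
            ENNReal.ofReal (a * Real.exp (-(b + a * x) ^ 2 / 2)) := by
          rw [setLIntegral_const]
      _ ≤ _ := setLIntegral_mono hρm hc
  calc _ ≤ ∫⁻ x, (fun k => Φ k / p (quantCell n k)) ⌊(n : ℝ) * x⌋ ∂p :=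
        lintegral_mono fun x => ENNReal.div_le_div_right (hpt x) _
    _ = ∑' k, Φ k / p (quantCell n k) * p (quantCell n k) := by
        rw [← lintegral_map (f := fun k => Φ k / p (quantCell n k)) (measurable_of_countable _)
          (measurable_quantLabel n),
          lintegral_countable']
        refine tsum_congr fun k => ?_
        rw [Measure.map_apply (measurable_quantLabel n) (measurableSet_singleton k)]
        rfl
    _ ≤ ∑' k, Φ k := by
        -- An inequality rather than an equality, so that cells of probability zero are covered.
        refine ENNReal.tsum_le_tsum fun k => ?_
        rw [div_eq_mul_inv, mul_assoc]
        exact mul_le_of_le_one_right' (ENNReal.inv_mul_le_one _)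
    _ = ∫⁻ u in ⋃ k, quantCell n k, ρ u := by
        rw [lintegral_iUnion (measurableSet_quantCell n)]
        intro i j hij
        exact disjoint_left.2 fun x hx hx' => hij (hx.symm.trans hx')
    _ = ENNReal.ofReal cellConst := by
        have : ⋃ k, quantCell n k = univ :=
          eq_univ_of_forall fun x => mem_iUnion.2 ⟨⌊(n : ℝ) * x⌋, rfl⟩
        rw [this, Measure.restrict_univ, lintegral_gauss_affine ha]

theorem integrable_neg_log_quantProb {p : Measure ℝ} [IsProbabilityMeasure p] {n : ℕ}
    (h : Summable fun k : ℤ => Real.negMulLog (quantProb p n k)) :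
    Integrable (fun x => -Real.log (quantProb p n ⌊(n : ℝ) * x⌋)) p ∧
      ∫ x, -Real.log (quantProb p n ⌊(n : ℝ) * x⌋) ∂p = quantEntropy p n := by
  set μ : Measure ℤ := p.map (fun x => ⌊(n : ℝ) * x⌋) with hμ
  have hμk : ∀ k, μ.real {k} = quantProb p n k := by
    intro k
    rw [measureReal_def, hμ, Measure.map_apply (measurable_quantLabel n) (measurableSet_singleton k)]
    rfl
  have hfin : IsFiniteMeasure μ := by rw [hμ]; infer_instance
  have hi : Integrable (fun k => -Real.log (quantProb p n k)) μ := by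
    rw [← Measure.sum_smul_dirac μ, integrable_sum_dirac_iff (fun k => measure_ne_top _ _)]
    refine h.congr fun k => ?_
    rw [← measureReal_def, hμk, Real.negMulLog, Real.norm_eq_abs, abs_of_nonneg]
    · ring
    · refine neg_nonneg.2 (Real.log_nonpos measureReal_nonneg ?_)
      exact measureReal_le_one
  constructor
  · exact (integrable_map_measure (measurable_of_countable _).aestronglyMeasurable
      (measurable_quantLabel n).aemeasurable).1 hi
  · have h1 : ∫ k, -Real.log (quantProb p n k) ∂μ
        = ∫ x, -Real.log (quantProb p n ⌊(n : ℝ) * x⌋) ∂p :=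
      integral_map (measurable_quantLabel n).aemeasurable
        (measurable_of_countable _).aestronglyMeasurable
    rw [← h1, integral_countable hi, quantEntropy]
    refine tsum_congr fun k => ?_
    rw [hμk, Real.negMulLog, smul_eq_mul]
    ring

theorem ae_quantProb_pos (p : Measure ℝ) [IsProbabilityMeasure p] (n : ℕ) :
    ∀ᵐ x ∂p, 0 < quantProb p n ⌊(n : ℝ) * x⌋ := by
  have h : ∀ k : ℤ, ∀ᵐ x ∂p, x ∈ quantCell n k → 0 < quantProb p n k := by
    intro k
    rcases eq_or_ne (p (quantCell n k)) 0 with hk | hk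
    · filter_upwards [measure_eq_zero_iff_ae_notMem.1 hk] with x hx hx'
      exact absurd hx' hx
    · exact .of_forall fun x _ => ENNReal.toReal_pos hk (measure_ne_top _ _)
  filter_upwards [ae_all_iff.2 h] with x hx
  exact hx _ rfl

/-- The likelihood of the observation `y`, up to a factor that depends on neither the signal nor
`y`. -/
noncomputable def outputLik (p : Measure ℝ) (t y : ℝ) : ℝ :=
  ∫ x, Real.exp (-(y - √t * x) ^ 2 / 2) ∂p

theorem integrable_lik (p : Measure ℝ) [IsProbabilityMeasure p] (t y : ℝ) :
    Integrable (fun x => Real.exp (-(y - √t * x) ^ 2 / 2)) p := by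
  refine Integrable.of_bound (C := 1) (by fun_prop) (.of_forall fun x => ?_)
  rw [Real.norm_eq_abs, abs_of_pos (Real.exp_pos _), Real.exp_le_one_iff]
  have := sq_nonneg (y - √t * x)
  linarith

theorem chanMoment_zero_eq_outputLik (p : Measure ℝ) {t : ℝ} (ht : 0 ≤ t) (y : ℝ) :
    chanMoment p 0 t y = Real.exp (y ^ 2 / 2) * outputLik p t y := by
  rw [chanMoment_zero, outputLik, ← integral_const_mul]
  simp only [chanKernel_eq ht]

theorem outputLik_pos (p : Measure ℝ) [IsProbabilityMeasure p] {t : ℝ} (ht : 0 ≤ t) (y : ℝ) :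
    0 < outputLik p t y := by
  have h := chanMoment_zero_pos p ht y
  rw [chanMoment_zero_eq_outputLik p ht] at h
  exact pos_of_mul_pos_right h (Real.exp_pos _).le

theorem measurable_outputLik (p : Measure ℝ) [IsProbabilityMeasure p] (t : ℝ) :
    Measurable (outputLik p t) := by
  unfold outputLik
  refine (StronglyMeasurable.integral_prod_right'
    (f := fun r : ℝ × ℝ => Real.exp (-(r.1 - √t * r.2) ^ 2 / 2))
    (Measurable.stronglyMeasurable ?_)).measurable
  fun_prop

theorem mutualInfo_eq_outputLik {p : Measure ℝ} [IsProbabilityMeasure p]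
    (hp : Integrable (fun x : ℝ => x ^ 2) p) {t : ℝ} (ht : 0 ≤ t) :
    Integrable (fun r : ℝ × ℝ => -r.2 ^ 2 / 2 - Real.log (outputLik p t (observation t r)))
      (p.prod stdGaussian) ∧
    mutualInfo p t = ∫ r : ℝ × ℝ, (-r.2 ^ 2 / 2 - Real.log (outputLik p t (observation t r)))
      ∂(p.prod stdGaussian) := by
  have hm : Measurable (fun r : ℝ × ℝ => √t * (r.1 * r.2) - t / 2 * r.1 ^ 2
      - Real.log (chanMoment p 0 t r.2)) :=
    (by fun_prop : Measurable (fun r : ℝ × ℝ => √t * (r.1 * r.2) - t / 2 * r.1 ^ 2)).sub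
      ((measurable_chanMoment p 0 t).comp measurable_snd).log
  have hi : Integrable (fun r : ℝ × ℝ => √t * (r.1 * r.2) - t / 2 * r.1 ^ 2
      - Real.log (chanMoment p 0 t r.2)) (chanLaw p t) :=
    (((integrable_mul_chanLaw hp t).const_mul (√t)).sub
      ((integrable_fst_chanLaw t (by fun_prop) hp).const_mul (t / 2))).sub
        (integrable_log_chanMoment_zero hp ht)
  have e : ∀ r : ℝ × ℝ, √t * (r.1 * observation t r) - t / 2 * r.1 ^ 2
      - Real.log (chanMoment p 0 t (observation t r))
      = -r.2 ^ 2 / 2 - Real.log (outputLik p t (observation t r)) := by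
    intro r
    rw [chanMoment_zero_eq_outputLik p ht, Real.log_mul (Real.exp_pos _).ne'
      (outputLik_pos p ht _).ne', Real.log_exp, observation]
    nlinarith [Real.sq_sqrt ht]
  constructor
  · simpa only [e] using (integrable_chanLaw_iff_comp p t hm).1 hi
  · rw [mutualInfo_eq_integral_chanLaw ht, integral_chanLaw_comp p t hm]
    simp only [e]

/-- Points `x` in the cell of the true signal satisfy `|y - √t x| ≤ |z| + 2`, so the likelihood of
`y` is at least the cell probability times `exp(-(|z| + 2)² / 2)`. Taking `-log` turns the cell
probability into entropy, and the `z²` terms cancel. -/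
theorem mutualInfo_le_quantEntropy {p : Measure ℝ} [IsProbabilityMeasure p]
    (hp : Integrable (fun x : ℝ => x ^ 2) p) {n : ℕ} {t : ℝ} (ht : 0 ≤ t)
    (h2 : √t ≤ 2 * n) (hs : Summable fun k : ℤ => Real.negMulLog (quantProb p n k)) :
    mutualInfo p t ≤ quantEntropy p n + (∫ z, (2 * |z| + 2) ∂stdGaussian) := by
  obtain ⟨hi, he⟩ := mutualInfo_eq_outputLik hp ht
  obtain ⟨hiL, heL⟩ := integrable_neg_log_quantProb hs
  have hz : Integrable (fun z : ℝ => 2 * |z| + 2) stdGaussian :=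
    ((by simpa using (integrable_pow_stdGaussian 1).abs : Integrable (fun z : ℝ => |z|)
      stdGaussian).const_mul 2).add (integrable_const 2)
  have e1 : ∫ r : ℝ × ℝ, (-Real.log (quantProb p n ⌊(n : ℝ) * r.1⌋) + (2 * |r.2| + 2))
      ∂(p.prod stdGaussian) = quantEntropy p n + ∫ z, (2 * |z| + 2) ∂stdGaussian := by
    rw [integral_add (hiL.comp_fst stdGaussian) (hz.comp_snd p),
      integral_fun_fst (fun x => -Real.log (quantProb p n ⌊(n : ℝ) * x⌋)),
      integral_fun_snd (fun z : ℝ => 2 * |z| + 2), heL]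
    simp
  rw [he, ← e1]
  refine integral_mono_ae hi ((hiL.comp_fst stdGaussian).add (hz.comp_snd p)) ?_
  have hae : ∀ᵐ r ∂(p.prod stdGaussian), 0 < quantProb p n ⌊(n : ℝ) * (r : ℝ × ℝ).1⌋ :=
    Measure.quasiMeasurePreserving_fst.ae (ae_quantProb_pos p n)
  filter_upwards [hae] with r hr
  have hlik : quantProb p n ⌊(n : ℝ) * r.1⌋ * Real.exp (-(|r.2| + 2) ^ 2 / 2)
      ≤ outputLik p t (observation t r) := by
    have hint := integrable_lik p t (observation t r)
    have h3 : ∫ x in quantCell n ⌊(n : ℝ) * r.1⌋, Real.exp (-(|r.2| + 2) ^ 2 / 2) ∂p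
        ≤ ∫ x in quantCell n ⌊(n : ℝ) * r.1⌋, Real.exp (-(observation t r - √t * x) ^ 2 / 2) ∂p := by
      refine setIntegral_mono_on (integrable_const _) hint.integrableOn
        (measurableSet_quantCell n _) fun x hx => ?_
      have h4 := abs_sub_le_of_quantLabel_eq (Real.sqrt_nonneg t) h2 hx
      refine Real.exp_le_exp.2 ?_
      have h5 : |observation t r - √t * x| ≤ |r.2| + 2 := by
        have : observation t r - √t * x = r.2 - (√t * x - √t * r.1) := by
          rw [observation]; ring
        rw [this]
        exact (abs_sub _ _).trans (by linarith)
      have := pow_le_pow_left₀ (abs_nonneg _) h5 2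
      rw [sq_abs] at this
      linarith
    rw [setIntegral_const, smul_eq_mul] at h3
    exact h3.trans (setIntegral_le_integral hint (.of_forall fun x => (Real.exp_pos _).le))
  have h6 := Real.log_le_log (by positivity) hlik
  rw [Real.log_mul hr.ne' (Real.exp_pos _).ne', Real.log_exp] at h6
  have h7 := sq_abs r.2
  nlinarith

/-- Let `ψ` be the likelihood divided by the cell probability. By `log ψ ≤ ψ - 1` it suffices to
bound the mean of `ψ`. The likelihood averages over an independent copy `x'` of the signal; for
fixed `x'` and `z` the average over `x` is bounded by `lintegral_div_cell_le` with `b = z - √t x'`.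
-/
theorem quantEntropy_le_mutualInfo {p : Measure ℝ} [IsProbabilityMeasure p]
    (hp : Integrable (fun x : ℝ => x ^ 2) p) {n : ℕ} (hn : 1 ≤ n) {t : ℝ} (ht : 0 ≤ t)
    (h1 : (n : ℝ) ≤ √t) (h2 : √t ≤ 2 * n)
    (hs : Summable fun k : ℤ => Real.negMulLog (quantProb p n k)) :
    quantEntropy p n - (∫ z, z ^ 2 ∂stdGaussian) / 2 + 1 - cellConst ≤ mutualInfo p t := by
  obtain ⟨hi, he⟩ := mutualInfo_eq_outputLik hp ht
  obtain ⟨hiL, heL⟩ := integrable_neg_log_quantProb hs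
  have hprm : Measurable (fun x : ℝ => quantProb p n ⌊(n : ℝ) * x⌋) :=
    (measurable_of_countable (quantProb p n)).comp (measurable_quantLabel n)
  have hpm : Measurable (fun x : ℝ => p (quantCell n ⌊(n : ℝ) * x⌋)) :=
    (measurable_of_countable (fun k => p (quantCell n k))).comp (measurable_quantLabel n)
  have hom : Measurable (fun r : ℝ × ℝ => outputLik p t (observation t r)) :=
    (measurable_outputLik p t).comp (measurable_observation t)
  set ψ : ℝ × ℝ → ℝ :=
    fun r => outputLik p t (observation t r) / quantProb p n ⌊(n : ℝ) * r.1⌋ with hψ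
  have hψm : Measurable ψ := hom.div (hprm.comp measurable_fst)
  have hψ0 : ∀ r, 0 ≤ ψ r := fun r =>
    div_nonneg (outputLik_pos p ht _).le measureReal_nonneg
  have hae : ∀ᵐ r ∂(p.prod stdGaussian), 0 < quantProb p n ⌊(n : ℝ) * (r : ℝ × ℝ).1⌋ :=
    Measure.quasiMeasurePreserving_fst.ae (ae_quantProb_pos p n)
  have hle : ∫⁻ r, ENNReal.ofReal (ψ r) ∂(p.prod stdGaussian) ≤ ENNReal.ofReal cellConst := by
    have hlm : Measurable (fun r : ℝ × ℝ => ENNReal.ofReal (outputLik p t (observation t r))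
        / p (quantCell n ⌊(n : ℝ) * r.1⌋)) :=
      hom.ennreal_ofReal.div (hpm.comp measurable_fst)
    calc ∫⁻ r, ENNReal.ofReal (ψ r) ∂(p.prod stdGaussian)
        = ∫⁻ r, ENNReal.ofReal (outputLik p t (observation t r))
            / p (quantCell n ⌊(n : ℝ) * r.1⌋) ∂(p.prod stdGaussian) := by
          refine lintegral_congr_ae ?_
          filter_upwards [hae] with r hr
          rw [hψ]
          simp only
          rw [ENNReal.ofReal_div_of_pos hr, quantProb, measureReal_def,
            ENNReal.ofReal_toReal (measure_ne_top _ _)]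
          rfl
      _ = ∫⁻ z, ∫⁻ x, ENNReal.ofReal (outputLik p t (observation t (x, z)))
            / p (quantCell n ⌊(n : ℝ) * x⌋) ∂p ∂stdGaussian :=
          lintegral_prod_symm _ hlm.aemeasurable
      _ ≤ ∫⁻ _, ENNReal.ofReal cellConst ∂stdGaussian := by
          refine lintegral_mono fun z => ?_
          calc _ = ∫⁻ x, ∫⁻ x', ENNReal.ofReal (Real.exp (-(observation t (x, z) - √t * x') ^ 2 / 2))
                  / p (quantCell n ⌊(n : ℝ) * x⌋) ∂p ∂p := by
                refine lintegral_congr fun x => ?_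
                rw [outputLik, ofReal_integral_eq_lintegral_ofReal (integrable_lik p t _)
                  (.of_forall fun x => (Real.exp_pos _).le)]
                simp only [div_eq_mul_inv]
                rw [lintegral_mul_const _ (by fun_prop)]
            _ = ∫⁻ x', ∫⁻ x, ENNReal.ofReal (Real.exp (-(observation t (x, z) - √t * x') ^ 2 / 2))
                  / p (quantCell n ⌊(n : ℝ) * x⌋) ∂p ∂p := by
                refine lintegral_lintegral_swap ?_
                refine Measurable.aemeasurable (Measurable.div ?_ (hpm.comp measurable_fst))
                simp only [observation]
                fun_prop
            _ ≤ ∫⁻ x', ENNReal.ofReal cellConst ∂p := by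
                refine lintegral_mono fun x' => ?_
                refine le_trans (le_of_eq (lintegral_congr fun x => ?_))
                  (lintegral_div_cell_le p hn h1 h2 (z - √t * x'))
                simp only [observation]
                congr 4
                ring
            _ = _ := by simp
      _ = _ := by simp
  have hc0 : 0 ≤ cellConst := by unfold cellConst; positivity
  have hψi : Integrable ψ (p.prod stdGaussian) := by
    refine ⟨hψm.aestronglyMeasurable, ?_⟩
    rw [hasFiniteIntegral_iff_ofReal (.of_forall hψ0)]
    exact hle.trans_lt ENNReal.ofReal_lt_top
  have hψle : ∫ r, ψ r ∂(p.prod stdGaussian) ≤ cellConst := by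
    rw [integral_eq_lintegral_of_nonneg_ae (.of_forall hψ0) hψm.aestronglyMeasurable]
    exact ENNReal.toReal_le_of_le_ofReal hc0 hle
  have hi2 : Integrable (fun r : ℝ × ℝ => -r.2 ^ 2 / 2) (p.prod stdGaussian) :=
    (((integrable_pow_stdGaussian 2).neg).div_const 2).comp_snd p
  have hi3 : Integrable (fun r : ℝ × ℝ => -Real.log (quantProb p n ⌊(n : ℝ) * r.1⌋))
      (p.prod stdGaussian) := hiL.comp_fst stdGaussian
  have hi23 : Integrable (fun r : ℝ × ℝ => -r.2 ^ 2 / 2 + -Real.log (quantProb p n ⌊(n : ℝ) * r.1⌋))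
      (p.prod stdGaussian) := hi2.add hi3
  have hi4 : Integrable (fun r : ℝ × ℝ => ψ r - 1) (p.prod stdGaussian) :=
    hψi.sub (integrable_const 1)
  have e1 : ∫ r : ℝ × ℝ, (-r.2 ^ 2 / 2 + -Real.log (quantProb p n ⌊(n : ℝ) * r.1⌋) - (ψ r - 1))
      ∂(p.prod stdGaussian) = -(∫ z, z ^ 2 ∂stdGaussian) / 2 + quantEntropy p n
        - (∫ r, ψ r ∂(p.prod stdGaussian) - 1) := by
    rw [integral_sub hi23 hi4, integral_add hi2 hi3, integral_sub hψi (integrable_const 1),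
      integral_fun_fst (fun x => -Real.log (quantProb p n ⌊(n : ℝ) * x⌋)),
      integral_fun_snd (fun z : ℝ => -z ^ 2 / 2), heL, integral_div, integral_neg]
    simp
  have e2 : ∫ r : ℝ × ℝ, (-r.2 ^ 2 / 2 + -Real.log (quantProb p n ⌊(n : ℝ) * r.1⌋) - (ψ r - 1))
      ∂(p.prod stdGaussian) ≤ mutualInfo p t := by
    rw [he]
    refine integral_mono_ae (hi23.sub hi4) hi ?_
    filter_upwards [hae] with r hr
    have h3 := outputLik_pos p ht (observation t r)
    have h4 := Real.log_le_sub_one_of_pos (div_pos h3 hr)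
    rw [Real.log_div h3.ne' hr.ne'] at h4
    simp only [hψ]
    linarith
  rw [e1] at e2
  linarith

theorem tendsto_log_floor_sqrt_div_log :
    Tendsto (fun t : ℝ => Real.log ⌊√t⌋₊ / Real.log t) atTop (𝓝 (1 / 2)) := by
  have hlog : Tendsto Real.log atTop atTop := Real.tendsto_log_atTop
  have h1 : Tendsto (fun t : ℝ => 1 / 2 - Real.log 2 / Real.log t) atTop (𝓝 (1 / 2)) := by
    simpa using (tendsto_const_nhds (x := (1 / 2 : ℝ))).sub
      (hlog.const_div_atTop (Real.log 2))
  refine tendsto_of_tendsto_of_tendsto_of_le_of_le' h1 tendsto_const_nhds ?_ ?_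
  all_goals
    filter_upwards [eventually_gt_atTop 1] with t ht
    have hl : 0 < Real.log t := Real.log_pos ht
    have ht0 : 0 < t := by linarith
    have hs1 : 1 ≤ √t := Real.one_le_sqrt.2 ht.le
    have hs0 : 0 < √t := by linarith
    have hn1 : 1 ≤ ⌊√t⌋₊ := Nat.one_le_floor_iff _ |>.2 hs1
    have hn1' : (1 : ℝ) ≤ ⌊√t⌋₊ := by exact_mod_cast hn1
    have hsl : Real.log (√t) = Real.log t / 2 := Real.log_sqrt ht0.le
  · rw [le_div_iff₀ hl, sub_mul, div_mul_cancel₀ _ hl.ne']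
    have h2 : √t / 2 ≤ ⌊√t⌋₊ := by
      have := Nat.lt_floor_add_one (√t)
      linarith
    have h3 := Real.log_le_log (by positivity) h2
    rw [Real.log_div hs0.ne' two_ne_zero, hsl] at h3
    linarith
  · rw [div_le_iff₀ hl]
    have h3 := Real.log_le_log (by linarith) (Nat.floor_le hs0.le)
    rw [hsl] at h3
    linarith

/-- High-SNR scaling of mutual information. -/
theorem tendsto_mutualInfo_div_log {p : Measure ℝ} [IsProbabilityMeasure p]
    (hp : Integrable (fun x : ℝ => x ^ 2) p) {d : ℝ} (hd : HasRenyiInfoDim p d) :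
    Tendsto (fun t => mutualInfo p t / Real.log t) atTop (𝓝 (d / 2)) := by
  obtain ⟨hs, hlim⟩ := hd
  have hlog : Tendsto Real.log atTop atTop := Real.tendsto_log_atTop
  -- For `n = ⌊√t⌋` and `t > 1` one has `n ≤ √t ≤ n + 1 ≤ 2n`, the range of both entropy bounds. The
  -- halved limit reflects `log n ∼ (log t) / 2`.
  have hfl : Tendsto (fun t : ℝ => ⌊√t⌋₊) atTop atTop :=
    tendsto_nat_floor_atTop.comp Real.tendsto_sqrt_atTop
  have h1 : Tendsto (fun t : ℝ => quantEntropy p ⌊√t⌋₊ / Real.log t) atTop (𝓝 (d / 2)) := by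
    have h2 := (hlim.comp hfl).mul tendsto_log_floor_sqrt_div_log
    rw [mul_one_div] at h2
    refine h2.congr' ?_
    filter_upwards [eventually_ge_atTop 4] with t ht
    have h3 : 2 ≤ √t := Real.le_sqrt_of_sq_le (by linarith)
    have h4 : 2 ≤ ⌊√t⌋₊ := Nat.le_floor (by exact_mod_cast h3)
    have h5 : 0 < Real.log ⌊√t⌋₊ := Real.log_pos (by exact_mod_cast h4)
    simp only [Function.comp, quantEntropy]
    field_simp
  have h2 : ∀ C : ℝ, Tendsto (fun t : ℝ => quantEntropy p ⌊√t⌋₊ / Real.log t + C / Real.log t)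
      atTop (𝓝 (d / 2)) := fun C => by simpa using h1.add (hlog.const_div_atTop C)
  refine tendsto_of_tendsto_of_tendsto_of_le_of_le'
    (h2 (-(∫ z, z ^ 2 ∂stdGaussian) / 2 + 1 - cellConst))
    (h2 (∫ z, (2 * |z| + 2) ∂stdGaussian)) ?_ ?_
  all_goals
    filter_upwards [eventually_gt_atTop 1] with t ht
    have hl : 0 < Real.log t := Real.log_pos ht
    have hs1 : 1 ≤ √t := Real.one_le_sqrt.2 ht.le
    have hn1 : 1 ≤ ⌊√t⌋₊ := Nat.one_le_floor_iff _ |>.2 hs1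
    have hn1' : (1 : ℝ) ≤ ⌊√t⌋₊ := by exact_mod_cast hn1
    have hlt := Nat.lt_floor_add_one (√t)
    rw [← add_div, div_le_div_iff_of_pos_right hl]
  · have := quantEntropy_le_mutualInfo hp hn1 (by linarith) (Nat.floor_le (by linarith))
      (by linarith) (hs _)
    linarith
  · exact mutualInfo_le_quantEntropy hp (by linarith) (by linarith) (hs _)

/-! ### The R-transform -/

section Spectrum

variable {ν : Measure ℝ} [IsProbabilityMeasure ν]

/-- `∫ x / (1 + w x) dν`, the companion of the `η`-transform. -/
noncomputable def etaMean (ν : Measure ℝ) (w : ℝ) : ℝ := ∫ x, x * (1 + w * x)⁻¹ ∂ν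

theorem one_le_one_add_mul {w x : ℝ} (hw : 0 ≤ w) (hx : 0 ≤ x) : 1 ≤ 1 + w * x := by
  have := mul_nonneg hw hx
  linarith

theorem integrable_mul_inv_of_nonneg {ν : Measure ℝ} (hν : ∀ᵐ x ∂ν, 0 ≤ x) {f g : ℝ → ℝ} (hf : Integrable f ν)
    (hg : Measurable g) (h : ∀ x, 0 ≤ x → 1 ≤ g x) : Integrable (fun x => f x * (g x)⁻¹) ν := by
  refine hf.mul_bdd (c := 1) hg.inv.aestronglyMeasurable ?_
  filter_upwards [hν] with x hx
  have := h x hx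
  rw [Real.norm_eq_abs, abs_of_nonneg (by positivity)]
  exact inv_le_one_of_one_le₀ this

theorem one_sub_etaTransform (hν : ∀ᵐ x ∂ν, 0 ≤ x) {w : ℝ} (hw : 0 ≤ w) :
    1 - etaTransform ν w = w * etaMean ν w := by
  have h1 : 1 - ∫ x, (1 + w * x)⁻¹ ∂ν = ∫ x, (1 - (1 + w * x)⁻¹) ∂ν := by
    rw [integral_sub (integrable_const 1) (integrable_eta hν hw)]
    simp
  rw [etaTransform, etaMean, ← integral_const_mul, h1]
  refine integral_congr_ae ?_
  filter_upwards [hν] with x hx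
  have := one_le_one_add_mul hw hx
  field_simp
  ring

/-- Parametrizing the negative axis by `-(w η(w))` makes `R` an explicit quotient of integrals; the
strict monotonicity and increment estimates for `R` are read off in the variable `w`. -/
theorem rTransform_eq_div (hν : ∀ᵐ x ∂ν, 0 ≤ x) {w : ℝ} (hw : 0 < w) :
    rTransform ν (-(w * etaTransform ν w)) = etaMean ν w / etaTransform ν w := by
  have h := etaTransform_eq_rTransform hν hw
  have hη := etaTransform_pos hν hw.le
  have h1 := one_sub_etaTransform hν hw.le
  set R := rTransform ν (-(w * etaTransform ν w))
  have h2 : 1 + w * R ≠ 0 := by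
    intro h0
    rw [h0, div_zero] at h
    exact hη.ne' h
  rw [eq_div_iff h2] at h
  rw [eq_div_iff hη.ne']
  have : w * (R * etaTransform ν w) = w * etaMean ν w := by linarith
  exact mul_left_cancel₀ hw.ne' this

/-- `z R(-z) = 1 - η(w)` for `z = w η(w)`. -/
theorem mul_rTransform_eq (hν : ∀ᵐ x ∂ν, 0 ≤ x) {w : ℝ} (hw : 0 < w) :
    w * etaTransform ν w * rTransform ν (-(w * etaTransform ν w)) = 1 - etaTransform ν w := by
  have hη := etaTransform_pos hν hw.le
  rw [rTransform_eq_div hν hw, one_sub_etaTransform hν hw.le]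
  field_simp

theorem etaTransform_sub (hν : ∀ᵐ x ∂ν, 0 ≤ x) {a b : ℝ} (ha : 0 ≤ a) (hb : 0 ≤ b) :
    etaTransform ν a - etaTransform ν b
      = (b - a) * ∫ x, x * ((1 + a * x) * (1 + b * x))⁻¹ ∂ν := by
  rw [etaTransform, etaTransform, ← integral_sub (integrable_eta hν ha) (integrable_eta hν hb),
    ← integral_const_mul]
  refine integral_congr_ae ?_
  filter_upwards [hν] with x hx
  have h1 := one_le_one_add_mul ha hx
  have h2 := one_le_one_add_mul hb hx
  field_simp
  ring

theorem etaMean_sub {ν : Measure ℝ} (hν : ∀ᵐ x ∂ν, 0 ≤ x) (h1 : Integrable (fun x : ℝ => x) ν) {a b : ℝ}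
    (ha : 0 ≤ a) (hb : 0 ≤ b) :
    etaMean ν a - etaMean ν b
      = (b - a) * ∫ x, x ^ 2 * ((1 + a * x) * (1 + b * x))⁻¹ ∂ν := by
  rw [etaMean, etaMean, ← integral_sub
    (integrable_mul_inv_of_nonneg hν h1 (by fun_prop) fun x hx => one_le_one_add_mul ha hx)
    (integrable_mul_inv_of_nonneg hν h1 (by fun_prop) fun x hx => one_le_one_add_mul hb hx),
    ← integral_const_mul]
  refine integral_congr_ae ?_
  filter_upwards [hν] with x hx
  have h1 := one_le_one_add_mul ha hx
  have h2 := one_le_one_add_mul hb hx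
  field_simp
  ring

theorem one_le_mul_one_add {a b x : ℝ} (ha : 0 ≤ a) (hb : 0 ≤ b) (hx : 0 ≤ x) :
    1 ≤ (1 + a * x) * (1 + b * x) :=
  one_le_mul_of_one_le_of_one_le (one_le_one_add_mul ha hx) (one_le_one_add_mul hb hx)

theorem antitoneOn_etaTransform (hν : ∀ᵐ x ∂ν, 0 ≤ x) : AntitoneOn (etaTransform ν) (Ici 0) := by
  intro a ha b hb hab
  rw [← sub_nonneg, etaTransform_sub hν ha hb]
  refine mul_nonneg (sub_nonneg.2 hab) (integral_nonneg_of_ae ?_)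
  filter_upwards [hν] with x hx
  have := one_le_mul_one_add ha hb hx
  simp only [Pi.zero_apply]
  positivity

theorem continuousOn_etaTransform (hν : ∀ᵐ x ∂ν, 0 ≤ x) (h1 : Integrable (fun x : ℝ => x) ν) :
    ContinuousOn (etaTransform ν) (Ici 0) := by
  have hK : 0 ≤ ∫ x, x ∂ν := integral_nonneg_of_ae hν
  have key : ∀ a ∈ Ici (0 : ℝ), ∀ b ∈ Ici (0 : ℝ), a ≤ b →
      |etaTransform ν a - etaTransform ν b| ≤ (∫ x, x ∂ν) * |a - b| := by
    intro a ha b hb hab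
    rw [abs_of_nonneg (sub_nonneg.2 (antitoneOn_etaTransform hν ha hb hab)), abs_sub_comm,
      abs_of_nonneg (sub_nonneg.2 hab), etaTransform_sub hν ha hb, mul_comm]
    refine mul_le_mul_of_nonneg_right ?_ (sub_nonneg.2 hab)
    refine integral_mono_ae (integrable_mul_inv_of_nonneg hν h1 (by fun_prop)
      fun x hx => one_le_mul_one_add ha hb hx) h1 ?_
    filter_upwards [hν] with x hx
    exact mul_le_of_le_one_right hx (inv_le_one_of_one_le₀ (one_le_mul_one_add ha hb hx))
  have hl : LipschitzOnWith (Real.toNNReal (∫ x, x ∂ν)) (etaTransform ν) (Ici 0) := by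
    refine LipschitzOnWith.of_dist_le_mul fun a ha b hb => ?_
    rw [Real.coe_toNNReal _ hK, Real.dist_eq, Real.dist_eq]
    rcases le_total a b with h | h
    · exact key a ha b hb h
    · rw [abs_sub_comm, abs_sub_comm a]
      exact key b hb a ha h
  exact hl.continuousOn

theorem strictMonoOn_mul_etaTransform (hν : ∀ᵐ x ∂ν, 0 ≤ x) :
    StrictMonoOn (fun w => w * etaTransform ν w) (Ioi 0) := by
  intro a ha b hb hab
  have ha' : (0 : ℝ) < a := ha
  refine lt_of_le_of_ne ?_ fun h => hab.ne (injOn_mul_etaTransform hν ha hb h)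
  have e : ∀ w ∈ Ioi (0 : ℝ), w * etaTransform ν w = ∫ x, w * (1 + w * x)⁻¹ ∂ν :=
    fun w _ => by rw [etaTransform, integral_const_mul]
  simp only
  rw [e a ha, e b hb]
  have hb' : (0 : ℝ) < b := hb
  refine integral_mono_ae ((integrable_eta hν ha'.le).const_mul a)
    ((integrable_eta hν hb'.le).const_mul b) ?_
  filter_upwards [hν] with x hx
  have h1 := one_le_one_add_mul ha'.le hx
  have h2 := one_le_one_add_mul hb'.le hx
  rw [← div_eq_mul_inv, ← div_eq_mul_inv, div_le_div_iff₀ (by linarith) (by linarith)]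
  nlinarith

theorem exists_mul_etaTransform_eq (hν : ∀ᵐ x ∂ν, 0 ≤ x) (h1 : Integrable (fun x : ℝ => x) ν)
    (htop : Tendsto (fun z => z * etaTransform ν z) atTop atTop) {z : ℝ} (hz : 0 < z) :
    ∃ w, 0 < w ∧ w * etaTransform ν w = z := by
  obtain ⟨b, hb, hbz⟩ := ((eventually_ge_atTop 0).and (htop.eventually_ge_atTop z)).exists
  have hc : ContinuousOn (fun w => w * etaTransform ν w) (Icc 0 b) :=
    continuousOn_id.mul ((continuousOn_etaTransform hν h1).mono Icc_subset_Ici_self)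
  obtain ⟨w, hw, hwz⟩ := intermediate_value_Icc hb hc
    (show z ∈ Icc _ _ from ⟨by simpa using hz.le, hbz⟩)
  refine ⟨w, lt_of_le_of_ne hw.1 fun h => ?_, hwz⟩
  rw [← h] at hwz
  simp at hwz
  exact hz.ne hwz

theorem not_ae_eq_const_of_moments (hμ : spectralMoment ν 1 ^ 2 < spectralMoment ν 2) (c : ℝ) :
    ¬ ∀ᵐ x ∂ν, x = c := by
  intro h
  have e : ∀ j, spectralMoment ν j = c ^ j := by
    intro j
    have : ∫ x, x ^ j ∂ν = ∫ _, c ^ j ∂ν :=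
      integral_congr_ae (h.mono fun x hx => by simp only [hx])
    rw [spectralMoment, this]
    simp
  rw [e, e] at hμ
  simp at hμ

theorem integral_pos_of_ae_nonneg {ν : Measure ℝ} {f : ℝ → ℝ} (hf : Integrable f ν) (h0 : ∀ᵐ x ∂ν, 0 ≤ f x)
    (hne : ¬ ∀ᵐ x ∂ν, f x = 0) : 0 < ∫ x, f x ∂ν :=
  lt_of_le_of_ne (integral_nonneg_of_ae h0) fun h =>
    hne ((integral_eq_zero_iff_of_nonneg_ae h0 hf).1 h.symm)

/-- The quotient is the mean of `x` under the weight `1/(1 + wx)`, and a larger `w` favours small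
`x`. Strictness holds because `μ₂ > μ₁²` excludes a point mass. -/
theorem etaMean_div_lt (hν : ∀ᵐ x ∂ν, 0 ≤ x) (h1 : Integrable (fun x : ℝ => x) ν)
    (hμ : spectralMoment ν 1 ^ 2 < spectralMoment ν 2) {a b : ℝ} (ha : 0 ≤ a) (hab : a < b) :
    etaMean ν b / etaTransform ν b < etaMean ν a / etaTransform ν a := by
  have hb : 0 ≤ b := ha.trans hab.le
  have hηa := etaTransform_pos hν ha
  have hηb := etaTransform_pos hν hb
  set c := etaMean ν a / etaTransform ν a with hc
  have hNa : etaMean ν a = c * etaTransform ν a := (div_mul_cancel₀ _ hηa.ne').symm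
  have hc0 : 0 ≤ c := by
    refine div_nonneg (integral_nonneg_of_ae ?_) hηa.le
    filter_upwards [hν] with x hx
    have := one_le_one_add_mul ha hx
    simp only [Pi.zero_apply]
    positivity
  have hin : ∀ w, 0 ≤ w → Integrable (fun x => x * (1 + w * x)⁻¹) ν := fun w hw =>
    integrable_mul_inv_of_nonneg hν h1 (by fun_prop) fun x hx => one_le_one_add_mul hw hx
  have hid : ∀ w, 0 ≤ w → ∫ x, (x * (1 + w * x)⁻¹ - c * (1 + w * x)⁻¹) ∂ν
      = etaMean ν w - c * etaTransform ν w := by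
    intro w hw
    rw [integral_sub (hin w hw) ((integrable_eta hν hw).const_mul c), integral_const_mul]
    rfl
  have hid' : ∀ w, 0 ≤ w → Integrable (fun x => x * (1 + w * x)⁻¹ - c * (1 + w * x)⁻¹) ν :=
    fun w hw => (hin w hw).sub ((integrable_eta hν hw).const_mul c)
  -- Chosen so that the two integrands, each proportional to `x - c`, differ by a non-negative
  -- multiple of `(x - c)²`; the one at `a` integrates to zero by the choice of `c`.
  set κ := (1 + a * c) / (1 + b * c) with hκ
  have hbc := one_le_one_add_mul hb hc0
  have hpos : 0 < ∫ x, (κ * (x * (1 + a * x)⁻¹ - c * (1 + a * x)⁻¹)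
      - (x * (1 + b * x)⁻¹ - c * (1 + b * x)⁻¹)) ∂ν := by
    have e : ∀ x, 0 ≤ x → κ * (x * (1 + a * x)⁻¹ - c * (1 + a * x)⁻¹)
        - (x * (1 + b * x)⁻¹ - c * (1 + b * x)⁻¹)
        = (b - a) * (x - c) ^ 2 / ((1 + b * c) * ((1 + a * x) * (1 + b * x))) := by
      intro x hx
      have h1 := one_le_one_add_mul ha hx
      have h2 := one_le_one_add_mul hb hx
      rw [hκ]
      field_simp
      ring
    refine integral_pos_of_ae_nonneg (((hid' a ha).const_mul κ).sub (hid' b hb)) ?_ ?_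
    · filter_upwards [hν] with x hx
      rw [e x hx]
      have h1 := one_le_one_add_mul ha hx
      have h2 := one_le_one_add_mul hb hx
      have : 0 ≤ b - a := by linarith
      positivity
    · intro h
      refine not_ae_eq_const_of_moments hμ c ?_
      filter_upwards [hν, h] with x hx h0
      rw [e x hx] at h0
      have h1 := one_le_one_add_mul ha hx
      have h2 := one_le_one_add_mul hb hx
      have h3 : b - a ≠ 0 := by linarith
      rcases div_eq_zero_iff.1 h0 with h0 | h0
      · rcases mul_eq_zero.1 h0 with h0 | h0
        · exact absurd h0 h3
        · exact sub_eq_zero.1 (pow_eq_zero_iff two_ne_zero |>.1 h0)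
      · exact absurd h0 (by positivity)
  rw [integral_sub ((hid' a ha).const_mul κ) (hid' b hb), integral_const_mul, hid a ha, hid b hb,
    hNa, sub_self, mul_zero] at hpos
  rw [div_lt_iff₀ hηb]
  linarith

theorem strictAntiOn_rTransform_neg (hν : ∀ᵐ x ∂ν, 0 ≤ x) (h1 : Integrable (fun x : ℝ => x) ν)
    (hR : RTransformProper ν)
    (hmono : MonotoneOn (rTransform ν) (Iic 0)) :
    StrictAntiOn (fun z => rTransform ν (-z)) (Ici 0) := by
  have hpos : StrictAntiOn (fun z => rTransform ν (-z)) (Ioi 0) := by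
    intro a ha b hb hab
    obtain ⟨u, hu, rfl⟩ := exists_mul_etaTransform_eq hν h1 hR.1 ha
    obtain ⟨w, hw, rfl⟩ := exists_mul_etaTransform_eq hν h1 hR.1 hb
    simp only
    rw [rTransform_eq_div hν hu, rTransform_eq_div hν hw]
    exact etaMean_div_lt hν h1 hR.2 hu.le
      ((strictMonoOn_mul_etaTransform hν).lt_iff_lt hu hw |>.1 hab)
  intro a ha b hb hab
  -- The parametrization misses `R(0)`. Monotonicity of `R` compares it with an intermediate point.
  rcases (show (0 : ℝ) ≤ a from ha).eq_or_lt with rfl | ha'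
  · have hb' : 0 < b := hab
    have h3 : rTransform ν (-b) < rTransform ν (-(b / 2)) :=
      hpos (mem_Ioi.2 (by linarith)) hb' (by linarith)
    have h4 : rTransform ν (-(b / 2)) ≤ rTransform ν (-0) :=
      hmono (by simp only [mem_Iic]; linarith) (by simp) (by simp; linarith)
    exact h3.trans_le h4
  · exact hpos ha' (ha'.trans hab) hab

/-- On bounded intervals, increments of `z R(-z)` dominate decrements of `R(-z)`. -/
theorem exists_mul_rTransform_increment (hν : ∀ᵐ x ∂ν, 0 ≤ x) (h1 : Integrable (fun x : ℝ => x) ν)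
    (h2 : Integrable (fun x : ℝ => x ^ 2) ν) (hR : RTransformProper ν) {Z : ℝ} (hZ : 0 < Z) :
    ∃ c > 0, ∀ z₁ z₂ : ℝ, 0 < z₂ → z₂ < z₁ → z₁ ≤ Z →
      c * (rTransform ν (-z₂) - rTransform ν (-z₁))
        ≤ z₁ * rTransform ν (-z₁) - z₂ * rTransform ν (-z₂) := by
  obtain ⟨W, hW, hWZ⟩ := exists_mul_etaTransform_eq hν h1 hR.1 hZ
  have hηW := etaTransform_pos hν hW.le
  have hμ2 : 0 < ∫ x, x ^ 2 ∂ν := by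
    have : 0 ≤ spectralMoment ν 1 ^ 2 := sq_nonneg _
    exact this.trans_lt hR.2
  have hi1 : Integrable (fun x => x * ((1 + W * x) * (1 + W * x))⁻¹) ν :=
    integrable_mul_inv_of_nonneg hν h1 (by fun_prop) fun x hx => one_le_mul_one_add hW.le hW.le hx
  have hc1 : 0 < ∫ x, x * ((1 + W * x) * (1 + W * x))⁻¹ ∂ν := by
    refine integral_pos_of_ae_nonneg hi1 ?_ fun h => not_ae_eq_const_of_moments hR.2 0 ?_
    · filter_upwards [hν] with x hx
      have := one_le_mul_one_add hW.le hW.le hx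
      positivity
    · filter_upwards [hν, h] with x hx h0
      have := one_le_mul_one_add hW.le hW.le hx
      rcases mul_eq_zero.1 h0 with h0 | h0
      · exact h0
      · exact absurd h0 (by positivity)
  set c₁ := ∫ x, x * ((1 + W * x) * (1 + W * x))⁻¹ ∂ν with hc₁
  set μ₂ := ∫ x, x ^ 2 ∂ν with hμ₂
  -- Per unit of the parameter `w ≤ W`, `z R(-z) = 1 - η(w)` gains at least `c₁`, while `R(-z)`
  -- loses at most `μ₂ / η(W)`.
  refine ⟨c₁ * etaTransform ν W / μ₂, by positivity, fun z₁ z₂ hz₂ hz₂₁ hz₁Z => ?_⟩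
  obtain ⟨a, ha, rfl⟩ := exists_mul_etaTransform_eq hν h1 hR.1 hz₂
  obtain ⟨b, hb, rfl⟩ := exists_mul_etaTransform_eq hν h1 hR.1 (hz₂.trans hz₂₁)
  have hsm := strictMonoOn_mul_etaTransform hν
  have hab : a < b := hsm.lt_iff_lt ha hb |>.1 hz₂₁
  have hbW : b ≤ W := hsm.le_iff_le hb hW |>.1 (by simpa only [hWZ] using hz₁Z)
  rw [mul_rTransform_eq hν ha, mul_rTransform_eq hν hb, rTransform_eq_div hν ha,
    rTransform_eq_div hν hb]
  have hηa := etaTransform_pos hν ha.le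
  have hηb := etaTransform_pos hν hb.le
  have hηab := antitoneOn_etaTransform hν (mem_Ici.2 ha.le) (mem_Ici.2 hb.le) hab.le
  have hηbW := antitoneOn_etaTransform hν (mem_Ici.2 hb.le) (mem_Ici.2 hW.le) hbW
  have hNa : 0 ≤ etaMean ν a := by
    refine integral_nonneg_of_ae ?_
    filter_upwards [hν] with x hx
    have := one_le_one_add_mul ha.le hx
    simp only [Pi.zero_apply]
    positivity
  have hlow : (b - a) * c₁ ≤ etaTransform ν a - etaTransform ν b := by
    rw [etaTransform_sub hν ha.le hb.le]
    refine mul_le_mul_of_nonneg_left (integral_mono_ae hi1 (integrable_mul_inv_of_nonneg hν h1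
      (by fun_prop) fun x hx => one_le_mul_one_add ha.le hb.le hx) ?_) (by linarith)
    filter_upwards [hν] with x hx
    have := one_le_mul_one_add ha.le hb.le hx
    have h3 := one_le_one_add_mul ha.le hx
    have h4 := one_le_one_add_mul hb.le hx
    have : a ≤ W := hab.le.trans hbW
    gcongr
  have hNup : etaMean ν a - etaMean ν b ≤ (b - a) * μ₂ := by
    rw [etaMean_sub hν h1 ha.le hb.le]
    refine mul_le_mul_of_nonneg_left (integral_mono_ae (integrable_mul_inv_of_nonneg hν h2
      (by fun_prop) fun x hx => one_le_mul_one_add ha.le hb.le hx) h2 ?_) (by linarith)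
    filter_upwards [hν] with x hx
    exact mul_le_of_le_one_right (sq_nonneg x)
      (inv_le_one_of_one_le₀ (one_le_mul_one_add ha.le hb.le hx))
  have hup : etaMean ν a / etaTransform ν a - etaMean ν b / etaTransform ν b
      ≤ (b - a) * μ₂ / etaTransform ν W := by
    have h3 : etaMean ν a / etaTransform ν a ≤ etaMean ν a / etaTransform ν b := by gcongr
    have h4 : (etaMean ν a - etaMean ν b) / etaTransform ν b ≤ (b - a) * μ₂ / etaTransform ν b := by
      gcongr
    have h5 : (b - a) * μ₂ / etaTransform ν b ≤ (b - a) * μ₂ / etaTransform ν W := by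
      have : 0 ≤ b - a := by linarith
      gcongr
    rw [sub_div] at h4
    linarith
  calc _ ≤ c₁ * etaTransform ν W / μ₂ * ((b - a) * μ₂ / etaTransform ν W) :=
        mul_le_mul_of_nonneg_left hup (by positivity)
    _ = (b - a) * c₁ := by field_simp
    _ ≤ _ := by linarith

end Spectrum

/-! ### The inf-sup problem for a general potential -/

/-- The potential with information function `I` and spectral function `r` at noise variance `v`. -/
noncomputable def potential (I r : ℝ → ℝ) (v E s : ℝ) : ℝ :=
  I s + (1 / 2) * (∫ z in (0 : ℝ)..(E / v), r z) - s * E / 2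

/-- The supremum over `E` of the potential. -/
noncomputable def supPotential (I r : ℝ → ℝ) (v s : ℝ) : ℝ :=
  ⨆ E : Icc (0 : ℝ) 1, potential I r v E s

/-- Optimizers of the inf-sup problem for `potential`. -/
def IsPotentialOptimizer (I r : ℝ → ℝ) (v : ℝ) (q : ℝ × ℝ) : Prop :=
  q.1 ∈ Icc (0 : ℝ) 1 ∧ q.2 ∈ Ici (0 : ℝ) ∧
    IsMinOn (supPotential I r v) (Ici 0) q.2 ∧
    IsMaxOn (fun E => potential I r v E q.2) (Icc 0 1) q.1

theorem intervalIntegrable_of_nonneg {r : ℝ → ℝ} (hrc : ContinuousOn r (Ici 0)) {a b : ℝ}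
    (ha : 0 ≤ a) (hb : 0 ≤ b) : IntervalIntegrable r volume a b :=
  (hrc.mono fun _ hx => (le_min ha hb).trans hx.1).intervalIntegrable

theorem integral_sub_integral_zero {r : ℝ → ℝ} (hrc : ContinuousOn r (Ici 0)) {a b : ℝ}
    (ha : 0 ≤ a) (hb : 0 ≤ b) :
    (∫ z in (0 : ℝ)..b, r z) - ∫ z in (0 : ℝ)..a, r z = ∫ z in a..b, r z :=
  intervalIntegral.integral_interval_sub_left (intervalIntegrable_of_nonneg hrc le_rfl hb)
    (intervalIntegrable_of_nonneg hrc le_rfl ha)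

theorem continuousOn_primitive {r : ℝ → ℝ} (hrc : ContinuousOn r (Ici 0)) :
    ContinuousOn (fun T => ∫ z in (0 : ℝ)..T, r z) (Ici 0) := by
  intro T hT
  have hT' : (0 : ℝ) ≤ T := hT
  have h := intervalIntegral.continuousOn_primitive_interval (μ := volume) (f := r) (a := 0)
    (b := T + 1) (by
      rw [uIcc_of_le (by linarith)]
      exact (hrc.mono Icc_subset_Ici_self).integrableOn_Icc)
  rw [uIcc_of_le (by linarith)] at h
  have hmem : Icc (0 : ℝ) (T + 1) ∈ 𝓝[Ici 0] T := by
    rw [← Ici_inter_Iic]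
    exact inter_mem self_mem_nhdsWithin (mem_nhdsWithin_of_mem_nhds (Iic_mem_nhds (by linarith)))
  exact (h T ⟨hT', by linarith⟩).mono_of_mem_nhdsWithin hmem

theorem integral_le_of_antitone {r : ℝ → ℝ} (hrc : ContinuousOn r (Ici 0))
    (hra : AntitoneOn r (Ici 0)) {a b : ℝ} (ha : 0 ≤ a) (hab : a ≤ b) :
    ∫ z in a..b, r z ≤ r a * (b - a) := by
  have := intervalIntegral.integral_mono_on hab (intervalIntegrable_of_nonneg hrc ha (ha.trans hab))
    (intervalIntegrable_const (c := r a)) fun z hz => hra ha (ha.trans hz.1) hz.1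
  rw [intervalIntegral.integral_const, smul_eq_mul] at this
  linarith

theorem le_integral_of_antitone {r : ℝ → ℝ} (hrc : ContinuousOn r (Ici 0))
    (hra : AntitoneOn r (Ici 0)) {a b : ℝ} (ha : 0 ≤ a) (hab : a ≤ b) :
    r b * (b - a) ≤ ∫ z in a..b, r z := by
  have := intervalIntegral.integral_mono_on hab (intervalIntegrable_const (c := r b))
    (intervalIntegrable_of_nonneg hrc ha (ha.trans hab))
    fun z hz => hra (ha.trans hz.1) (ha.trans hab) hz.2
  rw [intervalIntegral.integral_const, smul_eq_mul] at this
  linarith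

theorem integral_const_div {k a b : ℝ} (ha : 0 < a) (hab : a ≤ b) :
    ∫ z in a..b, k * z⁻¹ = k * Real.log (b / a) := by
  rw [intervalIntegral.integral_const_mul, integral_inv_of_pos ha (ha.trans_le hab)]

theorem intervalIntegrable_const_div {k a b : ℝ} (ha : 0 < a) (hab : a ≤ b) :
    IntervalIntegrable (fun z => k * z⁻¹) volume a b := by
  refine ContinuousOn.intervalIntegrable ?_
  rw [uIcc_of_le hab]
  exact continuousOn_const.mul (continuousOn_inv₀.mono fun z hz => (ha.trans_le hz.1).ne')

theorem integral_le_log {r : ℝ → ℝ} (hrc : ContinuousOn r (Ici 0)) {k Z : ℝ} (hZ : 0 < Z)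
    (hk : ∀ z, Z ≤ z → z * r z ≤ k) {a b : ℝ} (ha : Z ≤ a) (hab : a ≤ b) :
    ∫ z in a..b, r z ≤ k * Real.log (b / a) := by
  have ha0 := hZ.trans_le ha
  rw [← integral_const_div ha0 hab]
  refine intervalIntegral.integral_mono_on hab
    (intervalIntegrable_of_nonneg hrc ha0.le (ha0.le.trans hab))
    (intervalIntegrable_const_div ha0 hab) fun z hz => ?_
  have hz0 := ha0.trans_le hz.1
  rw [← div_eq_mul_inv, le_div_iff₀ hz0, mul_comm]
  exact hk z (ha.trans hz.1)

theorem log_le_integral {r : ℝ → ℝ} (hrc : ContinuousOn r (Ici 0)) {k Z : ℝ} (hZ : 0 < Z)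
    (hk : ∀ z, Z ≤ z → k ≤ z * r z) {a b : ℝ} (ha : Z ≤ a) (hab : a ≤ b) :
    k * Real.log (b / a) ≤ ∫ z in a..b, r z := by
  have ha0 := hZ.trans_le ha
  rw [← integral_const_div ha0 hab]
  refine intervalIntegral.integral_mono_on hab (intervalIntegrable_const_div ha0 hab)
    (intervalIntegrable_of_nonneg hrc ha0.le (ha0.le.trans hab)) fun z hz => ?_
  have hz0 := ha0.trans_le hz.1
  rw [← div_eq_mul_inv, div_le_iff₀ hz0, mul_comm]
  exact hk z (ha.trans hz.1)

/-! ### Existence of optimizers and their location at small noise -/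

theorem continuousOn_potential_left {I r : ℝ → ℝ} (hrc : ContinuousOn r (Ici 0)) {v : ℝ}
    (hv : 0 < v) (s : ℝ) : ContinuousOn (fun E => potential I r v E s) (Icc 0 1) := by
  have h : ContinuousOn (fun E => ∫ z in (0 : ℝ)..(E / v), r z) (Icc 0 1) :=
    (continuousOn_primitive hrc).comp (f := fun E => E / v) (by fun_prop)
      fun E hE => div_nonneg hE.1 hv.le
  unfold potential
  exact (continuousOn_const.add (continuousOn_const.mul h)).sub (by fun_prop)

theorem bddAbove_potential {I r : ℝ → ℝ} (hrc : ContinuousOn r (Ici 0)) {v : ℝ} (hv : 0 < v)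
    (s : ℝ) : BddAbove (range fun E : Icc (0 : ℝ) 1 => potential I r v E s) := by
  have := isCompact_Icc.bddAbove_image (continuousOn_potential_left (I := I) hrc hv s)
  rwa [image_eq_range] at this

theorem potential_le_sup {I r : ℝ → ℝ} (hrc : ContinuousOn r (Ici 0)) {v : ℝ} (hv : 0 < v) (s : ℝ)
    {E : ℝ} (hE : E ∈ Icc (0 : ℝ) 1) : potential I r v E s ≤ supPotential I r v s :=
  le_ciSup (bddAbove_potential hrc hv s) ⟨E, hE⟩

theorem supPotential_le {I r : ℝ → ℝ} {v s K : ℝ}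
    (h : ∀ E ∈ Icc (0 : ℝ) 1, potential I r v E s ≤ K) : supPotential I r v s ≤ K :=
  have : Nonempty (Icc (0 : ℝ) 1) := ⟨⟨0, by simp⟩⟩
  ciSup_le fun E => h E E.2

theorem supPotential_eq {I r : ℝ → ℝ} (hrc : ContinuousOn r (Ici 0)) {v : ℝ} (hv : 0 < v) {s E : ℝ}
    (hE : E ∈ Icc (0 : ℝ) 1) (hmax : IsMaxOn (fun E => potential I r v E s) (Icc 0 1) E) :
    supPotential I r v s = potential I r v E s :=
  le_antisymm (supPotential_le fun _ hF => hmax hF) (potential_le_sup hrc hv s hE)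

theorem potential_zero_left (I r : ℝ → ℝ) (v s : ℝ) : potential I r v 0 s = I s := by
  simp [potential]

/-- For such `s` the linear cost dominates `∫ r ≤ r(0) E / v`, so `E = 0` is best. -/
theorem supPotential_of_le {I r : ℝ → ℝ} (hrc : ContinuousOn r (Ici 0))
    (hra : AntitoneOn r (Ici 0)) {v : ℝ} (hv : 0 < v) {s : ℝ} (hs : r 0 / v ≤ s) :
    supPotential I r v s = I s := by
  refine le_antisymm (supPotential_le fun E hE => ?_) ?_
  · have h1 := integral_le_of_antitone hrc hra le_rfl (div_nonneg hE.1 hv.le)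
    have h2 : r 0 / v * E ≤ s * E := mul_le_mul_of_nonneg_right hs hE.1
    have h3 : r 0 * (E / v - 0) = r 0 / v * E := by ring
    rw [potential]
    linarith
  · rw [← potential_zero_left I r v s]
    exact potential_le_sup hrc hv s ⟨le_rfl, zero_le_one⟩

/-- A supremum of continuous functions is lower semicontinuous, so it attains its minimum on `[0,
r(0)/v]`. Beyond that interval it equals `I`, which is non-decreasing. -/
theorem exists_potentialOptimizer {I r : ℝ → ℝ} (hrc : ContinuousOn r (Ici 0))
    (hra : AntitoneOn r (Ici 0)) (hrpos : 0 < r 0) (hIc : ContinuousOn I (Ici 0))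
    (hIm : MonotoneOn I (Ici 0)) {v : ℝ} (hv : 0 < v) : ∃ q, IsPotentialOptimizer I r v q := by
  set s₀ := r 0 / v with hs₀
  have hs₀0 : 0 ≤ s₀ := by positivity
  have hlsc : LowerSemicontinuousOn (supPotential I r v) (Icc 0 s₀) := by
    refine lowerSemicontinuousOn_ciSup (fun s _ => bddAbove_potential hrc hv s) fun E => ?_
    refine ContinuousOn.lowerSemicontinuousOn ?_
    unfold potential
    exact ((hIc.mono Icc_subset_Ici_self).add continuousOn_const).sub (by fun_prop)
  obtain ⟨s, hs, hmin⟩ := LowerSemicontinuousOn.exists_isMinOn (nonempty_Icc.2 hs₀0)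
    isCompact_Icc hlsc
  obtain ⟨E, hE, hmax⟩ := isCompact_Icc.exists_isMaxOn (nonempty_Icc.2 zero_le_one)
    (continuousOn_potential_left (I := I) hrc hv s)
  refine ⟨(E, s), hE, hs.1, fun t ht => ?_, hmax⟩
  rcases le_total t s₀ with h | h
  · exact hmin ⟨ht, h⟩
  · have h1 : supPotential I r v s ≤ supPotential I r v s₀ := hmin ⟨hs₀0, le_rfl⟩
    rw [supPotential_of_le hrc hra hv le_rfl] at h1
    have h2 : supPotential I r v t = I t := supPotential_of_le hrc hra hv h
    change supPotential I r v s ≤ supPotential I r v t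
    rw [h2]
    exact h1.trans (hIm hs₀0 ht h)

/-- Any SNR beyond `S` is eventually exceeded by the optimizers if `d < δ`. -/
theorem eventually_lt_snd_optimizer {I r : ℝ → ℝ} (hrc : ContinuousOn r (Ici 0))
    (hra : AntitoneOn r (Ici 0)) (hrpos : ∀ z, 0 ≤ z → 0 < r z) {δ d : ℝ}
    (hrlim : Tendsto (fun z => z * r z) atTop (𝓝 δ))
    (hI0 : ∀ s, 0 ≤ I s) (hIlim : Tendsto (fun t => I t / Real.log t) atTop (𝓝 (d / 2)))
    (hdδ : d < δ) (S : ℝ) :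
    ∀ᶠ v in 𝓝[>] (0 : ℝ), ∀ q, IsPotentialOptimizer I r v q → S < q.2 := by
  obtain ⟨d', hd', hd'δ⟩ := exists_between hdδ
  obtain ⟨δ', hδ', hδ'δ⟩ := exists_between hd'δ
  obtain ⟨Z, hZ0, hZ⟩ : ∃ Z, 0 < Z ∧ ∀ z, Z ≤ z → δ' ≤ z * r z := by
    obtain ⟨Z, hZ⟩ := eventually_atTop.1 (hrlim.eventually (le_mem_nhds hδ'δ))
    exact ⟨max Z 1, by positivity, fun z hz => hZ z ((le_max_left _ _).trans hz)⟩
  have hinv : Tendsto (fun v : ℝ => v⁻¹) (𝓝[>] 0) atTop := tendsto_inv_nhdsGT_zero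
  have hlog : Tendsto (fun v : ℝ => Real.log v⁻¹) (𝓝[>] 0) atTop :=
    Real.tendsto_log_atTop.comp hinv
  have hr0 := hrpos 0 le_rfl
  have hIev : ∀ᶠ t in atTop, I t ≤ d' / 2 * Real.log t := by
    filter_upwards [hIlim.eventually (ge_mem_nhds (by linarith : d / 2 < d' / 2)),
      eventually_gt_atTop 1] with t ht ht1
    exact (div_le_iff₀ (Real.log_pos ht1)).1 ht
  have hIv : ∀ᶠ v in 𝓝[>] (0 : ℝ), I (r 0 * v⁻¹) ≤ d' / 2 * Real.log (r 0 * v⁻¹) :=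
    (hinv.const_mul_atTop hr0).eventually hIev
  have hbig : ∀ᶠ v in 𝓝[>] (0 : ℝ),
      (S + d' * Real.log (r 0) + δ' * Real.log Z) / (δ' - d') < Real.log v⁻¹ :=
    hlog.eventually_gt_atTop _
  filter_upwards [self_mem_nhdsWithin, hIv, hbig, hinv.eventually_ge_atTop Z] with v hv hIv hbig hvZ
  rintro q ⟨hE, hs, hmin, -⟩
  have hv0 : 0 < v := hv
  by_contra hle
  push Not at hle
  have h1 : supPotential I r v q.2 ≤ I (r 0 * v⁻¹) := by
    have h2 : supPotential I r v (r 0 / v) = I (r 0 / v) :=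
      supPotential_of_le hrc hra hv0 le_rfl
    rw [← div_eq_mul_inv, ← h2]
    exact hmin (div_nonneg hr0.le hv0.le)
  -- If `s ≤ S`, testing `E = 1` costs about `(δ'/2) log(1/v)`, more than the competitor `s =
  -- r(0)/v` with cost at most `(d'/2) log(r(0)/v)`.
  have h2 := potential_le_sup (I := I) hrc hv0 q.2 (E := 1) ⟨zero_le_one, le_rfl⟩
  rw [potential, one_div v, mul_one] at h2
  have h3 := log_le_integral hrc hZ0 hZ le_rfl hvZ
  have h4 : 0 ≤ ∫ z in (0 : ℝ)..Z, r z :=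
    intervalIntegral.integral_nonneg hZ0.le fun z hz => (hrpos z hz.1).le
  rw [← integral_sub_integral_zero hrc hZ0.le (hZ0.le.trans hvZ), Real.log_div (by positivity)
    hZ0.ne'] at h3
  rw [Real.log_mul hr0.ne' (by positivity)] at hIv
  rw [div_lt_iff₀ (by linarith)] at hbig
  have h5 := hI0 q.2
  nlinarith

/-- Moving from `E` up to the optimal value gains at most `r(E/v)/v` per unit, up to the factor
`1/2`, and this must pay for the linear cost. -/
theorem snd_optimizer_le_of_le_fst {I r : ℝ → ℝ} (hrc : ContinuousOn r (Ici 0))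
    (hra : AntitoneOn r (Ici 0)) {v : ℝ} (hv : 0 < v) {q : ℝ × ℝ}
    (hq : IsPotentialOptimizer I r v q) {E : ℝ} (hE : 0 ≤ E) (hEq : E < q.1) :
    q.2 ≤ r (E / v) / v := by
  obtain ⟨hq1, -, -, hmax⟩ := hq
  have h1 : potential I r v E q.2 ≤ potential I r v q.1 q.2 := hmax ⟨hE, hEq.le.trans hq1.2⟩
  have hEv : 0 ≤ E / v := div_nonneg hE hv.le
  have hle : E / v ≤ q.1 / v := by gcongr
  have h2 := integral_le_of_antitone hrc hra hEv hle
  rw [← integral_sub_integral_zero hrc hEv (hEv.trans hle)] at h2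
  rw [potential, potential] at h1
  have h3 : r (E / v) * (q.1 / v - E / v) = r (E / v) / v * (q.1 - E) := by ring
  rw [h3] at h2
  have h4 : q.2 * (q.1 - E) ≤ r (E / v) / v * (q.1 - E) := by linarith
  exact le_of_mul_le_mul_right h4 (by linarith)

/-- An optimal `E ≥ ε` forces `s ≤ r(ε/(2v))/v`, which is bounded because `z * r z` converges. -/
theorem eventually_fst_optimizer_lt {I r : ℝ → ℝ} (hrc : ContinuousOn r (Ici 0))
    (hra : AntitoneOn r (Ici 0)) {δ : ℝ} (hrlim : Tendsto (fun z => z * r z) atTop (𝓝 δ))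
    (hbig : ∀ S : ℝ, ∀ᶠ v in 𝓝[>] (0 : ℝ), ∀ q, IsPotentialOptimizer I r v q → S < q.2)
    {ε : ℝ} (hε : 0 < ε) :
    ∀ᶠ v in 𝓝[>] (0 : ℝ), ∀ q, IsPotentialOptimizer I r v q → q.1 < ε := by
  have hinv : Tendsto (fun v : ℝ => ε / 2 * v⁻¹) (𝓝[>] 0) atTop :=
    tendsto_inv_nhdsGT_zero.const_mul_atTop (by linarith)
  filter_upwards [self_mem_nhdsWithin, hbig ((δ + 1) / (ε / 2)),
    hinv.eventually (hrlim.eventually (ge_mem_nhds (lt_add_one δ)))] with v hv hS hr q hq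
  have hv0 : 0 < v := hv
  by_contra hle
  push Not at hle
  have h1 := snd_optimizer_le_of_le_fst hrc hra hv0 hq (E := ε / 2) (by linarith) (by linarith)
  have h2 := hS q hq
  rw [← div_eq_mul_inv] at hr
  have h3 : r (ε / 2 / v) / v ≤ (δ + 1) / (ε / 2) := by
    rw [le_div_iff₀ (by linarith)]
    refine le_trans (le_of_eq ?_) hr
    ring
  linarith

/-- At `s = 0` the supremum is at most `½ ∫₀^{1/v} r`; at `s` the test point `E = 1/s` loses only `∫
r` over `[1/(sv), 1/v]`, of size `δ' log s`, uniformly in `v`. If `I` grows faster than `(δ'/2) log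
s`, large `s` cannot be optimal. -/
theorem exists_snd_optimizer_le {I r : ℝ → ℝ} (hrc : ContinuousOn r (Ici 0))
    (hra : AntitoneOn r (Ici 0)) (hrpos : ∀ z, 0 ≤ z → 0 < r z) {δ d : ℝ}
    (hrlim : Tendsto (fun z => z * r z) atTop (𝓝 δ))
    (hI0 : I 0 = 0) (hIlim : Tendsto (fun t => I t / Real.log t) atTop (𝓝 (d / 2)))
    (hδd : δ < d) :
    ∃ S : ℝ, ∀ᶠ v in 𝓝[>] (0 : ℝ), ∀ q, IsPotentialOptimizer I r v q → q.2 ≤ S := by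
  have hδ0 : 0 ≤ δ := by
    refine ge_of_tendsto hrlim ?_
    filter_upwards [eventually_ge_atTop 0] with z hz
    exact mul_nonneg hz (hrpos z hz).le
  obtain ⟨δ', hδ', hδ'd⟩ := exists_between hδd
  obtain ⟨d', hd', hd'd⟩ := exists_between hδ'd
  obtain ⟨Z, hZ0, hZ⟩ : ∃ Z, 0 < Z ∧ ∀ z, Z ≤ z → z * r z ≤ δ' := by
    obtain ⟨Z, hZ⟩ := eventually_atTop.1 (hrlim.eventually (ge_mem_nhds hδ'))
    exact ⟨max Z 1, by positivity, fun z hz => hZ z ((le_max_left _ _).trans hz)⟩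
  obtain ⟨T, hT⟩ : ∃ T, ∀ t, T ≤ t → d' / 2 * Real.log t ≤ I t := by
    refine eventually_atTop.1 ?_
    filter_upwards [hIlim.eventually (le_mem_nhds (by linarith : d' / 2 < d / 2)),
      eventually_gt_atTop 1] with t ht ht1
    exact (le_div_iff₀ (Real.log_pos ht1)).1 ht
  have hinv : Tendsto (fun v : ℝ => v⁻¹) (𝓝[>] 0) atTop := tendsto_inv_nhdsGT_zero
  refine ⟨max (max T 1) (Real.exp ((1 + r 0 * Z) / (d' - δ'))), ?_⟩
  filter_upwards [self_mem_nhdsWithin, hinv.eventually_ge_atTop Z] with v hv hvZ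
  rintro q ⟨-, hs, hmin, -⟩
  have hv0 : 0 < v := hv
  have hvi : 0 < v⁻¹ := inv_pos.2 hv0
  by_contra hlt
  push Not at hlt
  obtain ⟨h1, h2⟩ := max_lt_iff.1 hlt
  obtain ⟨hTs, h1s⟩ := max_lt_iff.1 h1
  set s := q.2
  have hs0 : 0 < s := by linarith
  have hlogs : 0 < Real.log s := Real.log_pos h1s
  have hG : (∫ z in (0 : ℝ)..v⁻¹, r z) - ∫ z in (0 : ℝ)..(1 / s / v), r z
      ≤ r 0 * Z + δ' * Real.log s := by
    have ha0 : 0 < 1 / s / v := by positivity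
    have hab : 1 / s / v ≤ v⁻¹ := by
      rw [div_eq_mul_inv]
      refine mul_le_of_le_one_left hvi.le ?_
      rw [div_le_one hs0]
      exact h1s.le
    -- If the interval reaches below `Z`, that part contributes at most `r(0) Z`, and the rest has
    -- logarithmic length at most `log s`.
    rcases le_total Z (1 / s / v) with hZa | haZ
    · rw [integral_sub_integral_zero hrc ha0.le hvi.le]
      have h3 := integral_le_log hrc hZ0 hZ hZa hab
      have h4 : v⁻¹ / (1 / s / v) = s := by field_simp
      rw [h4] at h3
      have := mul_pos (hrpos 0 le_rfl) hZ0
      linarith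
    · have h3 := integral_le_log hrc hZ0 hZ le_rfl hvZ
      rw [← integral_sub_integral_zero hrc hZ0.le hvi.le] at h3
      have h4 := integral_le_of_antitone hrc hra le_rfl hZ0.le
      have h5 : 0 ≤ ∫ z in (0 : ℝ)..(1 / s / v), r z :=
        intervalIntegral.integral_nonneg ha0.le fun z hz => (hrpos z hz.1).le
      have h6 : Real.log (v⁻¹ / Z) ≤ Real.log s := by
        refine Real.log_le_log (by positivity) ?_
        rw [div_le_iff₀ hZ0]
        calc v⁻¹ = s * (1 / s / v) := by field_simp
          _ ≤ s * Z := by gcongr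
      have h7 : δ' * Real.log (v⁻¹ / Z) ≤ δ' * Real.log s := by
        have : 0 ≤ δ' := by linarith
        gcongr
      linarith
  have h3 := potential_le_sup (I := I) hrc hv0 s (E := 1 / s)
    ⟨by positivity, by rw [div_le_one hs0]; exact h1s.le⟩
  have h4 : supPotential I r v s ≤ supPotential I r v 0 := hmin (mem_Ici.2 le_rfl)
  have h5 : supPotential I r v 0 ≤ 1 / 2 * ∫ z in (0 : ℝ)..v⁻¹, r z := by
    refine supPotential_le fun E hE => ?_
    have hEv : 0 ≤ E / v := div_nonneg hE.1 hv0.le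
    have hle : E / v ≤ v⁻¹ := by
      rw [div_eq_mul_inv]
      exact mul_le_of_le_one_left hvi.le hE.2
    have h6 : 0 ≤ ∫ z in (E / v)..v⁻¹, r z :=
      intervalIntegral.integral_nonneg hle fun z hz => (hrpos z (hEv.trans hz.1)).le
    rw [← integral_sub_integral_zero hrc hEv hvi.le] at h6
    rw [potential, hI0]
    linarith
  have h6 := hT s hTs.le
  rw [potential] at h3
  have h7 : s * (1 / s) = 1 := by field_simp
  rw [h7] at h3
  have h8 : (1 + r 0 * Z) / (d' - δ') < Real.log s := (Real.lt_log_iff_exp_lt hs0).2 h2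
  rw [div_lt_iff₀ (by linarith)] at h8
  linarith

/-! ### Stationarity and uniqueness of optimizers -/

/-- `m` behaves like twice the derivative of the concave function `I`. -/
def IsSlope (I m : ℝ → ℝ) : Prop :=
  ∀ s t, 0 < s → s < t → (t - s) / 2 * m t ≤ I t - I s ∧ I t - I s ≤ (t - s) / 2 * m s

theorem potential_sub_snd (I r : ℝ → ℝ) (v E s t : ℝ) :
    potential I r v E s - I s = potential I r v E t - I t + (t - s) * E / 2 := by
  simp only [potential]
  ring

theorem potential_sub_fst_le {I r : ℝ → ℝ} (hrc : ContinuousOn r (Ici 0))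
    (hra : AntitoneOn r (Ici 0)) {v : ℝ} (hv : 0 < v) {E F : ℝ} (hE : 0 ≤ E) (hEF : E ≤ F) {s : ℝ}
    (hs : r (E / v) ≤ v * s) : potential I r v F s ≤ potential I r v E s := by
  have hEv : 0 ≤ E / v := div_nonneg hE hv.le
  have hle : E / v ≤ F / v := by gcongr
  have h1 := integral_le_of_antitone hrc hra hEv hle
  rw [← integral_sub_integral_zero hrc hEv (hEv.trans hle)] at h1
  have h2 : r (E / v) * (F / v - E / v) ≤ v * s * (F / v - E / v) :=
    mul_le_mul_of_nonneg_right hs (by linarith)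
  have h3 : v * s * (F / v - E / v) = s * (F - E) := by field_simp
  simp only [potential]
  linarith

theorem potential_sub_fst_ge {I r : ℝ → ℝ} (hrc : ContinuousOn r (Ici 0))
    (hra : AntitoneOn r (Ici 0)) {v : ℝ} (hv : 0 < v) {E F : ℝ} (hE : 0 ≤ E) (hEF : E ≤ F) {s : ℝ}
    (hs : v * s ≤ r (F / v)) : potential I r v E s ≤ potential I r v F s := by
  have hEv : 0 ≤ E / v := div_nonneg hE hv.le
  have hle : E / v ≤ F / v := by gcongr
  have h1 := le_integral_of_antitone hrc hra hEv hle
  rw [← integral_sub_integral_zero hrc hEv (hEv.trans hle)] at h1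
  have h2 : v * s * (F / v - E / v) ≤ r (F / v) * (F / v - E / v) :=
    mul_le_mul_of_nonneg_right hs (by linarith)
  have h3 : v * s * (F / v - E / v) = s * (F - E) := by field_simp
  simp only [potential]
  linarith

/-- Otherwise, by continuity of `r`, a slight increase of `E` would raise the potential. With
`ge_of_optimizer_of_pos` this gives the first stationarity equation. -/
theorem le_of_optimizer_of_lt_one {I r : ℝ → ℝ} (hrc : ContinuousOn r (Ici 0))
    (hra : StrictAntiOn r (Ici 0)) {v : ℝ} (hv : 0 < v) {q : ℝ × ℝ}
    (hq : IsPotentialOptimizer I r v q) (h1 : q.1 < 1) : r (q.1 / v) ≤ v * q.2 := by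
  obtain ⟨hE, -, -, hmax⟩ := hq
  by_contra hlt
  push Not at hlt
  have hEv : 0 ≤ q.1 / v := div_nonneg hE.1 hv.le
  have hcont : ContinuousWithinAt r (Ici 0) (q.1 / v) := hrc _ hEv
  have hev : ∀ᶠ F in 𝓝[>] q.1, v * q.2 < r (F / v) := by
    have ht : Tendsto (fun F : ℝ => F / v) (𝓝[>] q.1) (𝓝[Ici 0] (q.1 / v)) := by
      refine tendsto_nhdsWithin_iff.2 ⟨?_, ?_⟩
      · exact ((continuous_id.div_const v).tendsto q.1).mono_left nhdsWithin_le_nhds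
      · filter_upwards [self_mem_nhdsWithin] with F hF
        exact div_nonneg (hE.1.trans (le_of_lt hF)) hv.le
    exact (hcont.tendsto.comp ht).eventually (lt_mem_nhds hlt)
  obtain ⟨F, hF, hF1, hF2⟩ := (hev.and (Ioo_mem_nhdsGT h1)).exists
  have h2 : potential I r v F q.2 ≤ potential I r v q.1 q.2 := hmax ⟨hE.1.trans hF1.le, hF2.le⟩
  have hle : q.1 / v ≤ F / v := by gcongr
  have h3 := le_integral_of_antitone hrc hra.antitoneOn hEv hle
  rw [← integral_sub_integral_zero hrc hEv (hEv.trans hle)] at h3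
  have h4 : v * q.2 * (F / v - q.1 / v) < r (F / v) * (F / v - q.1 / v) :=
    mul_lt_mul_of_pos_right hF (by rw [← sub_div]; exact div_pos (by linarith) hv)
  have h5 : v * q.2 * (F / v - q.1 / v) = q.2 * (F - q.1) := by field_simp
  simp only [potential] at h2
  linarith

theorem ge_of_optimizer_of_pos {I r : ℝ → ℝ} (hrc : ContinuousOn r (Ici 0))
    (hra : AntitoneOn r (Ici 0)) {v : ℝ} (hv : 0 < v) {q : ℝ × ℝ}
    (hq : IsPotentialOptimizer I r v q) (h0 : 0 < q.1) : v * q.2 ≤ r (q.1 / v) := by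
  have hq1 : 0 ≤ q.1 / v := div_nonneg h0.le hv.le
  have ht : Tendsto (fun E : ℝ => r (E / v)) (𝓝[<] q.1) (𝓝 (r (q.1 / v))) := by
    refine (hrc _ hq1).tendsto.comp (tendsto_nhdsWithin_iff.2 ⟨?_, ?_⟩)
    · exact ((continuous_id.div_const v).tendsto q.1).mono_left nhdsWithin_le_nhds
    · filter_upwards [Ioo_mem_nhdsLT h0] with E hE
      exact div_nonneg hE.1.le hv.le
  refine ge_of_tendsto ht ?_
  filter_upwards [Ioo_mem_nhdsLT h0] with E hE
  have := snd_optimizer_le_of_le_fst hrc hra hv hq hE.1.le hE.2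
  rw [le_div_iff₀ hv] at this
  linarith

/-- An envelope argument without differentiating the supremum. For `F > E` and `t < s` close to `s`,
strict decrease of `r` confines the competing `E`-values at `t` to `[0, F]`, so lowering `s` to `t`
raises the linear part by at most `(s - t)F/2`. Minimality at `s` then gives `m(s) ≤ F`. -/
theorem slope_le_fst_optimizer {I m r : ℝ → ℝ} (hrc : ContinuousOn r (Ici 0))
    (hra : StrictAntiOn r (Ici 0)) (hm : IsSlope I m) {v : ℝ} (hv : 0 < v) {q : ℝ × ℝ}
    (hq : IsPotentialOptimizer I r v q) (h1 : q.1 < 1) (hs : 0 < q.2) : m q.2 ≤ q.1 := by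
  have hle := le_of_optimizer_of_lt_one hrc hra hv hq h1
  obtain ⟨hE, -, hmin, hmax⟩ := hq
  refine le_of_forall_gt_imp_ge_of_dense fun F hF => ?_
  have hFE : r (F / v) < v * q.2 :=
    (hra (div_nonneg hE.1 hv.le) (div_nonneg (hE.1.trans hF.le) hv.le)
      (by gcongr)).trans_le hle
  have hlt : max 0 (r (F / v) / v) < q.2 := by
    refine max_lt hs ?_
    rw [div_lt_iff₀ hv]
    linarith
  obtain ⟨t, ht1, ht2⟩ := exists_between hlt
  obtain ⟨ht0, htF⟩ := max_lt_iff.1 ht1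
  rw [div_lt_iff₀ hv] at htF
  have hF0 : 0 ≤ F := hE.1.trans hF.le
  have hsup : supPotential I r v q.2 = potential I r v q.1 q.2 := supPotential_eq hrc hv hE hmax
  have hbd : supPotential I r v t ≤ I t + (potential I r v q.1 q.2 - I q.2) + (q.2 - t) * F / 2 := by
    refine supPotential_le fun G hG => ?_
    have key : ∀ G ∈ Icc (0 : ℝ) 1, G ≤ F → potential I r v G t
        ≤ I t + (potential I r v q.1 q.2 - I q.2) + (q.2 - t) * F / 2 := by
      intro G hG hGF
      have h2 := potential_sub_snd I r v G t q.2
      have h3 : potential I r v G q.2 ≤ potential I r v q.1 q.2 := hmax hG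
      have h4 : (q.2 - t) * G ≤ (q.2 - t) * F := mul_le_mul_of_nonneg_left hGF (by linarith)
      linarith
    rcases le_total G F with h | h
    · exact key G hG h
    · exact (potential_sub_fst_le hrc hra.antitoneOn hv hF0 h (by linarith)).trans
        (key F ⟨hF0, h.trans hG.2⟩ le_rfl)
  have h2 : supPotential I r v q.2 ≤ supPotential I r v t := hmin (mem_Ici.2 ht0.le)
  have h3 := (hm t q.2 ht0 ht2).1
  rw [hsup] at h2
  have h4 : (q.2 - t) * m q.2 ≤ (q.2 - t) * F := by linarith
  exact le_of_mul_le_mul_left h4 (by linarith)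

/-- The mirror image, raising `s` slightly so that maximization at `t` may be restricted to
`E`-values at least `F < E`. -/
theorem fst_optimizer_le_slope {I m r : ℝ → ℝ} (hrc : ContinuousOn r (Ici 0))
    (hra : StrictAntiOn r (Ici 0)) (hm : IsSlope I m) {v : ℝ} (hv : 0 < v) {q : ℝ × ℝ}
    (hq : IsPotentialOptimizer I r v q) (h0 : 0 < q.1) (hs : 0 < q.2) : q.1 ≤ m q.2 := by
  have hge := ge_of_optimizer_of_pos hrc hra.antitoneOn hv hq h0
  obtain ⟨hE, -, hmin, hmax⟩ := hq
  refine le_of_forall_lt_imp_le_of_dense fun F' hF' => ?_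
  -- Clipping keeps `F` positive, hence in the domain of `r`.
  set F := max F' (q.1 / 2) with hFdef
  have hF : F < q.1 := max_lt hF' (by linarith)
  have hF0 : 0 < F := lt_max_of_lt_right (by linarith)
  refine (le_max_left F' (q.1 / 2)).trans ?_
  rw [← hFdef]
  have hFE : v * q.2 < r (F / v) :=
    hge.trans_lt (hra (div_nonneg hF0.le hv.le) (div_nonneg hE.1 hv.le) (by gcongr))
  have hlt : q.2 < r (F / v) / v := by
    rw [lt_div_iff₀ hv]
    linarith
  obtain ⟨t, ht1, ht2⟩ := exists_between hlt
  rw [lt_div_iff₀ hv] at ht2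
  have hsup : supPotential I r v q.2 = potential I r v q.1 q.2 := supPotential_eq hrc hv hE hmax
  have hbd : supPotential I r v t ≤ I t + (potential I r v q.1 q.2 - I q.2) - (t - q.2) * F / 2 := by
    refine supPotential_le fun G hG => ?_
    have key : ∀ G ∈ Icc (0 : ℝ) 1, F ≤ G → potential I r v G t
        ≤ I t + (potential I r v q.1 q.2 - I q.2) - (t - q.2) * F / 2 := by
      intro G hG hGF
      have h2 := potential_sub_snd I r v G t q.2
      have h3 : potential I r v G q.2 ≤ potential I r v q.1 q.2 := hmax hG
      have h4 : (t - q.2) * F ≤ (t - q.2) * G := mul_le_mul_of_nonneg_left hGF (by linarith)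
      linarith
    rcases le_total F G with h | h
    · exact key G hG h
    · exact (potential_sub_fst_ge hrc hra.antitoneOn hv hG.1 h (by linarith)).trans
        (key F ⟨hF0.le, hF.le.trans hE.2⟩ le_rfl)
  have h2 : supPotential I r v q.2 ≤ supPotential I r v t := hmin (mem_Ici.2 (by linarith))
  have h3 := (hm q.2 t hs ht1).2
  rw [hsup] at h2
  have h4 : (t - q.2) * F ≤ (t - q.2) * m q.2 := by linarith
  exact le_of_mul_le_mul_left h4 (by linarith)

/-! ### Slow variation of `t m(t)` and uniqueness -/

theorem le_of_slope_relation {a b c K L κ τ ε w lam : ℝ} (hκ : 0 < κ) (hτ : 0 ≤ τ) (hw : 0 ≤ w)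
    (hlam0 : 0 ≤ lam) (hlam1 : lam ≤ 1) (hlam2 : 1 - lam ≤ 2 * κ) (hL : 0 ≤ L)
    (hab : -(2 * τ) ≤ a - b) (hcb : -(2 * τ) ≤ c - b) (hbK : -L ≤ b - K)
    (hκL : 2 * κ * L = ε / 2) (hτε : 2 * τ / κ + 2 * τ ≤ ε / 2)
    (h : a - b ≤ -w * (lam * ((c - b) / κ) + (1 - lam) * (b - K) + (a - b))) : a - b ≤ ε * w := by
  have h0 : 0 ≤ 2 * τ / κ := by positivity
  have h1 : -(2 * τ / κ) ≤ (c - b) / κ := by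
    rw [← neg_div]
    exact div_le_div_of_nonneg_right hcb hκ.le
  have h2 : -(2 * τ / κ) ≤ lam * ((c - b) / κ) := by
    have h3 : lam * -(2 * τ / κ) ≤ lam * ((c - b) / κ) := mul_le_mul_of_nonneg_left h1 hlam0
    have h4 : lam * (2 * τ / κ) ≤ 1 * (2 * τ / κ) := mul_le_mul_of_nonneg_right hlam1 h0
    linarith
  have h3 : -(2 * κ * L) ≤ (1 - lam) * (b - K) := by
    have h4 : (1 - lam) * -L ≤ (1 - lam) * (b - K) :=
      mul_le_mul_of_nonneg_left hbK (by linarith)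
    have h5 : (1 - lam) * L ≤ 2 * κ * L := mul_le_mul_of_nonneg_right hlam2 hL
    linarith
  have h4 : w * -ε ≤ w * (lam * ((c - b) / κ) + (1 - lam) * (b - K) + (a - b)) :=
    mul_le_mul_of_nonneg_left (by linarith) hw
  linarith

/-- One-sided Tauberian estimate: if `m t - K / t` is concave and `t m(t)` converges, then `t m(t)`
varies slowly on the logarithmic scale. -/
theorem eventually_mul_slope_sub_le {m : ℝ → ℝ} {K D : ℝ}
    (hc : ConcaveOn ℝ (Ioi 0) (fun t => m t - K / t))
    (hD : Tendsto (fun t => t * m t) atTop (𝓝 D)) {ε : ℝ} (hε : 0 < ε) :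
    ∃ S, 0 < S ∧ ∀ s t, S ≤ s → s < t → s * m s - t * m t ≤ ε * ((t - s) / s) := by
  -- `L` bounds `|t m(t) - K|` far out, `κ` is the relative step to a third point, and `τ` is the
  -- tolerance of `t m(t)` around `D`, small compared with `ε κ`.
  set L := |D| + 1 + |K| with hL
  have hL0 : 1 ≤ L := by
    have := abs_nonneg D
    have := abs_nonneg K
    linarith
  set κ := ε / (4 * L) with hκ
  have hκ0 : 0 < κ := by positivity
  have hκL : 2 * κ * L = ε / 2 := by rw [hκ]; field_simp; norm_num
  obtain ⟨τ, hτ0, hτ1, hτ2, hτ3⟩ : ∃ τ : ℝ, 0 < τ ∧ τ ≤ 1 ∧ 2 * τ / κ + 2 * τ ≤ ε / 2 ∧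
      2 * τ ≤ ε * κ := by
    refine ⟨min 1 (min (ε / 2 / (2 / κ + 2)) (ε * κ / 2)), by positivity, min_le_left _ _, ?_, ?_⟩
    · have h1 : min 1 (min (ε / 2 / (2 / κ + 2)) (ε * κ / 2)) ≤ ε / 2 / (2 / κ + 2) :=
        (min_le_right _ _).trans (min_le_left _ _)
      rw [le_div_iff₀ (by positivity)] at h1
      refine le_trans (le_of_eq ?_) h1
      ring
    · have h1 : min 1 (min (ε / 2 / (2 / κ + 2)) (ε * κ / 2)) ≤ ε * κ / 2 :=
        (min_le_right _ _).trans (min_le_right _ _)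
      linarith
  obtain ⟨S, hS⟩ := eventually_atTop.1 (hD.eventually (Metric.ball_mem_nhds D hτ0))
  have hSb : ∀ t, S ≤ t → |t * m t - D| < τ := fun t ht => by
    simpa [Real.dist_eq] using hS t ht
  refine ⟨max S 1, by positivity, fun s t hs hst => ?_⟩
  have hs0 : 0 < s := lt_of_lt_of_le (by positivity) hs
  have ht0 : 0 < t := hs0.trans hst
  have hSs : S ≤ s := (le_max_left _ _).trans hs
  have hs1 := abs_lt.1 (hSb s hSs)
  have ht1 := abs_lt.1 (hSb t (hSs.trans hst.le))
  rcases le_or_gt t ((1 + κ) * s) with hκt | hκt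
  -- Concavity bounds the slope on `[s, t]` below by the slope on `[t, u]`. The latter is controlled
  -- because `u` is at a fixed relative distance from `t`, so dividing the tolerance by `κ` is
  -- harmless however close `s` and `t` are.
  · set u := (1 + κ) * t with hu
    have htu : t < u := by rw [hu]; nlinarith
    have hu1 := abs_lt.1 (hSb u (hSs.trans (hst.le.trans htu.le)))
    have hslope := hc.slope_anti_adjacent (mem_Ioi.2 hs0) (mem_Ioi.2 (ht0.trans htu)) hst htu
    set a := s * m s with ha
    set b := t * m t with hb
    set c := u * m u with hcdef
    have ems : m s = a / s := by rw [ha]; field_simp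
    have emt : m t = b / t := by rw [hb]; field_simp
    have hu0 : 0 < u := ht0.trans htu
    have emu : m u = c / u := by rw [hcdef]; field_simp
    rw [ems, emt, emu, ← sub_div, ← sub_div, ← sub_div] at hslope
    have hut : u - t = κ * t := by rw [hu]; ring
    have hts : 0 < t - s := by linarith
    have e1 : ((c - K) / u - (b - K) / t) / (u - t)
        = ((c - b) / κ - (b - K)) / ((1 + κ) * t ^ 2) := by
      rw [hut, hu]
      field_simp
      ring
    rw [e1, le_div_iff₀ hts] at hslope
    set lam := s / ((1 + κ) * t) with hlam
    have hlam1 : lam ≤ 1 := by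
      rw [hlam, div_le_one (by positivity)]
      nlinarith
    have hlam0 : 0 ≤ lam := by positivity
    have hlam2 : 1 - lam ≤ 2 * κ := by
      have : 1 - 2 * κ ≤ lam := by
        rw [hlam, le_div_iff₀ (by positivity)]
        rcases le_or_gt (1 - 2 * κ) 0 with h | h
        · have : (1 - 2 * κ) * ((1 + κ) * t) ≤ 0 :=
            mul_nonpos_of_nonpos_of_nonneg h (by positivity)
          linarith
        · have h2 : (1 - 2 * κ) * ((1 + κ) * t) ≤ (1 - 2 * κ) * ((1 + κ) * ((1 + κ) * s)) := by
            gcongr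
          have h3 : (1 - 2 * κ) * ((1 + κ) * ((1 + κ) * s))
              = s - (3 * κ ^ 2 + 2 * κ ^ 3) * s := by ring
          have : 0 ≤ (3 * κ ^ 2 + 2 * κ ^ 3) * s := by positivity
          linarith
      linarith
    have hmain : a - b ≤ -((t - s) / s) * (lam * ((c - b) / κ) + (1 - lam) * (b - K) + (a - b)) := by
      have h2 : t * (((c - b) / κ - (b - K)) / ((1 + κ) * t ^ 2) * (t - s))
          ≤ t * ((b - K) / t - (a - K) / s) := mul_le_mul_of_nonneg_left hslope ht0.le
      have h3 : t * ((b - K) / t - (a - K) / s) = b - a - (t - s) / s * (a - K) := by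
        field_simp
        ring
      have h4 : t * (((c - b) / κ - (b - K)) / ((1 + κ) * t ^ 2) * (t - s))
          = (t - s) / s * (lam * ((c - b) / κ - (b - K))) := by
        rw [hlam]
        field_simp
      rw [h3, h4] at h2
      linarith
    have hD1 := neg_abs_le D
    have hK1 := le_abs_self K
    exact le_of_slope_relation hκ0 hτ0.le (div_nonneg hts.le hs0.le) hlam0 hlam1 hlam2 (by linarith)
      (by linarith) (by linarith) (by linarith) hκL hτ2 hmain
  -- Far apart points need no concavity: the total oscillation is at most `2τ ≤ ε κ`.
  · have h1 : ε * κ ≤ ε * ((t - s) / s) := by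
      gcongr
      rw [le_div_iff₀ hs0]
      linarith
    linarith

theorem hasDerivAt_of_isSlope {I m : ℝ → ℝ} (hm : IsSlope I m) {s : ℝ} (hs : 0 < s)
    (hc : ContinuousAt m s) : HasDerivAt I (m s / 2) s := by
  rw [hasDerivAt_iff_tendsto_slope]
  have h1 : Tendsto (fun t => m t / 2) (𝓝[≠] s) (𝓝 (m s / 2)) :=
    (hc.tendsto.div_const 2).mono_left nhdsWithin_le_nhds
  have h2 : Tendsto (fun _ : ℝ => m s / 2) (𝓝[≠] s) (𝓝 (m s / 2)) := tendsto_const_nhds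
  have hmin := h1.min h2
  have hmax := h1.max h2
  rw [min_self] at hmin
  rw [max_self] at hmax
  have hpos : ∀ᶠ t in 𝓝[≠] s, 0 < t := nhdsWithin_le_nhds (lt_mem_nhds hs)
  refine tendsto_of_tendsto_of_tendsto_of_le_of_le' hmin hmax ?_ ?_
  all_goals
    filter_upwards [self_mem_nhdsWithin, hpos] with t hne ht
    rw [slope_def_field]
    rcases lt_or_gt_of_ne hne with h | h
    · have h3 := hm t s ht h
      have hneg : t - s < 0 := by linarith
      first
      | refine (min_le_right _ _).trans ?_
        rw [le_div_iff_of_neg hneg]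
        linarith [h3.1]
      | refine le_trans ?_ (le_max_left _ _)
        rw [div_le_iff_of_neg hneg]
        linarith [h3.2]
    · have h3 := hm s t hs h
      have hp : 0 < t - s := by linarith
      first
      | refine (min_le_left _ _).trans ?_
        rw [le_div_iff₀ hp]
        linarith [h3.1]
      | refine le_trans ?_ (le_max_right _ _)
        rw [div_le_iff₀ hp]
        linarith [h3.2]

/-- The limit of `t m(t)` is at most twice the logarithmic growth rate of `I`. -/
theorem slope_limit_le {I m : ℝ → ℝ} (hm : IsSlope I m) (hc : ContinuousOn m (Ioi 0)) {d D : ℝ}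
    (hIlim : Tendsto (fun t => I t / Real.log t) atTop (𝓝 (d / 2)))
    (hD : Tendsto (fun t => t * m t) atTop (𝓝 D)) : D ≤ d := by
  refine le_of_forall_lt_imp_le_of_dense fun D' hD' => ?_
  obtain ⟨S, hS⟩ := eventually_atTop.1 (hD.eventually (le_mem_nhds hD'))
  set T := max S 1
  have hT0 : 0 < T := by positivity
  have hder : ∀ t, T ≤ t → HasDerivAt (fun t => I t - D' / 2 * Real.log t)
      (m t / 2 - D' / 2 * t⁻¹) t := fun t ht => by
    have ht0 := hT0.trans_le ht
    exact (hasDerivAt_of_isSlope hm ht0 (hc.continuousAt (Ioi_mem_nhds ht0))).sub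
      ((Real.hasDerivAt_log ht0.ne').const_mul _)
  have hmono : MonotoneOn (fun t => I t - D' / 2 * Real.log t) (Ici T) := by
    refine monotoneOn_of_deriv_nonneg (convex_Ici T)
      (fun t ht => (hder t ht).continuousAt.continuousWithinAt) ?_ ?_
    · rw [interior_Ici]
      exact fun t ht => (hder t (le_of_lt ht)).differentiableAt.differentiableWithinAt
    · rw [interior_Ici]
      intro t ht
      have htT : T < t := ht
      have ht0 := hT0.trans htT
      rw [(hder t htT.le).deriv]
      have h1 : D' ≤ t * m t := hS t ((le_max_left _ _).trans htT.le)
      have h2 : D' * t⁻¹ ≤ m t := by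
        rw [← div_eq_mul_inv, div_le_iff₀ ht0]
        linarith
      linarith
  have hlog : Tendsto Real.log atTop atTop := Real.tendsto_log_atTop
  have h1 : Tendsto (fun t => (I T - D' / 2 * Real.log T) / Real.log t + D' / 2) atTop
      (𝓝 (0 + D' / 2)) := (hlog.const_div_atTop _).add tendsto_const_nhds
  have h2 : 0 + D' / 2 ≤ d / 2 := by
    refine le_of_tendsto_of_tendsto h1 hIlim ?_
    filter_upwards [eventually_ge_atTop T, eventually_gt_atTop 1] with t ht ht1
    have hl := Real.log_pos ht1
    have h3 : I T - D' / 2 * Real.log T ≤ I t - D' / 2 * Real.log t :=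
      hmono (mem_Ici.2 le_rfl) ht ht
    rw [le_div_iff₀ hl, add_mul, div_mul_cancel₀ _ hl.ne']
    linarith
  linarith

/-- Stationarity puts every optimizer on the curve `s m(s) = z r(z)`, `v s = r(z)`, with `z = E/v`.
For two optimizers with `s < s'`, `z r(z)` must drop at a fixed rate times the change in `r`,
whereas `s m(s)` drops at most half as fast. -/
theorem eventually_unique_optimizer {I m r : ℝ → ℝ} (hrc : ContinuousOn r (Ici 0))
    (hra : StrictAntiOn r (Ici 0)) (hrpos : ∀ z, 0 ≤ z → 0 < r z) {δ D K : ℝ}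
    (hrlim : Tendsto (fun z => z * r z) atTop (𝓝 δ))
    (hinc : ∀ Z, 0 < Z → ∃ c > 0, ∀ z₁ z₂ : ℝ, 0 < z₂ → z₂ < z₁ → z₁ ≤ Z →
      c * (r z₂ - r z₁) ≤ z₁ * r z₁ - z₂ * r z₂)
    (hm : IsSlope I m) (hmpos : ∀ s, 0 < s → 0 < m s)
    (hc : ConcaveOn ℝ (Ioi 0) (fun t => m t - K / t))
    (hD : Tendsto (fun t => t * m t) atTop (𝓝 D)) (hDδ : D < δ)
    (hbig : ∀ S : ℝ, ∀ᶠ v in 𝓝[>] (0 : ℝ), ∀ q, IsPotentialOptimizer I r v q → S < q.2) :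
    ∀ᶠ v in 𝓝[>] (0 : ℝ), ∀ q q', IsPotentialOptimizer I r v q →
      IsPotentialOptimizer I r v q' → q = q' := by
  obtain ⟨θ, hDθ, hθδ⟩ := exists_between hDδ
  obtain ⟨Z, hZ0, hZ⟩ : ∃ Z, 0 < Z ∧ ∀ z, Z ≤ z → θ < z * r z := by
    obtain ⟨Z, hZ⟩ := eventually_atTop.1 (hrlim.eventually (lt_mem_nhds hθδ))
    exact ⟨max Z 1, by positivity, fun z hz => hZ z ((le_max_left _ _).trans hz)⟩
  obtain ⟨c, hc0, hcinc⟩ := hinc Z hZ0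
  have hρ := hrpos Z hZ0.le
  -- After normalizing by `r z ≥ r Z`, the rate becomes `c / 2`, strictly below `c`.
  obtain ⟨S, hS0, hS⟩ := eventually_mul_slope_sub_le hc hD (ε := c * r Z / 2) (by positivity)
  obtain ⟨T, hT⟩ := eventually_atTop.1 (hD.eventually (gt_mem_nhds hDθ))
  filter_upwards [self_mem_nhdsWithin, hbig (max S T),
    eventually_fst_optimizer_lt hrc hra.antitoneOn hrlim hbig one_pos] with v hv hv1 hv2
  have hv0 : 0 < v := hv
  have key : ∀ q, IsPotentialOptimizer I r v q → 0 < q.1 ∧ S < q.2 ∧ m q.2 = q.1 ∧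
      v * q.2 = r (q.1 / v) ∧ q.2 * m q.2 = q.1 / v * r (q.1 / v) ∧ q.1 / v < Z := by
    intro q hq
    obtain ⟨hSq, hTq⟩ := max_lt_iff.1 (hv1 q hq)
    have hs0 := hS0.trans hSq
    have hle := slope_le_fst_optimizer hrc hra hm hv0 hq (hv2 q hq) hs0
    have hE0 : 0 < q.1 := (hmpos q.2 hs0).trans_le hle
    have heq : m q.2 = q.1 := le_antisymm hle (fst_optimizer_le_slope hrc hra hm hv0 hq hE0 hs0)
    have hr : v * q.2 = r (q.1 / v) :=
      le_antisymm (ge_of_optimizer_of_pos hrc hra.antitoneOn hv0 hq hE0)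
        (le_of_optimizer_of_lt_one hrc hra hv0 hq (hv2 q hq))
    have hprod : q.2 * m q.2 = q.1 / v * r (q.1 / v) := by
      rw [← hr, heq]
      field_simp
    -- Large `z` is impossible: there `z r(z) > θ`, while `s m(s) < θ` for the large `s` in
    -- question.
    refine ⟨hE0, hSq, heq, hr, hprod, ?_⟩
    by_contra hge
    push Not at hge
    have h1 := hZ _ hge
    have h2 := hT q.2 hTq.le
    linarith
  have hlt : ∀ q q', IsPotentialOptimizer I r v q → IsPotentialOptimizer I r v q' →
      ¬ q.2 < q'.2 := by
    intro q q' hq hq' hlt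
    obtain ⟨hE, hs, -, hr, hp, hz⟩ := key q hq
    obtain ⟨hE', -, -, hr', hp', -⟩ := key q' hq'
    have hz0 : 0 < q.1 / v := div_pos hE hv0
    have hz0' : 0 < q'.1 / v := div_pos hE' hv0
    have hrr : r (q.1 / v) < r (q'.1 / v) := by
      rw [← hr, ← hr']
      gcongr
    have hzz : q'.1 / v < q.1 / v := (hra.lt_iff_gt hz0.le hz0'.le).1 hrr
    have h1 := hcinc _ _ hz0' hzz hz.le
    have h2 := hS q.2 q'.2 hs.le hlt
    rw [hp, hp'] at h2
    have hs0 : 0 < q.2 := hS0.trans hs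
    -- Since `v s = r(z)` at both points, relative increments of `s` and of `r` agree and `v` drops
    -- out.
    have h3 : (q'.2 - q.2) / q.2 = (r (q'.1 / v) - r (q.1 / v)) / r (q.1 / v) := by
      rw [← hr, ← hr']
      field_simp
    have hrZ : r Z ≤ r (q.1 / v) := hra.antitoneOn hz0.le hZ0.le hz.le
    have h4 : (r (q'.1 / v) - r (q.1 / v)) / r (q.1 / v)
        ≤ (r (q'.1 / v) - r (q.1 / v)) / r Z :=
      div_le_div_of_nonneg_left (by linarith) hρ hrZ
    rw [h3] at h2
    have h5 : c * r Z / 2 * ((r (q'.1 / v) - r (q.1 / v)) / r (q.1 / v))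
        ≤ c * r Z / 2 * ((r (q'.1 / v) - r (q.1 / v)) / r Z) :=
      mul_le_mul_of_nonneg_left h4 (by positivity)
    have h6 : c * r Z / 2 * ((r (q'.1 / v) - r (q.1 / v)) / r Z)
        = c / 2 * (r (q'.1 / v) - r (q.1 / v)) := by field_simp
    have h7 : 0 < c * (r (q'.1 / v) - r (q.1 / v)) := mul_pos hc0 (by linarith)
    linarith
  intro q q' hq hq'
  have h2 : q.2 = q'.2 :=
    le_antisymm (not_lt.1 (hlt q' q hq' hq)) (not_lt.1 (hlt q q' hq hq'))
  have h1 : q.1 = q'.1 := by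
    rw [← (key q hq).2.2.1, ← (key q' hq').2.2.1, h2]
  exact Prod.ext h1 h2

end CompressedSensing

/-! ### The phase transition for the replica-symmetric potential -/

open MeasureTheory ProbabilityTheory Filter Topology Set CompressedSensing in
theorem mainTheorem3
    {Ω : Type*} [MeasurableSpace Ω] (P : Measure Ω) [IsProbabilityMeasure P]
    (M N : ℕ → ℕ) (A : (k : ℕ) → Ω → Matrix (Fin (M k)) (Fin (N k)) ℝ)
    (δ : ℝ) (hN : Tendsto N atTop atTop)
    (hM : Tendsto (fun k => (M k : ℝ) / (N k : ℝ)) atTop (𝓝 δ))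
    (ν : Measure ℝ) [IsProbabilityMeasure ν] (hA : HasLimitingSpectrum P A ν)
    (hmoments : ∀ j : ℕ, Integrable (fun x : ℝ => x ^ j) ν)
    (p : Measure ℝ) [IsProbabilityMeasure p] (hp : ∫ x, x ^ 2 ∂p = 1)
    (dI : ℝ) (hdI : HasRenyiInfoDim p dI)
    (hRproper : RTransformProper ν)
    (hRcont : ContinuousOn (rTransform ν) (Iic 0))
    (hRmono : MonotoneOn (rTransform ν) (Iic 0))
    (hRpos : ∀ z ≤ 0, 0 < rTransform ν z)
    (hRlim : Tendsto (fun z => z * rTransform ν (-z)) atTop (𝓝 δ)) :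
    (∀ v : ℝ, 0 < v → ∃ q, IsInfSupOptimizer p ν v q) ∧
    (δ ≠ dI → ∀ Q : ℝ → ℝ × ℝ, (∀ᶠ v in 𝓝[>] 0, IsInfSupOptimizer p ν v (Q v)) →
      (NoiseLimited Q ↔ dI < δ)) ∧
    (dI < δ →
      (∀ ε > 0, ∀ S : ℝ, ∀ᶠ v in 𝓝[>] (0 : ℝ), ∀ q, IsInfSupOptimizer p ν v q →
        q.1 < ε ∧ S < q.2) ∧
      (HasMMSEDimension p → 0 < variance id p →
        ∀ᶠ v in 𝓝[>] (0 : ℝ), ∃! q, IsInfSupOptimizer p ν v q)) := by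
  set I := mutualInfo p with hI
  set r : ℝ → ℝ := fun z => rTransform ν (-z) with hr
  have hν := hA.ae_nonneg
  have hint1 : Integrable (fun x : ℝ => x) ν := by simpa using hmoments 1
  have hp2 := integrable_sq_of_integral_eq_one hp
  have hrc : ContinuousOn r (Ici 0) :=
    hRcont.comp continuousOn_neg fun z (hz : 0 ≤ z) => mem_Iic.2 (neg_nonpos.2 hz)
  have hrs : StrictAntiOn r (Ici 0) := strictAntiOn_rTransform_neg hν hint1 hRproper hRmono
  have hrpos : ∀ z, 0 ≤ z → 0 < r z := fun z hz => hRpos _ (neg_nonpos.2 hz)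
  have hopt : ∀ v q, IsInfSupOptimizer p ν v q ↔ IsPotentialOptimizer I r v q :=
    fun _ _ => Iff.rfl
  have hIlim := tendsto_mutualInfo_div_log hp2 hdI
  have hex : ∀ v : ℝ, 0 < v → ∃ q, IsInfSupOptimizer p ν v q := fun v hv =>
    exists_potentialOptimizer hrc hrs.antitoneOn (hrpos 0 le_rfl) (continuousOn_mutualInfo hp2)
      (monotoneOn_mutualInfo hp2) hv
  have hbig : dI < δ → ∀ S : ℝ, ∀ᶠ v in 𝓝[>] (0 : ℝ), ∀ q, IsPotentialOptimizer I r v q →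
      S < q.2 := fun h S =>
    eventually_lt_snd_optimizer hrc hrs.antitoneOn hrpos hRlim (mutualInfo_nonneg p) hIlim h S
  have hsmall : dI < δ → ∀ ε > 0, ∀ᶠ v in 𝓝[>] (0 : ℝ), ∀ q, IsPotentialOptimizer I r v q →
      q.1 < ε := fun h ε hε =>
    eventually_fst_optimizer_lt hrc hrs.antitoneOn hRlim (hbig h) hε
  refine ⟨hex, fun hne Q hQ => ⟨fun hNL => ?_, fun h => ⟨?_, ?_⟩⟩, fun h => ⟨fun ε hε S => ?_,
    fun ⟨D, hD⟩ hvar => ?_⟩⟩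
  · by_contra hle
    have hlt : δ < dI := lt_of_le_of_ne (not_lt.1 hle) hne
    obtain ⟨S, hS⟩ := exists_snd_optimizer_le hrc hrs.antitoneOn hrpos hRlim (mutualInfo_zero hp2)
      hIlim hlt
    obtain ⟨v, hv1, hv2, hv3⟩ := (hQ.and (hS.and (hNL.2.eventually_gt_atTop S))).exists
    exact absurd (hv2 _ hv1) (not_le.2 hv3)
  · rw [Metric.tendsto_nhds]
    intro ε hε
    filter_upwards [hQ, hsmall h ε hε] with v hv1 hv2
    rw [Real.dist_eq, sub_zero, abs_of_nonneg hv1.1.1]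
    exact hv2 _ hv1
  · rw [tendsto_atTop]
    intro S
    filter_upwards [hQ, hbig h S] with v hv1 hv2
    exact (hv2 _ hv1).le
  · filter_upwards [hsmall h ε hε, hbig h S] with v hv1 hv2 q hq
    exact ⟨hv1 q hq, hv2 q hq⟩
  · have hslope : IsSlope I (mmse p) := fun s t hs hst => mutualInfo_increment hp2 hs hst
    have hconc := concaveOn_mmse_sub hp2
    have hcont : ContinuousOn (mmse p) (Ioi 0) := by
      have h1 := (hconc.continuousOn isOpen_Ioi).add
        ((continuousOn_const (c := sixthMoment)).div continuousOn_id fun t ht => ne_of_gt ht)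
      refine h1.congr fun t _ => ?_
      simp
    -- Only `D ≤ dI` is needed, which leaves the strict gap `D < δ`.
    have hDd := slope_limit_le hslope hcont hIlim hD
    have huniq := eventually_unique_optimizer hrc hrs hrpos hRlim
      (fun Z hZ => exists_mul_rTransform_increment hν hint1 (hmoments 2) hRproper hZ) hslope
      (fun s hs => mmse_pos hp2 hvar hs.le) hconc hD (hDd.trans_lt h) (hbig h)
    filter_upwards [self_mem_nhdsWithin, huniq] with v hv hv1
    obtain ⟨q, hq⟩ := hex v hv
    exact ⟨q, hq, fun q' hq' => hv1 q' q hq' hq⟩
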